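/- Let $k$ be a commutative ring. A bicomplex is a family of $k$-modules $X_{p,q}$ ($p,q\in\mathbb Z$) with $X_{p,q}=0$ for $p<0$, with differentials $d_h\colon X_{p,q}\to X_{p-1,q}$ and $d_v\colon X_{p,q}\to X_{p,q-1}$ satisfying $d_h^2=0$, $d_v^2=0$ and $d_vd_h+d_hd_v=0$; morphisms are families of linear maps commuting with both differentials. Let $\operatorname{bCh}$ be the category of bicomplexes. Its symmetric monoidal structure has $$(X\otimes Y)_{p,q}=\bigoplus_{m+s=p,\;n+t=q}X_{m,n}\otimes_k Y_{s,t},\qquad d(x\otimes y)=d(x)\otimes y+(-1)^{|x|}x\otimes d(y)\quad (d=d_h,d_v),$$ where $|x|=m+n$ for $x\in X_{m,n}$, unit $k$ concentrated in bidegree $(0,0)$, and symmetry $x\otimes y\mapsto(-1)^{|x||y|}y\otimes x$. The total complex $\operatorname{Tot}(X)$ is $\bigoplus_{p+q=n}X_{p,q}$ in degree $n$ with differential $d_h+d_v$. Proposition 3.3. The category $\operatorname{bCh}$ has a model structure $\operatorname{bCh}_{\operatorname{Tot}}$, the total model structure, in which a map $f$ is a weak equivalence if and only if $\operatorname{Tot}(f)$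 is a quasi-isomorphism, and a fibration if and only if every $f_{p,q}$ is surjective and $f$ induces isomorphisms $H^v_{p,q}(f)$ on homology with respect to $d_v$ for all $p>0$ and $q\in\mathbb Z$ (the cofibrations are then the maps with the left lifting property against all fibrations that are weak equivalences). Moreover: 1. $\operatorname{bCh}_{\operatorname{Tot}}$ is a monoidal model category: the tensor product is closed; the pushout-product $f\mathbin{\square}g$ of two cofibrations is a cofibration, and it is a trivial cofibration if $f$ or $g$ is one; and for every weak equivalence $Q\to\mathbf 1$ to the unit with $Q$ cofibrant and every cofibrant $X$, the maps $Q\otimes X\to\mathbf 1\otimes X$ and $X\otimes Q\to X\otimes\mathbf 1$ are weak equivalences. 2. The unit $\mathbf 1$ is cofibrant. 3. The Schwede–Shipley monoid axiom holds: every transfinite composition of pushouts of maps of the form $j\otimes Z\colon A\otimes Z\to B\otimes Z$, with $j\colon A\to B$ a trivial cofibration and $Z$ any bicomplex, is a weak equivalence. -/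

import Mathlib

open CategoryTheory Limits
universe u

noncomputable section

namespace BigradedTensor

variable {k : Type u} [CommRing k]

instance (Z : ModuleCat.{u} k) : ((MonoidalCategory.curriedTensor (ModuleCat.{u} k)).obj Z).IsLeftAdjoint :=
  inferInstanceAs (MonoidalCategory.tensorLeft Z).IsLeftAdjoint

instance (Z : ModuleCat.{u} k) : ((MonoidalCategory.curriedTensor (ModuleCat.{u} k)).flip.obj Z).IsLeftAdjoint :=
  inferInstanceAs (MonoidalCategory.tensorRight Z).IsLeftAdjoint

open MonoidalCategory hiding tensorObj tensorHom tensorUnit associator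
  leftUnitor rightUnitor whiskerLeft whiskerRight
open scoped MonoidalCategory
open GradedObject.Monoidal hiding tensorHom_def tensorHom_comp_tensorHom
  tensorHom_comp_tensorHom_assoc leftUnitor_naturality rightUnitor_naturality associator_naturality id_tensorHom_id

/-- The sign `(-1) ^ (p + q)`. -/
def sgn (i : ℤ × ℤ) : ℤˣ := (i.1 + i.2).negOnePow

lemma sgn_add (i j : ℤ × ℤ) : sgn (i + j) = sgn i * sgn j := by
  rw [sgn, sgn, sgn, ← Int.negOnePow_add]
  congr 1
  simp only [Prod.fst_add, Prod.snd_add]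
  ring

lemma sgn_mul_self (i : ℤ × ℤ) : sgn i * sgn i = 1 := Int.units_mul_self _

lemma units_smul_whiskerRight {A B : ModuleCat.{u} k} (e : ℤˣ) (f : A ⟶ B) (Z : ModuleCat.{u} k) :
    (e • f) ▷ Z = e • (f ▷ Z) := by
  obtain rfl | rfl := Int.units_eq_one_or e
  · simp
  · rw [Units.neg_smul, one_smul, Units.neg_smul, one_smul]; exact (tensorRight Z).map_neg (f := f)

lemma whiskerLeft_units_smul {A B : ModuleCat.{u} k} (e : ℤˣ) (f : A ⟶ B) (Z : ModuleCat.{u} k) :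
    Z ◁ (e • f) = e • (Z ◁ f) := by
  obtain rfl | rfl := Int.units_eq_one_or e
  · simp
  · rw [Units.neg_smul, one_smul, Units.neg_smul, one_smul]; exact (tensorLeft Z).map_neg (f := f)

/-- A shift of bidegrees by a fixed bidegree of odd total degree. -/
structure IsShift (σ : ℤ × ℤ → ℤ × ℤ) : Prop where
  left : ∀ a b, σ a + b = σ (a + b)
  right : ∀ a b, a + σ b = σ (a + b)
  sgn : ∀ a, sgn (σ a) = - sgn a

lemma isShift_h : IsShift (fun i => (i.1 - 1, i.2)) where
  left a b := by ext <;> dsimp; ring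
  right a b := by ext <;> dsimp; ring
  sgn a := by
    have : a.1 + a.2 = a.1 - 1 + a.2 + 1 := by ring
    simp only [BigradedTensor.sgn, this, Int.negOnePow_succ, neg_neg]

lemma isShift_v : IsShift (fun i => (i.1, i.2 - 1)) where
  left a b := by ext <;> dsimp; ring
  right a b := by ext <;> dsimp; ring
  sgn a := by
    have : a.1 + a.2 = a.1 + (a.2 - 1) + 1 := by ring
    simp only [BigradedTensor.sgn, this, Int.negOnePow_succ, neg_neg]

section

variable {σ τ : ℤ × ℤ → ℤ × ℤ} (hσ : IsShift σ) (hτ : IsShift τ)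
  {X Y Z X' Y' : GradedObject (ℤ × ℤ) (ModuleCat.{u} k)}
  (dX : ∀ i, X i ⟶ X (σ i)) (dY : ∀ i, Y i ⟶ Y (σ i)) (dZ : ∀ i, Z i ⟶ Z (σ i))
  (dX' : ∀ i, X' i ⟶ X' (σ i)) (dY' : ∀ i, Y' i ⟶ Y' (σ i))
  (eX : ∀ i, X i ⟶ X (τ i)) (eY : ∀ i, Y i ⟶ Y (τ i))

/-- The map `x ⊗ y ↦ d x ⊗ y + (-1) ^ |x| • x ⊗ d y` on a tensor product of bigraded modules,
where `|x|` is the total degree. -/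
def tensorD (i : ℤ × ℤ) : tensorObj X Y i ⟶ tensorObj X Y (σ i) :=
  tensorObjDesc fun a b hab =>
    (dX a ▷ Y b) ≫ ιTensorObj X Y (σ a) b (σ i) (by rw [hσ.left, hab]) +
    sgn a • (X a ◁ dY b) ≫ ιTensorObj X Y a (σ b) (σ i) (by rw [hσ.right, hab])

lemma ι_tensorD (a b i : ℤ × ℤ) (hab : a + b = i) :
    ιTensorObj X Y a b i hab ≫ tensorD hσ dX dY i =
      (dX a ▷ Y b) ≫ ιTensorObj X Y (σ a) b (σ i) (by rw [hσ.left, hab]) +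
      sgn a • (X a ◁ dY b) ≫ ιTensorObj X Y a (σ b) (σ i) (by rw [hσ.right, hab]) :=
  ι_tensorObjDesc _ _ _ _

lemma ι_tensorD_assoc (a b i : ℤ × ℤ) (hab : a + b = i) {A : ModuleCat.{u} k}
    (h : tensorObj X Y (σ i) ⟶ A) :
    ιTensorObj X Y a b i hab ≫ tensorD hσ dX dY i ≫ h =
      ((dX a ▷ Y b) ≫ ιTensorObj X Y (σ a) b (σ i) (by rw [hσ.left, hab]) +
      sgn a • (X a ◁ dY b) ≫ ιTensorObj X Y a (σ b) (σ i) (by rw [hσ.right, hab])) ≫ h := by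
  rw [← ι_tensorD, Category.assoc]

lemma ι_tensorD_tensorD (a b i : ℤ × ℤ) (hab : a + b = i) :
    ιTensorObj X Y a b i hab ≫ tensorD hσ dX dY i ≫ tensorD hτ eX eY (σ i) =
      ((dX a ≫ eX (σ a)) ▷ Y b) ≫ ιTensorObj X Y (τ (σ a)) b (τ (σ i))
        (by rw [hτ.left, hσ.left, hab]) +
      (X a ◁ (dY b ≫ eY (σ b))) ≫ ιTensorObj X Y a (τ (σ b)) (τ (σ i))
        (by rw [hτ.right, hσ.right, hab]) +
      sgn a • ((eX a ⊗ₘ dY b) ≫ ιTensorObj X Y (τ a) (σ b) (τ (σ i))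
        (by rw [hτ.left, hσ.right, hab]) -
        (dX a ⊗ₘ eY b) ≫ ιTensorObj X Y (σ a) (τ b) (τ (σ i))
        (by rw [hτ.right, hσ.left, hab])) := by
  rw [ι_tensorD_assoc]
  simp only [Preadditive.add_comp, Category.assoc, Linear.units_smul_comp, ι_tensorD,
    Preadditive.comp_add, Linear.comp_units_smul, smul_add, smul_smul, sgn_mul_self, one_smul,
    hσ.sgn, smul_sub, MonoidalCategory.tensorHom_def, Preadditive.comp_neg, comp_whiskerRight, whiskerLeft_comp, Units.neg_smul,
    whisker_exchange_assoc]
  abel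

lemma tensorD_tensorHom (f : X ⟶ X') (g : Y ⟶ Y')
    (hf : ∀ i, dX i ≫ f (σ i) = f i ≫ dX' i) (hg : ∀ i, dY i ≫ g (σ i) = g i ≫ dY' i)
    (i : ℤ × ℤ) :
    tensorD hσ dX dY i ≫ tensorHom f g (σ i) = tensorHom f g i ≫ tensorD hσ dX' dY' i := by
  apply tensorObj_ext
  intro a b hab
  simp only [ι_tensorD_assoc, ι_tensorHom_assoc, ι_tensorD, Preadditive.add_comp,
    Preadditive.comp_add, Linear.units_smul_comp, Linear.comp_units_smul, Category.assoc,
    ι_tensorHom]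
  congr 1
  · rw [← tensorHom_id, ← tensorHom_id, tensorHom_comp_tensorHom_assoc,
      tensorHom_comp_tensorHom_assoc, hf, Category.id_comp, Category.comp_id]
  · congr 1
    rw [← id_tensorHom, ← id_tensorHom, tensorHom_comp_tensorHom_assoc,
      tensorHom_comp_tensorHom_assoc, hg, Category.id_comp, Category.comp_id]

lemma tensorD_associator (i : ℤ × ℤ) :
    tensorD hσ (tensorD hσ dX dY) dZ i ≫ (associator X Y Z).hom (σ i) =
      (associator X Y Z).hom i ≫ tensorD hσ dX (tensorD hσ dY dZ) i := by
  apply tensorObj₃'_ext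
  intro a b c h
  rw [ιTensorObj₃'_associator_hom_assoc]
  have h₁ : σ a + b + c = σ i := by rw [hσ.left, hσ.left, h]
  have h₂ : a + σ b + c = σ i := by rw [hσ.right, hσ.left, h]
  have h₃ : a + b + σ c = σ i := by rw [hσ.right, h]
  have l : ιTensorObj₃' X Y Z a b c i h ≫ tensorD hσ (tensorD hσ dX dY) dZ i =
      ((dX a ▷ Y b) ▷ Z c) ≫ ιTensorObj₃' X Y Z (σ a) b c (σ i) h₁ +
      sgn a • ((X a ◁ dY b) ▷ Z c) ≫ ιTensorObj₃' X Y Z a (σ b) c (σ i) h₂ +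
      sgn (a + b) • ((X a ⊗ Y b) ◁ dZ c) ≫ ιTensorObj₃' X Y Z a b (σ c) (σ i) h₃ := by
    rw [ιTensorObj₃'_eq X Y Z a b c i h _ rfl, Category.assoc, ι_tensorD, Preadditive.comp_add,
      ← comp_whiskerRight_assoc, ι_tensorD, Linear.comp_units_smul,
      ← whisker_exchange_assoc,
      ιTensorObj₃'_eq X Y Z (σ a) b c (σ i) h₁ (σ (a + b)) (hσ.left _ _),
      ιTensorObj₃'_eq X Y Z a (σ b) c (σ i) h₂ (σ (a + b)) (hσ.right _ _),
      ιTensorObj₃'_eq X Y Z a b (σ c) (σ i) h₃ _ rfl]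
    simp only [MonoidalPreadditive.add_whiskerRight, units_smul_whiskerRight, comp_whiskerRight,
      Preadditive.add_comp, Linear.units_smul_comp, Category.assoc]
  have r : ιTensorObj₃ X Y Z a b c i h ≫ tensorD hσ dX (tensorD hσ dY dZ) i =
      (dX a ▷ (Y b ⊗ Z c)) ≫ ιTensorObj₃ X Y Z (σ a) b c (σ i) h₁ +
      sgn a • (X a ◁ (dY b ▷ Z c)) ≫ ιTensorObj₃ X Y Z a (σ b) c (σ i) h₂ +
      sgn (a + b) • (X a ◁ (Y b ◁ dZ c)) ≫ ιTensorObj₃ X Y Z a b (σ c) (σ i) h₃ := by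
    rw [ιTensorObj₃_eq X Y Z a b c i h _ rfl, Category.assoc, ι_tensorD, Preadditive.comp_add,
      Linear.comp_units_smul, ← whiskerLeft_comp_assoc, ι_tensorD,
      whisker_exchange_assoc,
      ιTensorObj₃_eq X Y Z (σ a) b c (σ i) h₁ _ rfl,
      ιTensorObj₃_eq X Y Z a (σ b) c (σ i) h₂ (σ (b + c)) (hσ.left _ _),
      ιTensorObj₃_eq X Y Z a b (σ c) (σ i) h₃ (σ (b + c)) (hσ.right _ _)]
    simp only [MonoidalPreadditive.whiskerLeft_add, whiskerLeft_units_smul, whiskerLeft_comp,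
      Preadditive.add_comp, Linear.units_smul_comp, Category.assoc, smul_add, smul_smul, sgn_add,
      add_assoc]
  rw [reassoc_of% l, r]
  simp only [Preadditive.add_comp, Linear.units_smul_comp, Category.assoc,
    ιTensorObj₃'_associator_hom, Preadditive.comp_add, Linear.comp_units_smul,
    associator_naturality_left_assoc, associator_naturality_middle_assoc,
    associator_naturality_right_assoc]

/-- The zero map on the unit bigraded module. -/
def unitD (σ : ℤ × ℤ → ℤ × ℤ) (i : ℤ × ℤ) :
    (tensorUnit : GradedObject (ℤ × ℤ) (ModuleCat.{u} k)) i ⟶ tensorUnit (σ i) := 0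

lemma leftUnitor_tensorD (i : ℤ × ℤ) :
    tensorD hσ (unitD σ) dY i ≫ (leftUnitor Y).hom (σ i) =
      (leftUnitor Y).hom i ≫ dY i := by
  have h1 (i) : (leftUnitor Y).hom i ≫ (leftUnitor Y).inv i = 𝟙 _ :=
    congr_fun (leftUnitor Y).hom_inv_id i
  have h2 (i) : (leftUnitor Y).inv i ≫ (leftUnitor Y).hom i = 𝟙 _ :=
    congr_fun (leftUnitor Y).inv_hom_id i
  suffices (leftUnitor Y).inv i ≫ tensorD hσ (unitD σ) dY i =
      dY i ≫ (leftUnitor Y).inv (σ i) by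
    have := (leftUnitor Y).hom i ≫= this =≫ (leftUnitor Y).hom (σ i)
    simpa [h2, reassoc_of% h1] using this
  have e (i) : (leftUnitor Y).inv i = (λ_ (Y i)).inv ≫ tensorUnit₀.inv ▷ (Y i) ≫
      ιTensorObj tensorUnit Y 0 i i (zero_add i) := leftUnitor_inv_apply Y i
  have z : unitD (k := k) σ 0 = 0 := rfl
  have h : sgn 0 = 1 := by simp [sgn]
  rw [e, e, Category.assoc, Category.assoc, ι_tensorD, z, h, one_smul,
    MonoidalPreadditive.zero_whiskerRight, zero_comp, zero_add, ← whisker_exchange_assoc,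
    id_whiskerLeft]
  simp only [Category.assoc, Iso.inv_hom_id_assoc]

lemma rightUnitor_tensorD (i : ℤ × ℤ) :
    tensorD hσ dX (unitD σ) i ≫ (rightUnitor X).hom (σ i) =
      (rightUnitor X).hom i ≫ dX i := by
  have h1 (i) : (rightUnitor X).hom i ≫ (rightUnitor X).inv i = 𝟙 _ :=
    congr_fun (rightUnitor X).hom_inv_id i
  have h2 (i) : (rightUnitor X).inv i ≫ (rightUnitor X).hom i = 𝟙 _ :=
    congr_fun (rightUnitor X).inv_hom_id i
  suffices (rightUnitor X).inv i ≫ tensorD hσ dX (unitD σ) i =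
      dX i ≫ (rightUnitor X).inv (σ i) by
    have := (rightUnitor X).hom i ≫= this =≫ (rightUnitor X).hom (σ i)
    simpa [h2, reassoc_of% h1] using this
  have e (i) : (rightUnitor X).inv i = (ρ_ (X i)).inv ≫ (X i) ◁ tensorUnit₀.inv ≫
      ιTensorObj X tensorUnit i 0 i (add_zero i) := rightUnitor_inv_apply X i
  have z : unitD (k := k) σ 0 = 0 := rfl
  rw [e, e, Category.assoc, Category.assoc, ι_tensorD, z,
    MonoidalPreadditive.whiskerLeft_zero, zero_comp, smul_zero, add_zero, whisker_exchange_assoc,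
    whiskerRight_id]
  simp only [Category.assoc, Iso.inv_hom_id_assoc]

end

section

/-- The symmetry `x ⊗ y ↦ (-1) ^ (|x| * |y|) • y ⊗ x` on bigraded modules. -/
def koszulHom (X Y : GradedObject (ℤ × ℤ) (ModuleCat.{u} k)) :
    tensorObj X Y ⟶ tensorObj Y X := fun i =>
  tensorObjDesc fun a b hab =>
    ((a.1 + a.2) * (b.1 + b.2)).negOnePow • (β_ (X a) (Y b)).hom ≫
      ιTensorObj Y X b a i (by rw [add_comm, hab])

lemma ι_koszulHom (X Y : GradedObject (ℤ × ℤ) (ModuleCat.{u} k)) (a b i : ℤ × ℤ)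
    (hab : a + b = i) :
    ιTensorObj X Y a b i hab ≫ koszulHom X Y i =
      ((a.1 + a.2) * (b.1 + b.2)).negOnePow • (β_ (X a) (Y b)).hom ≫
        ιTensorObj Y X b a i (by rw [add_comm, hab]) :=
  ι_tensorObjDesc _ _ _ _

lemma ι_koszulHom_assoc (X Y : GradedObject (ℤ × ℤ) (ModuleCat.{u} k)) (a b i : ℤ × ℤ)
    (hab : a + b = i) {A : ModuleCat.{u} k} (h : tensorObj Y X i ⟶ A) :
    ιTensorObj X Y a b i hab ≫ koszulHom X Y i ≫ h =
      (((a.1 + a.2) * (b.1 + b.2)).negOnePow • (β_ (X a) (Y b)).hom ≫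
        ιTensorObj Y X b a i (by rw [add_comm, hab])) ≫ h := by
  rw [← ι_koszulHom, Category.assoc]

lemma koszulHom_koszulHom (X Y : GradedObject (ℤ × ℤ) (ModuleCat.{u} k)) :
    koszulHom X Y ≫ koszulHom Y X = 𝟙 (tensorObj X Y) := by
  ext1 i
  apply tensorObj_ext
  intro a b hab
  dsimp
  rw [ι_koszulHom_assoc, Linear.units_smul_comp, Category.assoc, ι_koszulHom,
    Linear.comp_units_smul, smul_smul, mul_comm (b.1 + b.2), Int.units_mul_self, one_smul,
    SymmetricCategory.symmetry_assoc]
  exact (Category.comp_id _).symm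

/-- The symmetry as an isomorphism of bigraded modules. -/
def koszul (X Y : GradedObject (ℤ × ℤ) (ModuleCat.{u} k)) : tensorObj X Y ≅ tensorObj Y X where
  hom := koszulHom X Y
  inv := koszulHom Y X
  hom_inv_id := koszulHom_koszulHom X Y
  inv_hom_id := koszulHom_koszulHom Y X

lemma koszulHom_naturality {X Y X' Y' : GradedObject (ℤ × ℤ) (ModuleCat.{u} k)}
    (f : X ⟶ X') (g : Y ⟶ Y') :
    tensorHom f g ≫ koszulHom X' Y' = koszulHom X Y ≫ tensorHom g f := by
  ext1 i
  apply tensorObj_ext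
  intro a b hab
  dsimp
  rw [ι_koszulHom_assoc, ι_tensorHom_assoc, Linear.units_smul_comp, Category.assoc, ι_koszulHom,
    Linear.comp_units_smul, ι_tensorHom, BraidedCategory.braiding_naturality_assoc]

lemma tensorD_koszulHom {σ : ℤ × ℤ → ℤ × ℤ} (hσ : IsShift σ)
    {X Y : GradedObject (ℤ × ℤ) (ModuleCat.{u} k)}
    (dX : ∀ i, X i ⟶ X (σ i)) (dY : ∀ i, Y i ⟶ Y (σ i)) (i : ℤ × ℤ) :
    tensorD hσ dX dY i ≫ koszulHom X Y (σ i) = koszulHom X Y i ≫ tensorD hσ dY dX i := by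
  have h (a b : ℤ × ℤ) : (((σ a).1 + (σ a).2) * (b.1 + b.2)).negOnePow =
      ((a.1 + a.2) * (b.1 + b.2)).negOnePow * sgn b := by
    have e : ((σ a).1 + (σ a).2).negOnePow = -(a.1 + a.2).negOnePow := hσ.sgn a
    rcases Int.even_or_odd (b.1 + b.2) with hb | hb
    · rw [Int.negOnePow_even _ (hb.mul_left _), Int.negOnePow_even _ (hb.mul_left _), sgn,
        Int.negOnePow_even _ hb, one_mul]
    · have q (n : ℤ) : (n * (b.1 + b.2)).negOnePow = n.negOnePow := by
        obtain ⟨c, hc⟩ := hb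
        rw [hc, mul_add, mul_one, Int.negOnePow_add, ← mul_assoc, mul_comm n, mul_assoc,
          Int.negOnePow_two_mul, one_mul]
      rw [q, q, sgn, Int.negOnePow_odd _ hb, e]
      simp
  apply tensorObj_ext
  intro a b hab
  rw [ι_koszulHom_assoc, ι_tensorD_assoc]
  simp only [Preadditive.add_comp, Linear.units_smul_comp, Category.assoc, ι_koszulHom,
    ι_tensorD, Preadditive.comp_add, Linear.comp_units_smul, smul_add, smul_smul, h,
    BraidedCategory.braiding_naturality_left_assoc,
    BraidedCategory.braiding_naturality_right_assoc]
  rw [mul_comm (a.1 + a.2) ((σ b).1 + (σ b).2), h, mul_comm (b.1 + b.2), add_comm, mul_comm (sgn a),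
    mul_assoc, sgn_mul_self, mul_one]

lemma koszulHom_hexagon (X Y Z : GradedObject (ℤ × ℤ) (ModuleCat.{u} k)) :
    (associator X Y Z).hom ≫ koszulHom X (tensorObj Y Z) ≫ (associator Y Z X).hom =
      tensorHom (koszulHom X Y) (𝟙 Z) ≫ (associator Y X Z).hom ≫
        tensorHom (𝟙 Y) (koszulHom X Z) := by
  ext1 k
  apply tensorObj₃'_ext
  intro i₁ i₂ i₃ h
  have s : ((i₁.1 + i₁.2) * ((i₂ + i₃).1 + (i₂ + i₃).2)).negOnePow =
      ((i₁.1 + i₁.2) * (i₂.1 + i₂.2)).negOnePow * ((i₁.1 + i₁.2) * (i₃.1 + i₃.2)).negOnePow := by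
    rw [← Int.negOnePow_add]
    congr 1
    simp only [Prod.fst_add, Prod.snd_add]
    ring
  dsimp
  have l : ιTensorObj₃' X Y Z i₁ i₂ i₃ k h ≫ (associator X Y Z).hom k ≫
      koszulHom X (tensorObj Y Z) k ≫ (associator Y Z X).hom k =
      ((i₁.1 + i₁.2) * ((i₂ + i₃).1 + (i₂ + i₃).2)).negOnePow •
        ((α_ _ _ _).hom ≫ (β_ (X i₁) (Y i₂ ⊗ Z i₃)).hom ≫ (α_ _ _ _).hom ≫
          ιTensorObj₃ Y Z X i₂ i₃ i₁ k (by rw [add_comm _ i₁, ← add_assoc, h])) := by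
    rw [ιTensorObj₃'_associator_hom_assoc, ιTensorObj₃_eq X Y Z i₁ i₂ i₃ k h _ rfl,
      Category.assoc, ι_koszulHom_assoc, Linear.units_smul_comp, Category.assoc,
      Linear.comp_units_smul, Linear.comp_units_smul,
      BraidedCategory.braiding_naturality_right_assoc,
      ← ιTensorObj₃'_eq_assoc Y Z X i₂ i₃ i₁ k (by rw [add_comm _ i₁, ← add_assoc, h]) _ rfl,
      ιTensorObj₃'_associator_hom]
  have r : ιTensorObj₃' X Y Z i₁ i₂ i₃ k h ≫ tensorHom (koszulHom X Y) (𝟙 Z) k ≫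
      (associator Y X Z).hom k ≫ tensorHom (𝟙 Y) (koszulHom X Z) k =
      (((i₁.1 + i₁.2) * (i₂.1 + i₂.2)).negOnePow * ((i₁.1 + i₁.2) * (i₃.1 + i₃.2)).negOnePow) •
        (((β_ (X i₁) (Y i₂)).hom ▷ Z i₃) ≫ (α_ _ _ _).hom ≫ (Y i₂ ◁ (β_ (X i₁) (Z i₃)).hom) ≫
          ιTensorObj₃ Y Z X i₂ i₃ i₁ k (by rw [add_comm _ i₁, ← add_assoc, h])) := by
    have e₁ : ιTensorObj₃' X Y Z i₁ i₂ i₃ k h ≫ tensorHom (koszulHom X Y) (𝟙 Z) k =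
        ((i₁.1 + i₁.2) * (i₂.1 + i₂.2)).negOnePow • ((β_ (X i₁) (Y i₂)).hom ▷ Z i₃) ≫
          ιTensorObj₃' Y X Z i₂ i₁ i₃ k (by rw [add_comm i₂ i₁, h]) := by
      rw [ιTensorObj₃'_eq X Y Z i₁ i₂ i₃ k h _ rfl, Category.assoc, ι_tensorHom,
        ιTensorObj₃'_eq Y X Z i₂ i₁ i₃ k _ (i₁ + i₂) (add_comm _ _)]
      dsimp
      rw [tensorHom_id, ← comp_whiskerRight_assoc, ι_koszulHom, units_smul_whiskerRight,
        comp_whiskerRight, Linear.units_smul_comp, Category.assoc]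
    have e₂ : ιTensorObj₃ Y X Z i₂ i₁ i₃ k (by rw [add_comm i₂ i₁, h]) ≫
        tensorHom (𝟙 Y) (koszulHom X Z) k =
        ((i₁.1 + i₁.2) * (i₃.1 + i₃.2)).negOnePow • (Y i₂ ◁ (β_ (X i₁) (Z i₃)).hom) ≫
          ιTensorObj₃ Y Z X i₂ i₃ i₁ k (by rw [add_comm _ i₁, ← add_assoc, h]) := by
      rw [ιTensorObj₃_eq Y X Z i₂ i₁ i₃ k _ _ rfl, Category.assoc, ι_tensorHom,
        ιTensorObj₃_eq Y Z X i₂ i₃ i₁ k _ (i₁ + i₃) (add_comm _ _)]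
      dsimp
      rw [id_tensorHom, ← whiskerLeft_comp_assoc, ι_koszulHom, whiskerLeft_units_smul,
        whiskerLeft_comp, Linear.units_smul_comp, Category.assoc]
    rw [reassoc_of% e₁, Linear.units_smul_comp, Category.assoc,
      ιTensorObj₃'_associator_hom_assoc, e₂]
    simp only [Linear.comp_units_smul, smul_smul]
  rw [l, r, s]
  congr 1
  have := BraidedCategory.hexagon_forward (X i₁) (Y i₂) (Z i₃)
  rw [reassoc_of% this]

end

end BigradedTensor

/-- A bicomplex of `k`-modules concentrated in the right half-plane: modules `X (p, q)` for
`p q : ℤ`, zero for `p < 0`, with a horizontal differential `X (p, q) ⟶ X (p - 1, q)` and a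
vertical differential `X (p, q) ⟶ X (p, q - 1)` which anticommute. -/
structure Bicomplex (k : Type u) [CommRing k] where
  X : GradedObject (ℤ × ℤ) (ModuleCat.{u} k)
  isZero_of_neg : ∀ i : ℤ × ℤ, i.1 < 0 → IsZero (X i)
  dh : ∀ i : ℤ × ℤ, X i ⟶ X (i.1 - 1, i.2)
  dv : ∀ i : ℤ × ℤ, X i ⟶ X (i.1, i.2 - 1)
  dh_dh : ∀ i : ℤ × ℤ, dh i ≫ dh (i.1 - 1, i.2) = 0
  dv_dv : ∀ i : ℤ × ℤ, dv i ≫ dv (i.1, i.2 - 1) = 0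
  dv_dh : ∀ i : ℤ × ℤ, dh i ≫ dv (i.1 - 1, i.2) + dv i ≫ dh (i.1, i.2 - 1) = 0

namespace Bicomplex

variable {k : Type u} [CommRing k]

/-- Morphisms of bicomplexes: degreewise linear maps compatible with both differentials. -/
@[ext]
structure Hom (X Y : Bicomplex k) where
  f : X.X ⟶ Y.X
  comm_h : ∀ i : ℤ × ℤ, X.dh i ≫ f (i.1 - 1, i.2) = f i ≫ Y.dh i
  comm_v : ∀ i : ℤ × ℤ, X.dv i ≫ f (i.1, i.2 - 1) = f i ≫ Y.dv i

instance : Category (Bicomplex k) where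
  Hom X Y := Hom X Y
  id X := { f := 𝟙 X.X, comm_h := by simp, comm_v := by simp }
  comp f g :=
    { f := f.f ≫ g.f
      comm_h := fun i => by
        dsimp; rw [← Category.assoc, f.comm_h, Category.assoc, g.comm_h, Category.assoc]
      comm_v := fun i => by
        dsimp; rw [← Category.assoc, f.comm_v, Category.assoc, g.comm_v, Category.assoc] }

@[ext]
lemma hom_ext {X Y : Bicomplex k} {f g : X ⟶ Y} (h : ∀ i, f.f i = g.f i) : f = g :=
  Hom.ext (funext h)

@[simp] lemma id_f (X : Bicomplex k) : Hom.f (𝟙 X) = 𝟙 X.X := rfl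

@[simp] lemma comp_f {X Y Z : Bicomplex k} (f : X ⟶ Y) (g : Y ⟶ Z) :
    (f ≫ g).f = f.f ≫ g.f := rfl

/-- The underlying bigraded module. -/
@[simps]
def forget (k : Type u) [CommRing k] :
    Bicomplex k ⥤ GradedObject (ℤ × ℤ) (ModuleCat.{u} k) where
  obj X := X.X
  map f := f.f

instance : (forget k).Faithful where
  map_injective h := Hom.ext h

/-- A degreewise isomorphism compatible with the differentials is an isomorphism. -/
@[simps]
def isoMk {X Y : Bicomplex k} (e : X.X ≅ Y.X)
    (comm_h : ∀ i : ℤ × ℤ, X.dh i ≫ e.hom (i.1 - 1, i.2) = e.hom i ≫ Y.dh i)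
    (comm_v : ∀ i : ℤ × ℤ, X.dv i ≫ e.hom (i.1, i.2 - 1) = e.hom i ≫ Y.dv i) : X ≅ Y where
  hom := { f := e.hom, comm_h := comm_h, comm_v := comm_v }
  inv :=
    { f := e.inv
      comm_h := fun i => by
        have h1 (i) : e.hom i ≫ e.inv i = 𝟙 _ := congr_fun e.hom_inv_id i
        have h2 (i) : e.inv i ≫ e.hom i = 𝟙 _ := congr_fun e.inv_hom_id i
        have := comm_h i
        calc Y.dh i ≫ e.inv _ = e.inv i ≫ (e.hom i ≫ Y.dh i) ≫ e.inv _ := by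
              simp only [Category.assoc]; rw [← Category.assoc, h2, Category.id_comp]
          _ = _ := by rw [← this, Category.assoc, h1, Category.comp_id]
      comm_v := fun i => by
        have h1 (i) : e.hom i ≫ e.inv i = 𝟙 _ := congr_fun e.hom_inv_id i
        have h2 (i) : e.inv i ≫ e.hom i = 𝟙 _ := congr_fun e.inv_hom_id i
        have := comm_v i
        calc Y.dv i ≫ e.inv _ = e.inv i ≫ (e.hom i ≫ Y.dv i) ≫ e.inv _ := by
              simp only [Category.assoc]; rw [← Category.assoc, h2, Category.id_comp]
          _ = _ := by rw [← this, Category.assoc, h1, Category.comp_id] }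
  hom_inv_id := Hom.ext e.hom_inv_id
  inv_hom_id := Hom.ext e.inv_hom_id

/-! ### The tensor product -/

section

open MonoidalCategory hiding tensorObj tensorHom tensorUnit associator
  leftUnitor rightUnitor whiskerLeft whiskerRight
open scoped MonoidalCategory
open BigradedTensor

/-- The tensor product of bicomplexes: the modules are
`⨁_{m + s = p, n + t = q} X (m, n) ⊗ Y (s, t)`, and both differentials are given by
`d (x ⊗ y) = d x ⊗ y + (-1) ^ |x| • x ⊗ d y`, where `|x|` is the total degree. -/
@[simps]
def tensorObj (X Y : Bicomplex k) : Bicomplex k where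
  X := GradedObject.Monoidal.tensorObj X.X Y.X
  isZero_of_neg i hi := by
    rw [IsZero.iff_id_eq_zero]
    apply GradedObject.Monoidal.tensorObj_ext
    intro a b hab
    have hz : IsZero (X.X a ⊗ Y.X b) := by
      by_cases ha : a.1 < 0
      · exact (tensorRight (Y.X b)).map_isZero (X.isZero_of_neg a ha)
      · refine (tensorLeft (X.X a)).map_isZero (Y.isZero_of_neg b ?_)
        have := congr_arg Prod.fst hab
        simp only [Prod.fst_add] at this
        omega
    exact hz.eq_of_src _ _
  dh := tensorD isShift_h X.dh Y.dh
  dv := tensorD isShift_v X.dv Y.dv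
  dh_dh i := by
    apply GradedObject.Monoidal.tensorObj_ext
    intro a b hab
    have := ι_tensorD_tensorD isShift_h isShift_h X.dh Y.dh X.dh Y.dh a b i hab
    rw [X.dh_dh, Y.dh_dh, sub_self, smul_zero, MonoidalPreadditive.zero_whiskerRight,
      MonoidalPreadditive.whiskerLeft_zero, zero_comp, zero_comp, add_zero, add_zero] at this
    rw [comp_zero]
    exact this
  dv_dv i := by
    apply GradedObject.Monoidal.tensorObj_ext
    intro a b hab
    have := ι_tensorD_tensorD isShift_v isShift_v X.dv Y.dv X.dv Y.dv a b i hab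
    rw [X.dv_dv, Y.dv_dv, sub_self, smul_zero, MonoidalPreadditive.zero_whiskerRight,
      MonoidalPreadditive.whiskerLeft_zero, zero_comp, zero_comp, add_zero, add_zero] at this
    rw [comp_zero]
    exact this
  dv_dh i := by
    apply GradedObject.Monoidal.tensorObj_ext
    intro a b hab
    have h₁ := ι_tensorD_tensorD isShift_h isShift_v X.dh Y.dh X.dv Y.dv a b i hab
    have h₂ := ι_tensorD_tensorD isShift_v isShift_h X.dv Y.dv X.dh Y.dh a b i hab
    have hX := eq_neg_of_add_eq_zero_left (X.dv_dh a)
    have hY := eq_neg_of_add_eq_zero_left (Y.dv_dh b)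
    rw [comp_zero, Preadditive.comp_add]
    refine (congr_arg₂ (· + ·) h₁ h₂).trans ?_
    dsimp only
    rw [hX, hY]
    have e₁ : (-X.dv a ≫ X.dh (a.1, a.2 - 1)) ▷ Y.X b = -(X.dv a ≫ X.dh (a.1, a.2 - 1)) ▷ Y.X b :=
      (tensorRight (Y.X b)).map_neg (f := X.dv a ≫ X.dh (a.1, a.2 - 1))
    have e₂ : X.X a ◁ (-Y.dv b ≫ Y.dh (b.1, b.2 - 1)) = -X.X a ◁ (Y.dv b ≫ Y.dh (b.1, b.2 - 1)) :=
      (tensorLeft (X.X a)).map_neg (f := Y.dv b ≫ Y.dh (b.1, b.2 - 1))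
    rw [e₁, e₂, smul_sub, smul_sub]
    simp only [Preadditive.neg_comp]
    abel

/-- The tensor product of morphisms of bicomplexes. -/
@[simps]
def tensorHom {X Y X' Y' : Bicomplex k} (f : X ⟶ X') (g : Y ⟶ Y') :
    tensorObj X Y ⟶ tensorObj X' Y' where
  f := GradedObject.Monoidal.tensorHom f.f g.f
  comm_h := tensorD_tensorHom isShift_h _ _ _ _ f.f g.f f.comm_h g.comm_h
  comm_v := tensorD_tensorHom isShift_v _ _ _ _ f.f g.f f.comm_v g.comm_v

/-- The tensor unit: `k` concentrated in bidegree `(0, 0)`. -/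
@[simps]
def tensorUnit (k : Type u) [CommRing k] : Bicomplex k where
  X := GradedObject.Monoidal.tensorUnit
  isZero_of_neg i hi :=
    (GradedObject.Monoidal.isInitialTensorUnitApply (C := ModuleCat.{u} k) i
      (by rintro rfl; simp at hi)).isZero
  dh := unitD _
  dv := unitD _
  dh_dh _ := zero_comp
  dv_dv _ := zero_comp
  dv_dh _ := by simp [unitD]

/-- The associativity isomorphism. -/
def associator (X Y Z : Bicomplex k) :
    tensorObj (tensorObj X Y) Z ≅ tensorObj X (tensorObj Y Z) :=
  isoMk (GradedObject.Monoidal.associator X.X Y.X Z.X)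
    (tensorD_associator isShift_h _ _ _) (tensorD_associator isShift_v _ _ _)

/-- The left unit isomorphism. -/
def leftUnitor (X : Bicomplex k) : tensorObj (tensorUnit k) X ≅ X :=
  isoMk (GradedObject.Monoidal.leftUnitor X.X)
    (leftUnitor_tensorD isShift_h _) (leftUnitor_tensorD isShift_v _)

/-- The right unit isomorphism. -/
def rightUnitor (X : Bicomplex k) : tensorObj X (tensorUnit k) ≅ X :=
  isoMk (GradedObject.Monoidal.rightUnitor X.X)
    (rightUnitor_tensorD isShift_h _) (rightUnitor_tensorD isShift_v _)

/-- The symmetry `x ⊗ y ↦ (-1) ^ (|x| * |y|) • y ⊗ x`. -/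
def braiding (X Y : Bicomplex k) : tensorObj X Y ≅ tensorObj Y X :=
  isoMk (koszul X.X Y.X) (tensorD_koszulHom isShift_h _ _) (tensorD_koszulHom isShift_v _ _)

instance : MonoidalCategoryStruct (Bicomplex k) where
  tensorObj := tensorObj
  tensorHom := tensorHom
  whiskerLeft X _ _ g := tensorHom (𝟙 X) g
  whiskerRight f Y := tensorHom f (𝟙 Y)
  tensorUnit := tensorUnit k
  associator := associator
  leftUnitor := leftUnitor
  rightUnitor := rightUnitor

instance : MonoidalCategory (Bicomplex k) where
  tensorHom_def f g := Hom.ext (MonoidalCategory.tensorHom_def (forget k |>.map f) ((forget k).map g))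
  id_tensorHom_id X Y := Hom.ext (GradedObject.Monoidal.id_tensorHom_id X.X Y.X)
  tensorHom_comp_tensorHom f₁ f₂ g₁ g₂ := Hom.ext
    (GradedObject.Monoidal.tensorHom_comp_tensorHom f₁.f g₁.f f₂.f g₂.f)
  whiskerLeft_id X Y := Hom.ext (GradedObject.Monoidal.id_tensorHom_id X.X Y.X)
  id_whiskerRight X Y := Hom.ext (GradedObject.Monoidal.id_tensorHom_id X.X Y.X)
  associator_naturality f₁ f₂ f₃ := Hom.ext
    (GradedObject.Monoidal.associator_naturality f₁.f f₂.f f₃.f)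
  leftUnitor_naturality f := Hom.ext (GradedObject.Monoidal.leftUnitor_naturality f.f)
  rightUnitor_naturality f := Hom.ext (GradedObject.Monoidal.rightUnitor_naturality f.f)
  pentagon W X Y Z := Hom.ext (GradedObject.Monoidal.pentagon W.X X.X Y.X Z.X)
  triangle X Y := Hom.ext (GradedObject.Monoidal.triangle X.X Y.X)

lemma braiding_symmetry (X Y : Bicomplex k) :
    (braiding X Y).hom ≫ (braiding Y X).hom = 𝟙 (tensorObj X Y) :=
  Hom.ext (koszulHom_koszulHom X.X Y.X)

lemma braiding_hexagon (X Y Z : Bicomplex k) :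
    (α_ X Y Z).hom ≫ (braiding X (Y ⊗ Z)).hom ≫ (α_ Y Z X).hom =
      ((braiding X Y).hom ▷ Z) ≫ (α_ Y X Z).hom ≫ (Y ◁ (braiding X Z).hom) :=
  Hom.ext (koszulHom_hexagon X.X Y.X Z.X)

instance : SymmetricCategory (Bicomplex k) where
  braiding := braiding
  braiding_naturality_right X _ _ g := Hom.ext (koszulHom_naturality (𝟙 X.X) g.f)
  braiding_naturality_left f Z := Hom.ext (koszulHom_naturality f.f (𝟙 Z.X))
  hexagon_forward := braiding_hexagon
  hexagon_reverse X Y Z := by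
    have s (A B : Bicomplex k) : braiding A B = (braiding B A).symm := by
      ext1
      rw [Iso.symm_hom, ← cancel_mono (braiding B A).hom, Iso.inv_hom_id]
      exact braiding_symmetry A B
    have h := congr_arg Iso.inv (Iso.ext (α := _) (braiding_hexagon Z X Y) :
      α_ Z X Y ≪≫ braiding Z (X ⊗ Y) ≪≫ α_ X Y Z =
        whiskerRightIso (braiding Z X) Y ≪≫ α_ X Z Y ≪≫ whiskerLeftIso X (braiding Z Y))
    rw [s (X ⊗ Y) Z, s Y Z, s X Z]
    simpa using h
  symmetry := braiding_symmetry

end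

/-! ### Totalisation and columns -/

/-- The differential `d_h + d_v` on `⨁_{p + q = n} X (p, q)`. -/
def totD (X : Bicomplex k) (n m : ℤ) :
    X.X.mapObj (fun i => i.1 + i.2) n ⟶ X.X.mapObj (fun i => i.1 + i.2) m :=
  if h : m + 1 = n then
    X.X.descMapObj (fun i => i.1 + i.2) (fun i hi =>
      X.dh i ≫ X.X.ιMapObj (fun i => i.1 + i.2) (i.1 - 1, i.2) m (by dsimp; omega) +
      X.dv i ≫ X.X.ιMapObj (fun i => i.1 + i.2) (i.1, i.2 - 1) m (by dsimp; omega))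
  else 0

lemma ι_totD (X : Bicomplex k) (i : ℤ × ℤ) (n m : ℤ) (hi : i.1 + i.2 = n) (h : m + 1 = n) :
    X.X.ιMapObj (fun i => i.1 + i.2) i n hi ≫ X.totD n m =
      X.dh i ≫ X.X.ιMapObj (fun i => i.1 + i.2) (i.1 - 1, i.2) m (by dsimp; omega) +
      X.dv i ≫ X.X.ιMapObj (fun i => i.1 + i.2) (i.1, i.2 - 1) m (by dsimp; omega) := by
  dsimp only [totD]
  rw [dif_pos h]
  exact GradedObject.ι_descMapObj _ _ _ _ _

lemma ι_totD_assoc (X : Bicomplex k) (i : ℤ × ℤ) (n m : ℤ) (hi : i.1 + i.2 = n) (h : m + 1 = n)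
    {A : ModuleCat.{u} k} (g : X.X.mapObj (fun i => i.1 + i.2) m ⟶ A) :
    X.X.ιMapObj (fun i => i.1 + i.2) i n hi ≫ X.totD n m ≫ g =
      (X.dh i ≫ X.X.ιMapObj (fun i => i.1 + i.2) (i.1 - 1, i.2) m (by dsimp; omega) +
      X.dv i ≫ X.X.ιMapObj (fun i => i.1 + i.2) (i.1, i.2 - 1) m (by dsimp; omega)) ≫ g := by
  rw [← ι_totD _ _ _ _ hi h, Category.assoc]

lemma totD_totD (X : Bicomplex k) (n m l : ℤ) (h : m + 1 = n) (h' : l + 1 = m) :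
    X.totD n m ≫ X.totD m l = 0 := by
  apply GradedObject.mapObj_ext
  intro i hi
  rw [ι_totD_assoc _ _ _ _ _ h, Preadditive.add_comp, Category.assoc, Category.assoc,
    ι_totD _ _ _ _ _ h', ι_totD _ _ _ _ _ h', Preadditive.comp_add, Preadditive.comp_add, comp_zero]
  have h1 := congr_arg (· ≫ X.X.ιMapObj (fun i => i.1 + i.2) (i.1 - 1 - 1, i.2) l
    (by dsimp; omega)) (X.dh_dh i)
  have h2 := congr_arg (· ≫ X.X.ιMapObj (fun i => i.1 + i.2) (i.1, i.2 - 1 - 1) l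
    (by dsimp; omega)) (X.dv_dv i)
  have h3 := congr_arg (· ≫ X.X.ιMapObj (fun i => i.1 + i.2) (i.1 - 1, i.2 - 1) l
    (by dsimp; omega)) (X.dv_dh i)
  simp only [Preadditive.add_comp, Category.assoc, zero_comp] at h1 h2 h3
  rw [h1, h2, zero_add, add_zero, h3]

lemma mapMap_totD {X Y : Bicomplex k} (f : X ⟶ Y) (n m : ℤ) (h : m + 1 = n) :
    GradedObject.mapMap f.f (fun i => i.1 + i.2) n ≫ Y.totD n m =
      X.totD n m ≫ GradedObject.mapMap f.f (fun i => i.1 + i.2) m := by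
  apply GradedObject.mapObj_ext
  intro i hi
  rw [ι_totD_assoc _ _ _ _ _ h, GradedObject.ι_mapMap_assoc, ι_totD _ _ _ _ _ h,
    Preadditive.add_comp, Preadditive.comp_add, Category.assoc, Category.assoc,
    GradedObject.ι_mapMap, GradedObject.ι_mapMap, reassoc_of% f.comm_h i,
    reassoc_of% f.comm_v i]

/-- The total complex: `⨁_{p + q = n} X (p, q)` in degree `n`, with differential `d_h + d_v`. -/
def totObj (X : Bicomplex k) : ChainComplex (ModuleCat.{u} k) ℤ where
  X := X.X.mapObj (fun i => i.1 + i.2)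
  d := X.totD
  shape n m h := dif_neg (by simpa using h)
  d_comp_d' n m l h h' := X.totD_totD n m l h h'

/-- The totalisation functor. -/
def tot (k : Type u) [CommRing k] : Bicomplex k ⥤ ChainComplex (ModuleCat.{u} k) ℤ where
  obj X := X.totObj
  map {X Y} f :=
    { f := GradedObject.mapMap f.f (fun i => i.1 + i.2)
      comm' := fun n m h => mapMap_totD f n m h }
  map_id X := by
    ext1 n
    exact congr_fun (GradedObject.mapMap_id X.X _) n
  map_comp f g := by
    ext1 n
    exact congr_fun (GradedObject.mapMap_comp f.f g.f _) n

/-- The column `X (p, *)` with the vertical differential. Its homology in degree `q` is the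
vertical homology of `X` in bidegree `(p, q)`. -/
def columnObj (X : Bicomplex k) (p : ℤ) : ChainComplex (ModuleCat.{u} k) ℤ where
  X q := X.X (p, q)
  d q r := if h : r + 1 = q then X.dv (p, q) ≫ eqToHom (by rw [← h]; simp) else 0
  shape q r h := dif_neg (by simpa using h)
  d_comp_d' q r s h h' := by
    obtain rfl : r = q - 1 := by rw [← h]; simp
    obtain rfl : s = q - 1 - 1 := by rw [← h']; simp
    rw [dif_pos (by simp), dif_pos (by simp)]
    simpa using X.dv_dv (p, q)

lemma columnObj_d (X : Bicomplex k) (p q : ℤ) : (X.columnObj p).d q (q - 1) = X.dv (p, q) := by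
  dsimp only [columnObj]
  rw [dif_pos (by simp)]
  exact Category.comp_id _

/-- The functor sending a bicomplex to its column `X (p, *)`. -/
def column (k : Type u) [CommRing k] (p : ℤ) :
    Bicomplex k ⥤ ChainComplex (ModuleCat.{u} k) ℤ where
  obj X := X.columnObj p
  map {X Y} f :=
    { f := fun q => f.f (p, q)
      comm' := fun q r h => by
        obtain rfl : r = q - 1 := by rw [← h]; simp
        rw [columnObj_d, columnObj_d]
        exact (f.comm_v (p, q)).symm }
  map_id X := by ext1; rfl
  map_comp f g := by ext1; rfl

/-! ### The classes of maps of the total model structure -/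

/-- Weak equivalences: the maps inducing a quasi-isomorphism on total complexes. -/
def totWeakEquivalences (k : Type u) [CommRing k] : MorphismProperty (Bicomplex k) :=
  fun _ _ f => QuasiIso ((tot k).map f)

/-- Fibrations: the pointwise surjective maps inducing an isomorphism on vertical homology in
horizontal degrees `p > 0`. -/
def totFibrations (k : Type u) [CommRing k] : MorphismProperty (Bicomplex k) :=
  fun _ _ f => (∀ i, Function.Surjective (f.f i)) ∧ ∀ p > 0, QuasiIso ((column k p).map f)

end Bicomplex

/-! ### Monoidal model categories -/

section MonoidalModel

open HomotopicalAlgebra MonoidalCategory MorphismProperty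

/-- A symmetric monoidal category with a model structure is a monoidal model category if it is
closed, satisfies the pushout-product axiom, and tensoring a cofibrant replacement of the unit with
a cofibrant object is a weak equivalence. -/
structure IsMonoidalModelCategory (C : Type*) [Category* C] [MonoidalCategory C]
    [SymmetricCategory C] [ModelCategory C] : Prop where
  closed : Nonempty (MonoidalClosed C)
  cofibration_pushoutProduct {A B X Y : C} (f : A ⟶ B) (g : X ⟶ Y) :
    cofibrations C f → cofibrations C g →
      cofibrations C ((Arrow.pushoutProduct.obj (.mk f)).obj (.mk g)).hom
  trivialCofibration_pushoutProduct_left {A B X Y : C} (f : A ⟶ B) (g : X ⟶ Y) :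
    trivialCofibrations C f → cofibrations C g →
      trivialCofibrations C ((Arrow.pushoutProduct.obj (.mk f)).obj (.mk g)).hom
  trivialCofibration_pushoutProduct_right {A B X Y : C} (f : A ⟶ B) (g : X ⟶ Y) :
    cofibrations C f → trivialCofibrations C g →
      trivialCofibrations C ((Arrow.pushoutProduct.obj (.mk f)).obj (.mk g)).hom
  weakEquivalence_unit_left {Q : C} (q : Q ⟶ 𝟙_ C) (X : C) [IsCofibrant Q] [IsCofibrant X] :
    weakEquivalences C q → weakEquivalences C (q ▷ X)
  weakEquivalence_unit_right {Q : C} (q : Q ⟶ 𝟙_ C) (X : C) [IsCofibrant Q] [IsCofibrant X] :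
    weakEquivalences C q → weakEquivalences C (X ◁ q)

/-- The class of maps `j ⊗ Z` with `j` a trivial cofibration and `Z` any object. -/
inductive TrivialCofibrationsTensor (C : Type*) [Category* C] [MonoidalCategory C]
    [ModelCategory C] : MorphismProperty C
  | mk {A B : C} (j : A ⟶ B) (Z : C) (hj : trivialCofibrations C j) :
      TrivialCofibrationsTensor C (j ▷ Z)

/-- The Schwede-Shipley monoid axiom: all transfinite compositions of pushouts of maps `j ⊗ Z`,
with `j` a trivial cofibration, are weak equivalences. -/
def MonoidAxiom.{w, v, u'} (C : Type u') [Category.{v} C] [MonoidalCategory C]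
    [ModelCategory C] : Prop :=
  transfiniteCompositions.{w} (TrivialCofibrationsTensor C).pushouts ≤ weakEquivalences C

end MonoidalModel

end

/-! Homology conditions are replaced by lifting conditions. A map of chain complexes is a surjective
quasi-isomorphism exactly when it lifts against the inclusions of spheres into discs
(`sphereLift_iff`). So the fibrations are the pointwise surjections satisfying `LiftsAt` in all
positive columns (`totFibrations_eq`). An element of a total complex has a top column, because
totals are direct sums, and columns are bounded below by zero. Peeling off top columns therefore
shows that the fibrations that are weak equivalences are the surjections satisfying `LiftsAt` in
every column (`surjLifts_top_iff`). Both classes are right orthogonal to explicit small families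
(`generators_rlp`), built from rows, which are free on a vertical cycle, and discs, which are free
on one element. The small object argument gives the two factorizations.

The other ingredient is that maps left orthogonal to the fibrations are weak equivalences, even
after tensoring with an arbitrary `Z`. A generating trivial cofibration is degreewise split, and its
cokernel has a contraction of one differential that anticommutes with the other. The contraction
survives as `s ⊗ 1` on tensor products and makes total complexes exact, so tensoring with `Z` gives
an injective quasi-isomorphism of totals. The class `totTrivialMonos`, of maps whose totals lift
against projections from injective discs to spheres, contains such maps and consists of weak
equivalences. Being defined by a left lifting property, it is closed under cobase change and
transfinite composition. This yields the monoid axiom, and with a retract argument the model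
structure (`llp_inf_totWeakEquivalences`).

For the pushout-product axiom, adjointness reduces to generators. There the pushout product is
degreewise split with cokernel `C ⊗ C'`. A lifting problem for a degreewise split inclusion against
`p` is solved by a section of a twisted fibre product over the cokernel, whose projection inherits
the lifting properties of `p` (`SplitExact.hasLiftingProperty`). Degreewise sections exist by
projectivity, and averaging over a contraction makes them commute with the differentials. The same
section argument shows that the unit is cofibrant. Closedness comes from the special adjoint functor
theorem, and the unit axiom from Ken Brown's factorization. -/

noncomputable section

/-! ### Quasi-isomorphisms of chain complexes in terms of elements. -/

namespace ChainComplexElements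

variable {k : Type u} [CommRing k] {K L : ChainComplex (ModuleCat.{u} k) ℤ}

/-- The map `k ⟶ M` sending `1` to `m`. -/
def ofElement {M : ModuleCat.{u} k} (m : M) : ModuleCat.of k k ⟶ M :=
  ModuleCat.ofHom (LinearMap.toSpanSingleton k M m)

lemma ofElement_apply_one {M : ModuleCat.{u} k} (m : M) : ofElement m (1 : k) = m := by
  simp [ofElement]

lemma ofElement_comp {M N : ModuleCat.{u} k} (m : M) (g : M ⟶ N) :
    ofElement m ≫ g = ofElement (g m) := by
  ext
  simp [ofElement]

lemma ofElement_zero {M : ModuleCat.{u} k} : ofElement (0 : M) = 0 := by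
  ext
  simp [ofElement]

lemma exists_of_epi {A : ModuleCat.{u} k} (π : A ⟶ ModuleCat.of k k) [Epi π] :
    ∃ a : A, π a = (1 : k) :=
  (ModuleCat.epi_iff_surjective π).1 inferInstance 1

/-- A family of elements solving an equation can be chosen functorially after a refinement. -/
lemma exists_refinement {A M N : ModuleCat.{u} k} (x : A ⟶ M) (d : N ⟶ M)
    (h : ∀ a : A, ∃ b : N, d b = x a) :
    ∃ (A' : ModuleCat.{u} k) (π : A' ⟶ A) (_ : Epi π) (y : A' ⟶ N), π ≫ x = y ≫ d := by
  -- The fibre product of `x` and `d`; the hypothesis says that its projection to `A` is surjective.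
  let S : Submodule k (A × N) :=
    LinearMap.ker (x.hom.comp (LinearMap.fst k A N) - d.hom.comp (LinearMap.snd k A N))
  refine ⟨ModuleCat.of k S, ModuleCat.ofHom ((LinearMap.fst k A N).comp S.subtype), ?_,
    ModuleCat.ofHom ((LinearMap.snd k A N).comp S.subtype), ?_⟩
  · rw [ModuleCat.epi_iff_surjective]
    intro a
    obtain ⟨b, hb⟩ := h a
    exact ⟨⟨(a, b), by simp [S, hb]⟩, rfl⟩
  · ext ⟨⟨a, b⟩, hab⟩
    simpa [S, sub_eq_zero] using hab

/-- The abelian-category criterion holds up to refinement by epimorphisms. Elements are maps from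
`k`, and an epimorphism onto `k` hits `1`, so refinements can be dropped; conversely
`exists_refinement` assembles elementwise solutions into a map. -/
lemma mono_homologyMap_iff (f : K ⟶ L) {i j l : ℤ} (hij : j + 1 = i) (hjl : l + 1 = j) :
    Mono (HomologicalComplex.homologyMap f j) ↔
      ∀ (a : K.X j) (b : L.X i), K.d j l a = 0 → f.f j a = L.d i j b →
        ∃ a', K.d i j a' = a := by
  rw [HomologicalComplex.mono_homologyMap_iff_up_to_refinements f i j l
    (ComplexShape.prev_eq' _ hij) (ComplexShape.next_eq' _ hjl)]
  constructor
  · intro h a b ha hab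
    obtain ⟨A, π, _, x, hx⟩ := h (ofElement a) (by rw [ofElement_comp, ha, ofElement_zero])
      (ofElement b) (by rw [ofElement_comp, ofElement_comp, hab])
    obtain ⟨t, ht⟩ := exists_of_epi π
    have : ofElement a (π t) = K.d i j (x t) := ConcreteCategory.congr_hom hx t
    rw [ht, ofElement_apply_one] at this
    exact ⟨x t, this.symm⟩
  · intro h A x hx y hxy
    apply exists_refinement
    intro a
    exact h _ (y a) (by simpa using ConcreteCategory.congr_hom hx a)
      (by simpa using ConcreteCategory.congr_hom hxy a)

lemma epi_homologyMap_iff (f : K ⟶ L) {i j l : ℤ} (hij : j + 1 = i) (hjl : l + 1 = j) :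
    Epi (HomologicalComplex.homologyMap f j) ↔
      ∀ b : L.X j, L.d j l b = 0 →
        ∃ a, K.d j l a = 0 ∧ ∃ b', b = f.f j a + L.d i j b' := by
  rw [HomologicalComplex.epi_homologyMap_iff_up_to_refinements f i j l
    (ComplexShape.prev_eq' _ hij) (ComplexShape.next_eq' _ hjl)]
  constructor
  · intro h b hb
    obtain ⟨A, π, _, x, hx, y, hy⟩ :=
      h (ofElement b) (by rw [ofElement_comp, hb, ofElement_zero])
    obtain ⟨t, ht⟩ := exists_of_epi π
    have : ofElement b (π t) = f.f j (x t) + L.d i j (y t) := ConcreteCategory.congr_hom hy t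
    rw [ht, ofElement_apply_one] at this
    exact ⟨x t, by simpa using ConcreteCategory.congr_hom hx t, y t, this⟩
  · intro h A y hy
    let Z := LinearMap.ker (K.d j l).hom
    let z : ModuleCat.of k (Z × L.X i) ⟶ L.X j :=
      ModuleCat.ofHom (LinearMap.coprod ((f.f j).hom.comp Z.subtype) (L.d i j).hom)
    obtain ⟨A', π, hπ, w, hw⟩ := exists_refinement y z (fun a => by
      obtain ⟨c, hc, b', hb'⟩ := h (y a) (by simpa using ConcreteCategory.congr_hom hy a)
      exact ⟨(⟨c, hc⟩, b'), hb'.symm⟩)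
    refine ⟨A', π, hπ, w ≫ ModuleCat.ofHom (Z.subtype.comp (LinearMap.fst k Z (L.X i))), ?_,
      w ≫ ModuleCat.ofHom (LinearMap.snd k Z (L.X i)), ?_⟩
    · ext t
      exact (w t).1.2
    · rw [hw]
      ext t
      rfl

lemma quasiIso_iff_forall (f : K ⟶ L) : QuasiIso f ↔
    ∀ {i j l : ℤ}, j + 1 = i → l + 1 = j →
      (∀ (a : K.X j) (b : L.X i), K.d j l a = 0 → f.f j a = L.d i j b →
        ∃ a', K.d i j a' = a) ∧
      ∀ b : L.X j, L.d j l b = 0 → ∃ a, K.d j l a = 0 ∧ ∃ b', b = f.f j a + L.d i j b' := by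
  rw [quasiIso_iff]
  simp only [quasiIsoAt_iff_isIso_homologyMap]
  constructor
  · intro h i j l hij hjl
    have := h j
    exact ⟨(mono_homologyMap_iff f hij hjl).1 inferInstance,
      (epi_homologyMap_iff f hij hjl).1 inferInstance⟩
  · intro h j
    have h' := h (i := j + 1) (j := j) (l := j - 1) rfl (by ring)
    have := (mono_homologyMap_iff f (i := j + 1) (j := j) (l := j - 1) rfl (by ring)).2 h'.1
    have := (epi_homologyMap_iff f (i := j + 1) (j := j) (l := j - 1) rfl (by ring)).2 h'.2
    exact isIso_of_mono_of_epi _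

lemma d_d_apply (K : ChainComplex (ModuleCat.{u} k) ℤ) (i j l : ℤ) (x : K.X i) :
    K.d j l (K.d i j x) = 0 :=
  ConcreteCategory.congr_hom (K.d_comp_d i j l) x

lemma comm_apply (f : K ⟶ L) (i j : ℤ) (x : K.X i) :
    L.d i j (f.f i x) = f.f j (K.d i j x) :=
  ConcreteCategory.congr_hom (f.comm i j) x

/-- The right lifting property against the inclusions of spheres into discs. -/
def SphereLift (f : K ⟶ L) : Prop :=
  ∀ {i j l : ℤ}, j + 1 = i → l + 1 = j → ∀ (y : L.X i) (x : K.X j), K.d j l x = 0 →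
    f.f j x = L.d i j y → ∃ x', f.f i x' = y ∧ K.d i j x' = x

/-- Lifting with suitable zero data gives surjectivity and both halves of the homology isomorphism.
Conversely, injectivity on homology solves the problem up to a cycle of the target, surjectivity on
homology solves it up to a boundary, and degreewise surjectivity removes the boundary. -/
lemma sphereLift_iff (f : K ⟶ L) :
    SphereLift f ↔ (∀ i, Function.Surjective (f.f i)) ∧ QuasiIso f := by
  rw [quasiIso_iff_forall]
  constructor
  · intro h
    refine ⟨fun i y => ?_, fun {i j l} hij hjl => ⟨fun a b ha hab => ?_, fun b hb => ?_⟩⟩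
    -- Lift the boundary of `y` to a cycle first; then `y` itself becomes a lifting problem.
    · obtain ⟨x, hx, hx'⟩ := h (i := i - 1) (j := i - 1 - 1) (l := i - 1 - 1 - 1) (by ring)
        (by ring) (L.d i (i - 1) y) 0 (by simp) (by simp [d_d_apply])
      obtain ⟨x', h', -⟩ := h (i := i) (j := i - 1) (l := i - 1 - 1) (by ring) (by ring) y x hx' hx
      exact ⟨x', h'⟩
    · obtain ⟨x, -, hx⟩ := h hij hjl b a ha hab
      exact ⟨x, hx⟩
    · obtain ⟨x, hx, hx'⟩ := h (i := j) (j := l) (l := l - 1) hjl (by ring) b 0 (by simp)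
        (by simp [hb])
      exact ⟨x, hx', 0, by simp [hx]⟩
  · rintro ⟨hs, h⟩ i j l hij hjl y x hx hxy
    obtain ⟨x₁, hx₁⟩ := (h hij hjl).1 x y hx hxy
    obtain ⟨x₂, hx₂, y₂, hy₂⟩ := (h (i := i + 1) (j := i) (l := j) rfl hij).2 (y - f.f i x₁)
      (by rw [map_sub, comm_apply, hx₁, hxy, sub_self])
    obtain ⟨x₃, rfl⟩ := hs _ y₂
    -- `x₁` has the prescribed boundary, the cycle `x₂` corrects its image up to the boundary of
    -- `y₂`, and `x₃` lifts `y₂`.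
    refine ⟨x₁ + x₂ + K.d _ _ x₃, ?_, ?_⟩
    · rw [comm_apply] at hy₂
      rw [map_add, map_add, add_assoc, ← hy₂, add_sub_cancel]
    · rw [map_add, map_add, hx₁, hx₂, d_d_apply, add_zero, add_zero]

end ChainComplexElements

/-! ### Pointwise limits and colimits of bicomplexes. -/

namespace Bicomplex

variable {k : Type u} [CommRing k]

/-- Evaluation at a bidegree. -/
@[simps]
def ev (k : Type u) [CommRing k] (i : ℤ × ℤ) : Bicomplex k ⥤ ModuleCat.{u} k where
  obj X := X.X i
  map f := f.f i

section

variable {J : Type u} [SmallCategory J] (F : J ⥤ Bicomplex k)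

section

/-- The inclusion into the pointwise colimit. -/
def colimι (i : ℤ × ℤ) (j : J) : (F.obj j).X i ⟶ colimit (F ⋙ ev k i) :=
  colimit.ι (F ⋙ ev k i) j

lemma colim_hom_ext {i : ℤ × ℤ} {A : ModuleCat.{u} k} {f g : colimit (F ⋙ ev k i) ⟶ A}
    (h : ∀ j, colimι F i j ≫ f = colimι F i j ≫ g) : f = g :=
  colimit.hom_ext h

/-- The map from the pointwise colimit induced by compatible maps. -/
def colimDesc (i : ℤ × ℤ) {A : ModuleCat.{u} k} (φ : ∀ j, (F.obj j).X i ⟶ A)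
    (hφ : ∀ ⦃j j' : J⦄ (u : j ⟶ j'), (F.map u).f i ≫ φ j' = φ j) : colimit (F ⋙ ev k i) ⟶ A :=
  colimit.desc (F ⋙ ev k i)
    { pt := A, ι := { app := φ, naturality := fun _ _ u => (hφ u).trans (Category.comp_id _).symm } }

lemma colimι_desc (i : ℤ × ℤ) {A : ModuleCat.{u} k} (φ : ∀ j, (F.obj j).X i ⟶ A)
    (hφ : ∀ ⦃j j' : J⦄ (u : j ⟶ j'), (F.map u).f i ≫ φ j' = φ j) (j : J) :
    colimι F i j ≫ colimDesc F i φ hφ = φ j :=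
  colimit.ι_desc _ _

lemma map_colimι (i : ℤ × ℤ) {j j' : J} (u : j ⟶ j') :
    (F.map u).f i ≫ colimι F i j' = colimι F i j :=
  colimit.w (F ⋙ ev k i) u

/-- The horizontal differential of the pointwise colimit. -/
def colimDh (i : ℤ × ℤ) : colimit (F ⋙ ev k i) ⟶ colimit (F ⋙ ev k (i.1 - 1, i.2)) :=
  colimDesc F i (fun j => (F.obj j).dh i ≫ colimι F _ j) fun _ _ u => by
    rw [← reassoc_of% (F.map u).comm_h i, map_colimι F]

/-- The vertical differential of the pointwise colimit. -/
def colimDv (i : ℤ × ℤ) : colimit (F ⋙ ev k i) ⟶ colimit (F ⋙ ev k (i.1, i.2 - 1)) :=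
  colimDesc F i (fun j => (F.obj j).dv i ≫ colimι F _ j) fun _ _ u => by
    rw [← reassoc_of% (F.map u).comm_v i, map_colimι F]

lemma colimι_dh (i : ℤ × ℤ) (j : J) :
    colimι F i j ≫ colimDh F i = (F.obj j).dh i ≫ colimι F _ j :=
  colimι_desc F _ _ _ _

lemma colimι_dv (i : ℤ × ℤ) (j : J) :
    colimι F i j ≫ colimDv F i = (F.obj j).dv i ≫ colimι F _ j :=
  colimι_desc F _ _ _ _

/-- The pointwise colimit. -/
def colimitObj : Bicomplex k where
  X i := colimit (F ⋙ ev k i)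
  isZero_of_neg i hi := by
    rw [IsZero.iff_id_eq_zero]
    exact colim_hom_ext F fun j => ((F.obj j).isZero_of_neg i hi).eq_of_src _ _
  dh := colimDh F
  dv := colimDv F
  dh_dh i := colim_hom_ext F fun j => by
    rw [reassoc_of% colimι_dh F i j, colimι_dh, reassoc_of% (F.obj j).dh_dh i, zero_comp, comp_zero]
  dv_dv i := colim_hom_ext F fun j => by
    rw [reassoc_of% colimι_dv F i j, colimι_dv, reassoc_of% (F.obj j).dv_dv i, zero_comp, comp_zero]
  dv_dh i := colim_hom_ext F fun j => by
    rw [Preadditive.comp_add, reassoc_of% colimι_dh F i j, colimι_dv, reassoc_of% colimι_dv F i j, colimι_dh, comp_zero]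
    have := (F.obj j).dv_dh i =≫ colimι F _ j
    rwa [Preadditive.add_comp, Category.assoc, Category.assoc, zero_comp] at this

/-- The inclusion into the pointwise colimit as a map of bicomplexes. -/
def colimitι (j : J) : F.obj j ⟶ colimitObj F where
  f i := colimι F i j
  comm_h i := (colimι_dh F i j).symm
  comm_v i := (colimι_dv F i j).symm

/-- The pointwise colimit cocone. -/
def colimitCocone : Cocone F where
  pt := colimitObj F
  ι :=
    { app := colimitι F
      naturality j j' φ := by
        ext i : 1
        exact (map_colimι F i φ).trans (Category.comp_id _).symm }

/-- The degreewise map out of the pointwise colimit. -/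
def colimDescCocone (s : Cocone F) (i : ℤ × ℤ) : colimit (F ⋙ ev k i) ⟶ s.pt.X i :=
  colimDesc F i (fun j => (s.ι.app j).f i) fun _ _ u => congr_arg (fun f => Hom.f f i) (s.w u)

lemma colimι_descCocone (s : Cocone F) (i : ℤ × ℤ) (j : J) :
    colimι F i j ≫ colimDescCocone F s i = (s.ι.app j).f i :=
  colimι_desc F i _ _ j

lemma colimDh_descCocone (s : Cocone F) (i : ℤ × ℤ) :
    colimDh F i ≫ colimDescCocone F s _ = colimDescCocone F s i ≫ s.pt.dh i :=
  colim_hom_ext F fun j => by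
    rw [reassoc_of% colimι_dh F i j, reassoc_of% colimι_descCocone F s i j, colimι_descCocone]
    exact (s.ι.app j).comm_h i

lemma colimDv_descCocone (s : Cocone F) (i : ℤ × ℤ) :
    colimDv F i ≫ colimDescCocone F s _ = colimDescCocone F s i ≫ s.pt.dv i :=
  colim_hom_ext F fun j => by
    rw [reassoc_of% colimι_dv F i j, reassoc_of% colimι_descCocone F s i j, colimι_descCocone]
    exact (s.ι.app j).comm_v i

/-- The map out of the pointwise colimit. -/
def colimitDesc (s : Cocone F) : colimitObj F ⟶ s.pt where
  f := colimDescCocone F s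
  comm_h := colimDh_descCocone F s
  comm_v := colimDv_descCocone F s

/-- The pointwise colimit cocone is a colimit. -/
def isColimitColimitCocone : IsColimit (colimitCocone F) where
  desc := colimitDesc F
  fac s j := by
    ext i : 1
    exact colimι_descCocone F s i j
  uniq s m hm := by
    ext i : 1
    exact colim_hom_ext F (f := m.f i) (g := colimDescCocone F s i) fun j =>
      (congr_arg (fun f => Hom.f f i) (hm j)).trans (colimι_descCocone F s i j).symm

scoped instance : HasColimitsOfShape J (Bicomplex k) where
  has_colimit F := ⟨⟨_, isColimitColimitCocone F⟩⟩

instance (i : ℤ × ℤ) : PreservesColimitsOfShape J (ev k i) where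
  preservesColimit {F} := preservesColimit_of_preserves_colimit_cocone (isColimitColimitCocone F)
    (IsColimit.ofIsoColimit (colimit.isColimit (F ⋙ ev k i))
      (Cocone.ext (Iso.refl _) fun j => Category.comp_id (colimι F i j)))

end

section

/-- The projection from the pointwise limit. -/
def limπ (i : ℤ × ℤ) (j : J) : limit (F ⋙ ev k i) ⟶ (F.obj j).X i :=
  limit.π (F ⋙ ev k i) j

lemma lim_hom_ext {i : ℤ × ℤ} {A : ModuleCat.{u} k} {f g : A ⟶ limit (F ⋙ ev k i)}
    (h : ∀ j, f ≫ limπ F i j = g ≫ limπ F i j) : f = g :=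
  limit.hom_ext h

/-- The map to the pointwise limit induced by compatible maps. -/
def limLift (i : ℤ × ℤ) {A : ModuleCat.{u} k} (φ : ∀ j, A ⟶ (F.obj j).X i)
    (hφ : ∀ ⦃j j' : J⦄ (u : j ⟶ j'), φ j ≫ (F.map u).f i = φ j') : A ⟶ limit (F ⋙ ev k i) :=
  limit.lift (F ⋙ ev k i)
    { pt := A, π := { app := φ, naturality := fun _ _ u => (Category.id_comp _).trans (hφ u).symm } }

lemma limLift_π (i : ℤ × ℤ) {A : ModuleCat.{u} k} (φ : ∀ j, A ⟶ (F.obj j).X i)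
    (hφ : ∀ ⦃j j' : J⦄ (u : j ⟶ j'), φ j ≫ (F.map u).f i = φ j') (j : J) :
    limLift F i φ hφ ≫ limπ F i j = φ j :=
  limit.lift_π _ _

lemma limπ_map (i : ℤ × ℤ) {j j' : J} (u : j ⟶ j') :
    limπ F i j ≫ (F.map u).f i = limπ F i j' :=
  limit.w (F ⋙ ev k i) u

/-- The horizontal differential of the pointwise limit. -/
def limDh (i : ℤ × ℤ) : limit (F ⋙ ev k i) ⟶ limit (F ⋙ ev k (i.1 - 1, i.2)) :=
  limLift F _ (fun j => limπ F _ j ≫ (F.obj j).dh i) fun _ _ u => by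
    rw [Category.assoc, (F.map u).comm_h i, reassoc_of% limπ_map F i u]

/-- The vertical differential of the pointwise limit. -/
def limDv (i : ℤ × ℤ) : limit (F ⋙ ev k i) ⟶ limit (F ⋙ ev k (i.1, i.2 - 1)) :=
  limLift F _ (fun j => limπ F _ j ≫ (F.obj j).dv i) fun _ _ u => by
    rw [Category.assoc, (F.map u).comm_v i, reassoc_of% limπ_map F i u]

lemma limDh_π (i : ℤ × ℤ) (j : J) :
    limDh F i ≫ limπ F _ j = limπ F i j ≫ (F.obj j).dh i :=
  limLift_π F _ _ _ _

lemma limDv_π (i : ℤ × ℤ) (j : J) :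
    limDv F i ≫ limπ F _ j = limπ F i j ≫ (F.obj j).dv i :=
  limLift_π F _ _ _ _

/-- The pointwise limit. -/
def limitObj : Bicomplex k where
  X i := limit (F ⋙ ev k i)
  isZero_of_neg i hi := by
    rw [IsZero.iff_id_eq_zero]
    exact lim_hom_ext F fun j => ((F.obj j).isZero_of_neg i hi).eq_of_tgt _ _
  dh := limDh F
  dv := limDv F
  dh_dh i := lim_hom_ext F fun j => by
    rw [Category.assoc, limDh_π, reassoc_of% limDh_π F i j, (F.obj j).dh_dh i, zero_comp, comp_zero]
  dv_dv i := lim_hom_ext F fun j => by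
    rw [Category.assoc, limDv_π, reassoc_of% limDv_π F i j, (F.obj j).dv_dv i, zero_comp, comp_zero]
  dv_dh i := lim_hom_ext F fun j => by
    rw [Preadditive.add_comp, Category.assoc, Category.assoc, limDh_π, limDv_π,
      reassoc_of% limDh_π F i j, reassoc_of% limDv_π F i j, zero_comp]
    have := limπ F _ j ≫= (F.obj j).dv_dh i
    rwa [Preadditive.comp_add, comp_zero] at this

/-- The projection from the pointwise limit as a map of bicomplexes. -/
def limitπ (j : J) : limitObj F ⟶ F.obj j where
  f i := limπ F i j
  comm_h i := limDh_π F i j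
  comm_v i := limDv_π F i j

/-- The pointwise limit cone. -/
def limitCone : Cone F where
  pt := limitObj F
  π :=
    { app := limitπ F
      naturality j j' φ := by
        ext i : 1
        exact (Category.id_comp _).trans (limπ_map F i φ).symm }

/-- The degreewise map to the pointwise limit. -/
def limLiftCone (s : Cone F) (i : ℤ × ℤ) : s.pt.X i ⟶ limit (F ⋙ ev k i) :=
  limLift F i (fun j => (s.π.app j).f i) fun _ _ u => congr_arg (fun f => Hom.f f i) (s.w u)

lemma limLiftCone_π (s : Cone F) (i : ℤ × ℤ) (j : J) :
    limLiftCone F s i ≫ limπ F i j = (s.π.app j).f i :=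
  limLift_π F i _ _ j

lemma limLiftCone_dh (s : Cone F) (i : ℤ × ℤ) :
    s.pt.dh i ≫ limLiftCone F s _ = limLiftCone F s i ≫ limDh F i :=
  lim_hom_ext F fun j => by
    rw [Category.assoc, Category.assoc, limDh_π, reassoc_of% limLiftCone_π F s i j, limLiftCone_π]
    exact (s.π.app j).comm_h i

lemma limLiftCone_dv (s : Cone F) (i : ℤ × ℤ) :
    s.pt.dv i ≫ limLiftCone F s _ = limLiftCone F s i ≫ limDv F i :=
  lim_hom_ext F fun j => by
    rw [Category.assoc, Category.assoc, limDv_π, reassoc_of% limLiftCone_π F s i j, limLiftCone_π]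
    exact (s.π.app j).comm_v i

/-- The map to the pointwise limit. -/
def limitLift (s : Cone F) : s.pt ⟶ limitObj F where
  f := limLiftCone F s
  comm_h := limLiftCone_dh F s
  comm_v := limLiftCone_dv F s

/-- The pointwise limit cone is a limit. -/
def isLimitLimitCone : IsLimit (limitCone F) where
  lift := limitLift F
  fac s j := by
    ext i : 1
    exact limLiftCone_π F s i j
  uniq s m hm := by
    ext i : 1
    exact lim_hom_ext F (f := m.f i) (g := limLiftCone F s i) fun j =>
      (congr_arg (fun f => Hom.f f i) (hm j)).trans (limLiftCone_π F s i j).symm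

scoped instance : HasLimitsOfShape J (Bicomplex k) where
  has_limit F := ⟨⟨_, isLimitLimitCone F⟩⟩

end

end

scoped instance : HasColimitsOfSize.{u, u} (Bicomplex k) where

scoped instance : HasLimitsOfSize.{u, u} (Bicomplex k) where

scoped instance : HasFiniteColimits (Bicomplex k) := hasFiniteColimits_of_hasColimitsOfSize _

scoped instance : HasFiniteLimits (Bicomplex k) := hasFiniteLimits_of_hasLimitsOfSize _

instance (i : ℤ × ℤ) : PreservesColimitsOfSize.{u, u} (ev k i) where

/-! ### Elementwise forms of the identities -/

section

variable (X : Bicomplex k) (i : ℤ × ℤ) (x : X.X i)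

lemma dh_dh_apply : X.dh (i.1 - 1, i.2) (X.dh i x) = 0 :=
  ConcreteCategory.congr_hom (X.dh_dh i) x

lemma dv_dv_apply : X.dv (i.1, i.2 - 1) (X.dv i x) = 0 :=
  ConcreteCategory.congr_hom (X.dv_dv i) x

lemma dv_dh_apply : X.dv (i.1 - 1, i.2) (X.dh i x) = -X.dh (i.1, i.2 - 1) (X.dv i x) :=
  eq_neg_of_add_eq_zero_left (ConcreteCategory.congr_hom (X.dv_dh i) x)

lemma eq_zero_of_neg (hi : i.1 < 0) : x = 0 := by
  have := ModuleCat.subsingleton_of_isZero (X.isZero_of_neg i hi)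
  exact Subsingleton.elim _ _

variable {X} {Y : Bicomplex k} (f : X ⟶ Y)

lemma comm_h_apply : f.f (i.1 - 1, i.2) (X.dh i x) = Y.dh i (f.f i x) :=
  ConcreteCategory.congr_hom (f.comm_h i) x

lemma comm_v_apply : f.f (i.1, i.2 - 1) (X.dv i x) = Y.dv i (f.f i x) :=
  ConcreteCategory.congr_hom (f.comm_v i) x

end

/-- A degreewise bijective map is an isomorphism. -/
lemma isIso_of_bijective {X Y : Bicomplex k} (f : X ⟶ Y)
    (h : ∀ i, Function.Bijective (f.f i)) : IsIso f := by
  have (i : ℤ × ℤ) : IsIso (f.f i) := (ConcreteCategory.isIso_iff_bijective _).2 (h i)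
  exact (isoMk (GradedObject.isoMk _ _ (fun i => asIso (f.f i))) f.comm_h f.comm_v).isIso_hom

lemma surjective_of_epi {X Y : Bicomplex k} (f : X ⟶ Y) [Epi f] (i : ℤ × ℤ) :
    Function.Surjective (f.f i) :=
  (ModuleCat.epi_iff_surjective _).1 (inferInstanceAs (Epi ((ev k i).map f)))

end Bicomplex

/-! ### Fibrations as lifting conditions, and the generating maps. -/

namespace Bicomplex

variable {k : Type u} [CommRing k]

/-- The relative lifting condition at a bidegree: vertical boundary problems can be solved. -/
def LiftsAt {X Y : Bicomplex k} (f : X ⟶ Y) (i : ℤ × ℤ) : Prop :=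
  ∀ (y : Y.X i) (x : X.X (i.1, i.2 - 1)), X.dv _ x = 0 → f.f _ x = Y.dv i y →
    ∃ x' : X.X i, f.f i x' = y ∧ X.dv i x' = x

/-- The surjective maps that have the vertical lifting property in the columns in `P`. -/
def surjLifts (k : Type u) [CommRing k] (P : ℤ → Prop) : MorphismProperty (Bicomplex k) :=
  fun _ _ f => (∀ i, Function.Surjective (f.f i)) ∧ ∀ i : ℤ × ℤ, P i.1 → LiftsAt f i

lemma surjective_of_liftsAt {X Y : Bicomplex k} (f : X ⟶ Y) (i : ℤ × ℤ)
    (h : LiftsAt f i) (h' : LiftsAt f (i.1, i.2 - 1)) : Function.Surjective (f.f i) := by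
  intro y
  obtain ⟨x, hx, hx'⟩ := h' (Y.dv i y) 0 (map_zero _) (by rw [map_zero, dv_dv_apply])
  obtain ⟨x', hx', -⟩ := h y x hx' hx
  exact ⟨x', hx'⟩

lemma liftsAt_column_iff {X Y : Bicomplex k} (f : X ⟶ Y) (p : ℤ) :
    (∀ q, LiftsAt f (p, q)) ↔ ChainComplexElements.SphereLift ((column k p).map f) := by
  constructor
  · rintro h i j l hij hjl
    obtain rfl : j = i - 1 := by omega
    obtain rfl : l = i - 1 - 1 := by omega
    have := h i
    intro y x hx hxy
    dsimp only [column] at *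
    rw [columnObj_d] at *
    exact this y x hx hxy
  · intro h q y x hx hxy
    have := h (i := q) (j := q - 1) (l := q - 1 - 1) (by omega) (by omega) y x
    dsimp only [column] at this
    rw [columnObj_d, columnObj_d, columnObj_d] at this
    exact this hx hxy

/-- A column is a chain complex, so once the map is pointwise surjective, `sphereLift_iff` trades
the quasi-isomorphism on a column for `LiftsAt` along it. -/
lemma totFibrations_eq : totFibrations k = surjLifts k (fun p => 0 < p) := by
  ext X Y f
  constructor
  · rintro ⟨h, h'⟩
    exact ⟨h, fun i hi => (liftsAt_column_iff f i.1).2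
      ((ChainComplexElements.sphereLift_iff _).2 ⟨fun q => h (i.1, q), h' i.1 hi⟩) i.2⟩
  · rintro ⟨h, h'⟩
    exact ⟨h, fun p hp => ((ChainComplexElements.sphereLift_iff _).1
      ((liftsAt_column_iff f p).1 fun q => h' (p, q) hp)).2⟩

/-! ### The generators -/

/-- The modules of the bicomplex generated by one element in bidegree `i` which is a vertical
cycle, with coordinates with respect to the generator and its horizontal differential. -/
def freeRow (k : Type u) [CommRing k] (i a : ℤ × ℤ) : Submodule k (k × k) where
  -- The conditions `0 ≤ a.1` truncate at column zero: the row is `k ⟶ k` for `i.1 > 0`, a single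
  -- `k` for `i.1 = 0`, and zero for `i.1 < 0`. Keeping both coordinates in every bidegree avoids
  -- transports along equalities of bidegrees.
  carrier := {x | (¬ (a = i ∧ 0 ≤ a.1) → x.1 = 0) ∧ (¬ (a = (i.1 - 1, i.2) ∧ 0 ≤ a.1) → x.2 = 0)}
  add_mem' := by
    rintro x y ⟨h₁, h₂⟩ ⟨h₃, h₄⟩
    exact ⟨fun h => by simp [h₁ h, h₃ h], fun h => by simp [h₂ h, h₄ h]⟩
  zero_mem' := ⟨fun _ => rfl, fun _ => rfl⟩
  smul_mem' := by
    rintro c x ⟨h₁, h₂⟩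
    exact ⟨fun h => by simp [h₁ h], fun h => by simp [h₂ h]⟩

instance (i a : ℤ × ℤ) : Projective (ModuleCat.of k (freeRow k i a)) := by
  rw [← IsProjective.iff_projective]
  -- A retraction from the free module `k × k`, multiplying each coordinate by `1` or `0` according
  -- to whether it is allowed.
  let r : k × k →ₗ[k] freeRow k i a := LinearMap.codRestrict _
    (((if a = i ∧ 0 ≤ a.1 then 1 else 0 : k) • LinearMap.fst k k k).prod
      ((if a = (i.1 - 1, i.2) ∧ 0 ≤ a.1 then 1 else 0 : k) • LinearMap.snd k k k))
    (fun x => ⟨fun h => by simp [h], fun h => by simp [h]⟩)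
  refine Module.Projective.of_split (freeRow k i a).subtype r ?_
  refine LinearMap.ext fun x => Subtype.ext (Prod.ext ?_ ?_)
  · by_cases h : a = i ∧ 0 ≤ a.1
    · simp only [r, if_pos h, one_smul]
      rfl
    · simp only [r, if_neg h, zero_smul]
      exact (x.2.1 h).symm
  · by_cases h : a = (i.1 - 1, i.2) ∧ 0 ≤ a.1
    · simp only [r, if_pos h, one_smul]
      rfl
    · simp only [r, if_neg h, zero_smul]
      exact (x.2.2 h).symm

/-- The horizontal differential of the generator. -/
def freeRowDh (i a : ℤ × ℤ) : freeRow k i a →ₗ[k] freeRow k i (a.1 - 1, a.2) where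
  -- The test matters for a generator in column zero, whose horizontal differential would land in
  -- column `-1`.
  toFun x := ⟨(0, if 0 ≤ a.1 - 1 then x.1.1 else 0), fun _ => rfl, fun h => by
    dsimp only
    split_ifs with ha
    · refine x.2.1 ?_
      rintro ⟨rfl, -⟩
      exact h ⟨rfl, ha⟩
    · rfl⟩
  map_add' x y := Subtype.ext (Prod.ext (add_zero 0).symm (by
    dsimp
    split_ifs <;> simp))
  map_smul' c x := Subtype.ext (Prod.ext (smul_zero c).symm (by
    dsimp
    split_ifs <;> simp))

lemma freeRowDh_coe (i a : ℤ × ℤ) (x : freeRow k i a) :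
    (freeRowDh i a x : k × k) = (0, if 0 ≤ a.1 - 1 then x.1.1 else 0) := rfl

/-- The bicomplex generated by one vertical cycle in bidegree `i`. -/
def rowObj (k : Type u) [CommRing k] (i : ℤ × ℤ) : Bicomplex k where
  X a := ModuleCat.of k (freeRow k i a)
  isZero_of_neg a ha := by
    have : Subsingleton (freeRow k i a) := ⟨fun x y => by
      have (z : freeRow k i a) : z.1 = 0 :=
        Prod.ext (z.2.1 (fun h => by omega)) (z.2.2 (fun h => by omega))
      exact Subtype.ext ((this x).trans (this y).symm)⟩
    exact ModuleCat.isZero_of_subsingleton _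
  dh a := ModuleCat.ofHom (freeRowDh i a)
  dv a := 0
  dh_dh a := by
    refine ModuleCat.hom_ext (LinearMap.ext fun x => Subtype.ext (Prod.ext rfl ?_))
    exact ite_self _
  dv_dv a := by simp
  dv_dh a := by simp

instance (i a : ℤ × ℤ) : Projective ((rowObj k i).X a) :=
  inferInstanceAs (Projective (ModuleCat.of k (freeRow k i a)))

/-- The generator. -/
def rowGen (k : Type u) [CommRing k] (i : ℤ × ℤ) : (rowObj k i).X i :=
  show freeRow k i i from ⟨(if 0 ≤ i.1 then 1 else 0, 0), fun h => by
    rw [if_neg (fun h' => h ⟨rfl, h'⟩)], fun _ => rfl⟩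

section

variable {X : Bicomplex k} {i : ℤ × ℤ}

/-- The linear map on the free row sending the generator to a given element. -/
def rowMap (z : X.X i) (a : ℤ × ℤ) : (rowObj k i).X a ⟶ X.X a :=
  ModuleCat.ofHom
    (LinearMap.toSpanSingleton k (X.X a) (Pi.single (M := fun a => X.X a) i z a) ∘ₗ LinearMap.fst k k k ∘ₗ
        (freeRow k i a).subtype +
      LinearMap.toSpanSingleton k (X.X a)
        (Pi.single (M := fun a => X.X a) (i.1 - 1, i.2) (X.dh i z) a) ∘ₗ
        LinearMap.snd k k k ∘ₗ (freeRow k i a).subtype)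

lemma rowMap_apply (z : X.X i) (a : ℤ × ℤ) (x : freeRow k i a) :
    rowMap z a x = x.1.1 • (Pi.single (M := fun a => X.X a) i z a) +
      x.1.2 • (Pi.single (M := fun a => X.X a) (i.1 - 1, i.2) (X.dh i z) a) := by
  rfl

lemma rowMap_dh (z : X.X i) (a : ℤ × ℤ) :
    (rowObj k i).dh a ≫ rowMap z (a.1 - 1, a.2) = rowMap z a ≫ X.dh a := by
  refine ModuleCat.hom_ext (LinearMap.ext fun x => ?_)
  obtain ⟨⟨α, β⟩, h₁, h₂⟩ : freeRow k i a := x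
  refine (rowMap_apply z _ (freeRowDh i a ⟨(α, β), h₁, h₂⟩)).trans ?_
  refine Eq.trans ?_ (congr_arg (X.dh a) (rowMap_apply z a ⟨(α, β), h₁, h₂⟩)).symm
  rw [freeRowDh_coe, map_add, map_smul, map_smul, zero_smul, zero_add]
  have e : β • X.dh a (Pi.single (M := fun a => X.X a) (i.1 - 1, i.2) (X.dh i z) a) = 0 := by
    by_cases ha : a = (i.1 - 1, i.2)
    · subst ha
      rw [Pi.single_eq_same, dh_dh_apply, smul_zero]
    · rw [Pi.single_eq_of_ne ha, map_zero, smul_zero]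
  rw [e, add_zero]
  by_cases ha : a = i
  · subst ha
    rw [Pi.single_eq_same, Pi.single_eq_same]
    by_cases hp : 0 ≤ a.1 - 1
    · rw [if_pos hp]
    -- Where the row has been truncated, the horizontal differential of `z` lies in a negative
    -- column of `X` and vanishes too.
    · rw [eq_zero_of_neg X (a.1 - 1, a.2) (X.dh a z) (by dsimp; omega), smul_zero, smul_zero]
  · have : α = 0 := h₁ (fun h => ha h.1)
    simp [this]

lemma rowMap_gen (z : X.X i) : rowMap z i (rowGen k i) = z := by
  refine (rowMap_apply z i (rowGen k i)).trans ?_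
  by_cases hi : 0 ≤ i.1
  · simp [rowGen, hi]
  · simp [rowGen, hi, eq_zero_of_neg X i z (by omega)]

/-- Degreewise maps out of a row commuting with the horizontal differential are determined by
the image of the generator. -/
lemma rowObj_ext {g g' : ∀ a, (rowObj k i).X a ⟶ X.X a}
    (hg : ∀ a, (rowObj k i).dh a ≫ g _ = g a ≫ X.dh a)
    (hg' : ∀ a, (rowObj k i).dh a ≫ g' _ = g' a ≫ X.dh a)
    (h : g i (rowGen k i) = g' i (rowGen k i)) (a : ℤ × ℤ) : g a = g' a := by
  refine ModuleCat.hom_ext (LinearMap.ext fun x => ?_)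
  obtain ⟨⟨α, β⟩, h₁, h₂⟩ : freeRow k i a := x
  by_cases ha : a = i ∧ 0 ≤ a.1
  · obtain ⟨rfl, ha⟩ := ha
    have : (⟨(α, β), h₁, h₂⟩ : freeRow k a a) = α • (rowGen k a : freeRow k a a) := by
      refine Subtype.ext (Prod.ext ?_ ?_)
      · refine (mul_one α).symm.trans (congr_arg (α * ·) (if_pos ha).symm)
      · exact (h₂ (by rintro ⟨h, -⟩; have := congr_arg Prod.fst h; dsimp at this; omega)).trans
          (mul_zero α).symm
    rw [this]
    refine (map_smul (g a).hom α (rowGen k a)).trans ?_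
    refine Eq.trans ?_ (map_smul (g' a).hom α (rowGen k a)).symm
    exact congr_arg _ h
  · by_cases hb : a = (i.1 - 1, i.2) ∧ 0 ≤ a.1
    · obtain ⟨rfl, hb⟩ := hb
      have : (⟨(α, β), h₁, h₂⟩ : freeRow k i (i.1 - 1, i.2)) =
          β • ((rowObj k i).dh i (rowGen k i) : freeRow k i (i.1 - 1, i.2)) := by
        refine Subtype.ext ?_
        refine Eq.trans ?_ (congr_arg (β • ·) (freeRowDh_coe i i (rowGen k i))).symm
        refine Prod.ext ?_ ?_
        · exact (h₁ ha).trans (by simp)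
        · dsimp at hb
          rw [if_pos hb]
          exact (mul_one β).symm.trans (congr_arg (β * ·) (if_pos (by omega)).symm)
      rw [this]
      refine (map_smul (g _).hom β ((rowObj k i).dh i (rowGen k i))).trans ?_
      refine Eq.trans ?_ (map_smul (g' _).hom β ((rowObj k i).dh i (rowGen k i))).symm
      refine congr_arg _ ?_
      refine (ConcreteCategory.congr_hom (hg i) (rowGen k i)).trans ?_
      refine Eq.trans ?_ (ConcreteCategory.congr_hom (hg' i) (rowGen k i)).symm
      exact congr_arg _ h
    · have : (⟨(α, β), h₁, h₂⟩ : freeRow k i a) = 0 := Subtype.ext (Prod.ext (h₁ ha) (h₂ hb))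
      rw [this]
      exact (map_zero (g a).hom).trans (map_zero (g' a).hom).symm

/-- The map out of a row classifying a vertical cycle. -/
def rowDesc (z : X.X i) (hz : X.dv i z = 0) : rowObj k i ⟶ X where
  f a := rowMap z a
  comm_h a := rowMap_dh z a
  comm_v a := by
    refine zero_comp.trans ?_
    ext x
    refine Eq.trans ?_ (congr_arg (X.dv a) (rowMap_apply z a x)).symm
    rw [map_add, map_smul, map_smul]
    have e : X.dv a (Pi.single (M := fun a => X.X a) (i.1 - 1, i.2) (X.dh i z) a) = 0 := by
      by_cases ha : a = (i.1 - 1, i.2)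
      · subst ha
        rw [Pi.single_eq_same, dv_dh_apply, hz, map_zero, neg_zero]
      · rw [Pi.single_eq_of_ne ha, map_zero]
    have e' : X.dv a (Pi.single (M := fun a => X.X a) i z a) = 0 := by
      by_cases ha : a = i
      · subst ha
        rw [Pi.single_eq_same, hz]
      · rw [Pi.single_eq_of_ne ha, map_zero]
    rw [e, e', smul_zero, smul_zero, add_zero]
    rfl

lemma rowDesc_gen (z : X.X i) (hz : X.dv i z = 0) : (rowDesc z hz).f i (rowGen k i) = z :=
  rowMap_gen z

lemma rowHom_ext {g g' : rowObj k i ⟶ X} (h : g.f i (rowGen k i) = g'.f i (rowGen k i)) : g = g' :=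
  hom_ext (rowObj_ext g.comm_h g'.comm_h h)

end

/-! ### The vertical discs -/

/-- The comparison of consecutive rows in a disc. -/
def rowShift (i a : ℤ × ℤ) : freeRow k i a →ₗ[k] freeRow k (i.1, i.2 - 1) (a.1, a.2 - 1) :=
  -- The second coordinate belongs to the horizontal differential of the generator; the sign is
  -- forced by `d_v d_h = -d_h d_v`.
  LinearMap.codRestrict _ (((LinearMap.fst k k k).prod (-LinearMap.snd k k k)) ∘ₗ
    (freeRow k i a).subtype) (by
    rintro ⟨x, h₁, h₂⟩
    refine ⟨fun h => ?_, fun h => ?_⟩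
    · exact h₁ (by rintro ⟨rfl, h'⟩; exact h ⟨rfl, h'⟩)
    · have : x.2 = 0 := h₂ (by rintro ⟨rfl, h'⟩; exact h ⟨rfl, h'⟩)
      simp [this])

lemma rowShift_coe (i a : ℤ × ℤ) (x : freeRow k i a) :
    (rowShift i a x : k × k) = (x.1.1, -x.1.2) := rfl

lemma rowShift_dh (i a : ℤ × ℤ) (x : freeRow k i a) :
    freeRowDh _ _ (rowShift i a x) = -rowShift i _ (freeRowDh i a x) := by
  refine Subtype.ext ?_
  rw [freeRowDh_coe, Submodule.coe_neg, rowShift_coe, rowShift_coe, freeRowDh_coe]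
  simp

/-- The bicomplex generated by one element in bidegree `i`. -/
def discObj (k : Type u) [CommRing k] (i : ℤ × ℤ) : Bicomplex k where
  X a := ModuleCat.of k (freeRow k (i.1, i.2 - 1) a × freeRow k i a)
  isZero_of_neg a ha := by
    have h (j : ℤ × ℤ) : Subsingleton (freeRow k j a) :=
      ModuleCat.subsingleton_of_isZero ((rowObj k j).isZero_of_neg a ha)
    have := h i
    have := h (i.1, i.2 - 1)
    exact ModuleCat.isZero_of_subsingleton _
  dh a := ModuleCat.ofHom ((freeRowDh _ a).prodMap (freeRowDh _ a))
  dv a := ModuleCat.ofHom (LinearMap.inl k _ _ ∘ₗ rowShift i a ∘ₗ LinearMap.snd k _ _)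
  dh_dh a := ModuleCat.hom_ext (LinearMap.ext fun x => Prod.ext
    (ConcreteCategory.congr_hom ((rowObj k _).dh_dh a) x.1)
    (ConcreteCategory.congr_hom ((rowObj k _).dh_dh a) x.2))
  dv_dv a := ModuleCat.hom_ext (LinearMap.ext fun x => Prod.ext (map_zero (rowShift i _)) rfl)
  dv_dh a := ModuleCat.hom_ext (LinearMap.ext fun x => Prod.ext
    ((congr_arg (rowShift i _ (freeRowDh i a x.2) + ·) (rowShift_dh i a x.2)).trans
      (add_neg_cancel _)) ((congr_arg (0 + ·) (map_zero (freeRowDh i _))).trans (add_zero 0)))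

/-- The generator. -/
def discGen (k : Type u) [CommRing k] (i : ℤ × ℤ) : (discObj k i).X i :=
  ((0 : freeRow k (i.1, i.2 - 1) i), (rowGen k i : freeRow k i i))

/-- The degreewise inclusion of the second row. -/
def discInr (i a : ℤ × ℤ) : (rowObj k i).X a ⟶ (discObj k i).X a :=
  ModuleCat.ofHom (LinearMap.inr k _ _)

/-- The degreewise projection to the first row. -/
def discFst (i a : ℤ × ℤ) : (discObj k i).X a ⟶ (rowObj k (i.1, i.2 - 1)).X a :=
  ModuleCat.ofHom (LinearMap.fst k _ _)

/-- The inclusion of the first row. -/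
def discInl (k : Type u) [CommRing k] (i : ℤ × ℤ) : rowObj k (i.1, i.2 - 1) ⟶ discObj k i where
  f _ := ModuleCat.ofHom (LinearMap.inl k _ _)
  comm_h a := ModuleCat.hom_ext (LinearMap.ext fun _ => Prod.ext rfl (map_zero (freeRowDh i a)).symm)
  comm_v a := ModuleCat.hom_ext (LinearMap.ext fun _ => Prod.ext (map_zero (rowShift i a)).symm rfl)

/-- The projection to the second row. -/
def discSnd (k : Type u) [CommRing k] (i : ℤ × ℤ) : discObj k i ⟶ rowObj k i where
  f _ := ModuleCat.ofHom (LinearMap.snd k _ _)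
  comm_h _ := rfl
  comm_v _ := rfl

lemma discInr_dh (i a : ℤ × ℤ) :
    (rowObj k i).dh a ≫ discInr i _ = discInr i a ≫ (discObj k i).dh a :=
  ModuleCat.hom_ext (LinearMap.ext fun _ => Prod.ext (map_zero (freeRowDh _ a)).symm rfl)

lemma disc_total (i a : ℤ × ℤ) :
    discFst i a ≫ (discInl k i).f a + (discSnd k i).f a ≫ discInr i a = 𝟙 _ :=
  ModuleCat.hom_ext (LinearMap.ext fun x => Prod.ext (add_zero x.1) (zero_add x.2))

instance (i a : ℤ × ℤ) : Projective ((discObj k i).X a) := by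
  have h (j : ℤ × ℤ) : Module.Projective k (freeRow k j a) :=
    (IsProjective.iff_projective _).2 (inferInstanceAs (Projective (ModuleCat.of k (freeRow k j a))))
  have := h i
  have := h (i.1, i.2 - 1)
  exact (IsProjective.iff_projective _).1
    (inferInstanceAs (Module.Projective k (freeRow k (i.1, i.2 - 1) a × freeRow k i a)))

lemma rowGen_dv (i : ℤ × ℤ) :
    (discObj k i).dv i (discGen k i) = (discInl k i).f _ (rowGen k (i.1, i.2 - 1)) :=
  Prod.ext (Subtype.ext (Prod.ext rfl neg_zero)) rfl

section

variable {X : Bicomplex k} {i : ℤ × ℤ}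

lemma rowMap_dv (z : X.X i) (a : ℤ × ℤ) (x : freeRow k i a) :
    X.dv a (rowMap z a x) = rowMap (X.dv i z) (a.1, a.2 - 1) (rowShift i a x) := by
  refine (congr_arg (X.dv a) (rowMap_apply z a x)).trans ?_
  refine Eq.trans ?_ (rowMap_apply (X.dv i z) _ (rowShift i a x)).symm
  rw [map_add, map_smul, map_smul, rowShift_coe]
  congr 1
  · by_cases ha : a = i
    · subst ha
      rw [Pi.single_eq_same, Pi.single_eq_same]
    · rw [x.2.1 (fun h => ha h.1), zero_smul, zero_smul]
  · by_cases ha : a = (i.1 - 1, i.2)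
    · subst ha
      dsimp only
      rw [Pi.single_eq_same, Pi.single_eq_same, dv_dh_apply, smul_neg, neg_smul]
    · rw [x.2.2 (fun h => ha h.1), zero_smul, neg_zero, zero_smul]

/-- The map out of a disc classifying an element. -/
def discDesc (z : X.X i) : discObj k i ⟶ X where
  f a := ModuleCat.ofHom ((rowMap (X.dv i z) a).hom.coprod (rowMap z a).hom)
  comm_h a := ModuleCat.hom_ext (LinearMap.ext fun x =>
    (congr_arg₂ (· + ·) (ConcreteCategory.congr_hom (rowMap_dh (X.dv i z) a) x.1)
      (ConcreteCategory.congr_hom (rowMap_dh z a) x.2)).trans (map_add (X.dh a).hom _ _).symm)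
  comm_v a := ModuleCat.hom_ext (LinearMap.ext fun x => by
    have h₁ := ConcreteCategory.congr_hom ((rowDesc (X.dv i z) (dv_dv_apply X i z)).comm_v a) x.1
    have h₁' : X.dv a (rowMap (X.dv i z) a x.1) = 0 := h₁.symm.trans (map_zero (rowMap _ _).hom)
    refine Eq.trans ?_ (map_add (X.dv a).hom _ _).symm
    refine Eq.trans ?_ (congr_arg₂ (· + ·) h₁' (rowMap_dv z a x.2)).symm
    refine (congr_arg (_ + ·) (map_zero (rowMap z _).hom)).trans ?_
    exact (add_zero _).trans (zero_add _).symm)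

lemma discDesc_gen (z : X.X i) : (discDesc z).f i (discGen k i) = z :=
  (congr_arg₂ (· + ·) (map_zero (rowMap _ _).hom) (rowMap_gen z)).trans (zero_add _)

/-- Degreewise a disc is a sum of two rows. The first is a subobject generated by the vertical
differential of the disc generator. The second is closed only under the horizontal differential,
which is why `rowObj_ext` concerns degreewise maps compatible with that differential alone. -/
lemma discHom_ext {g g' : discObj k i ⟶ X} (h : g.f i (discGen k i) = g'.f i (discGen k i)) :
    g = g' := by
  have h₁ : discInl k i ≫ g = discInl k i ≫ g' := rowHom_ext (by
    have := congr_arg (X.dv i) h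
    rw [← comm_v_apply, ← comm_v_apply, rowGen_dv] at this
    exact this)
  have h₂ (a) : discInr i a ≫ g.f a = discInr i a ≫ g'.f a := by
    refine rowObj_ext (g := fun a => discInr i a ≫ g.f a) (g' := fun a => discInr i a ≫ g'.f a)
      (fun a => ?_) (fun a => ?_) h a
    · rw [Category.assoc, ← g.comm_h, ← Category.assoc, discInr_dh, Category.assoc]
    · rw [Category.assoc, ← g'.comm_h, ← Category.assoc, discInr_dh, Category.assoc]
  ext a : 1
  rw [← Category.id_comp (g.f a), ← Category.id_comp (g'.f a), ← disc_total,
    Preadditive.add_comp, Preadditive.add_comp, Category.assoc, Category.assoc, Category.assoc,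
    Category.assoc, h₂]
  exact congr_arg (discFst i a ≫ · + _) (congr_arg (fun f => Hom.f f a) h₁)

end

/-! ### Lifting properties against the generators -/

section

variable {X Y : Bicomplex k} (f : X ⟶ Y) (i : ℤ × ℤ)

/-- Maps out of a row are vertical cycles and maps out of a disc are elements, so a commutative
square is precisely the datum `(x, y)` in `LiftsAt`, and a diagonal is precisely a solution. -/
lemma hasLiftingProperty_discInl_iff : HasLiftingProperty (discInl k i) f ↔ LiftsAt f i := by
  constructor
  · intro h y x hx hxy
    have sq : CommSq (rowDesc x hx) (discInl k i) f (discDesc y) := ⟨rowHom_ext (by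
      refine (congr_arg (f.f _) (rowDesc_gen x hx)).trans (hxy.trans ?_)
      refine Eq.trans ?_ (congr_arg ((discDesc y).f _) (rowGen_dv i))
      rw [comm_v_apply, discDesc_gen])⟩
    refine ⟨sq.lift.f i (discGen k i), ?_, ?_⟩
    · exact (congr_arg (fun g => Hom.f g i (discGen k i)) sq.fac_right).trans (discDesc_gen y)
    · rw [← comm_v_apply, rowGen_dv]
      exact (congr_arg (fun g => Hom.f g _ (rowGen k _)) sq.fac_left).trans (rowDesc_gen x hx)
  · intro h
    refine ⟨fun {g g'} sq => ?_⟩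
    have hg : X.dv _ (g.f _ (rowGen k (i.1, i.2 - 1))) = 0 := by
      rw [← comm_v_apply]
      exact map_zero (g.f _).hom
    obtain ⟨x, hx, hx'⟩ := h (g'.f i (discGen k i)) (g.f _ (rowGen k (i.1, i.2 - 1))) hg (by
      rw [← comm_v_apply, rowGen_dv]
      exact congr_arg (fun g => Hom.f g _ (rowGen k _)) sq.w)
    refine ⟨⟨⟨discDesc x, rowHom_ext ?_, discHom_ext ?_⟩⟩⟩
    · refine (congr_arg ((discDesc x).f _) (rowGen_dv i)).symm.trans ?_
      rw [comm_v_apply, discDesc_gen, hx']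
    · exact (congr_arg (f.f i) (discDesc_gen x)).trans hx

/-- The zero bicomplex. -/
def zeroObj (k : Type u) [CommRing k] : Bicomplex k where
  X _ := ModuleCat.of k PUnit
  isZero_of_neg _ _ := ModuleCat.isZero_of_subsingleton _
  dh _ := 0
  dv _ := 0
  dh_dh _ := zero_comp
  dv_dv _ := zero_comp
  dv_dh _ := by simp

/-- The map out of the zero bicomplex. -/
def fromZero (X : Bicomplex k) : zeroObj k ⟶ X where
  f _ := 0
  comm_h _ := by simp
  comm_v _ := by simp

lemma fromZero_uniq (g : zeroObj k ⟶ X) : g = fromZero X := by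
  ext a : 1
  exact (ModuleCat.isZero_of_subsingleton (ModuleCat.of k PUnit)).eq_of_src _ _

lemma hasLiftingProperty_fromZero_iff :
    HasLiftingProperty (fromZero (discObj k i)) f ↔ Function.Surjective (f.f i) := by
  constructor
  · intro h y
    have sq : CommSq (fromZero X) (fromZero (discObj k i)) f (discDesc y) :=
      ⟨(fromZero_uniq _).trans (fromZero_uniq _).symm⟩
    exact ⟨sq.lift.f i (discGen k i),
      (congr_arg (fun g => Hom.f g i (discGen k i)) sq.fac_right).trans (discDesc_gen y)⟩
  · intro h
    refine ⟨fun {g g'} sq => ?_⟩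
    obtain ⟨x, hx⟩ := h (g'.f i (discGen k i))
    exact ⟨⟨⟨discDesc x, (fromZero_uniq _).trans (fromZero_uniq _).symm, discHom_ext
      ((congr_arg (f.f i) (discDesc_gen x)).trans hx)⟩⟩⟩

end

/-- The generating maps: the inclusions into discs in the columns in `P` and the maps from zero
to the discs in the other columns. -/
inductive generators (k : Type u) [CommRing k] (P : ℤ → Prop) : MorphismProperty (Bicomplex k)
  | row (i : ℤ × ℤ) (hi : P i.1) : generators k P (discInl k i)
  | zero (i : ℤ × ℤ) (hi : ¬ P i.1) : generators k P (fromZero (discObj k i))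

/-- In the columns of `P`, surjectivity is automatic from lifting at two consecutive bidegrees; in
the others it is imposed by the maps from zero to the discs. -/
lemma generators_rlp (P : ℤ → Prop) : (generators k P).rlp = surjLifts k P := by
  ext X Y f
  constructor
  · intro h
    have h' (i : ℤ × ℤ) (hi : P i.1) : LiftsAt f i :=
      (hasLiftingProperty_discInl_iff f i).1 (h _ (generators.row i hi))
    refine ⟨fun i => ?_, h'⟩
    by_cases hi : P i.1
    · exact surjective_of_liftsAt f i (h' i hi) (h' (i.1, i.2 - 1) hi)
    · exact (hasLiftingProperty_fromZero_iff f i).1 (h _ (generators.zero i hi))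
  · rintro h _ _ _ (⟨i, hi⟩ | ⟨i, hi⟩)
    · exact (hasLiftingProperty_discInl_iff f i).2 (h.2 i hi)
    · exact (hasLiftingProperty_fromZero_iff f i).2 (h.1 i)

end Bicomplex

/-! ### Components of total complexes and the filtration by columns. -/

namespace Bicomplex

variable {k : Type u} [CommRing k]

section

variable (X : Bicomplex k)

/-- The inclusion of a summand of the total complex. -/
def totι (i : ℤ × ℤ) (n : ℤ) (h : i.1 + i.2 = n) : X.X i ⟶ X.totObj.X n :=
  X.X.ιMapObj (fun i => i.1 + i.2) i n h

lemma tot_hom_ext {n : ℤ} {A : ModuleCat.{u} k} {f g : X.totObj.X n ⟶ A}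
    (h : ∀ i hi, X.totι i n hi ≫ f = X.totι i n hi ≫ g) : f = g :=
  GradedObject.mapObj_ext _ _ _ _ h

/-- The map out of a module of the total complex given by its restrictions to the summands. -/
def totDesc {n : ℤ} {A : ModuleCat.{u} k} (φ : ∀ i : ℤ × ℤ, i.1 + i.2 = n → (X.X i ⟶ A)) :
    X.totObj.X n ⟶ A :=
  X.X.descMapObj (fun i => i.1 + i.2) φ

lemma totι_desc {n : ℤ} {A : ModuleCat.{u} k} (φ : ∀ i : ℤ × ℤ, i.1 + i.2 = n → (X.X i ⟶ A))
    (i : ℤ × ℤ) (hi : i.1 + i.2 = n) : X.totι i n hi ≫ X.totDesc φ = φ i hi :=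
  GradedObject.ι_descMapObj _ _ _ _ _

lemma totι_d (i : ℤ × ℤ) (n m : ℤ) (hi : i.1 + i.2 = n) (h : m + 1 = n) :
    X.totι i n hi ≫ X.totObj.d n m =
      X.dh i ≫ X.totι (i.1 - 1, i.2) m (by dsimp; omega) +
      X.dv i ≫ X.totι (i.1, i.2 - 1) m (by dsimp; omega) :=
  X.ι_totD i n m hi h

lemma d_totι_apply (i : ℤ × ℤ) (n m : ℤ) (hi : i.1 + i.2 = n) (h : m + 1 = n) (x : X.X i) :
    X.totObj.d n m (X.totι i n hi x) =
      X.totι (i.1 - 1, i.2) m (by dsimp; omega) (X.dh i x) +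
      X.totι (i.1, i.2 - 1) m (by dsimp; omega) (X.dv i x) :=
  ConcreteCategory.congr_hom (X.totι_d i n m hi h) x

/-- The map induced on total complexes. -/
def totHom {X Y : Bicomplex k} (f : X ⟶ Y) : X.totObj ⟶ Y.totObj := (tot k).map f

lemma totι_map {X Y : Bicomplex k} (f : X ⟶ Y) (i : ℤ × ℤ) (n : ℤ) (hi : i.1 + i.2 = n) :
    X.totι i n hi ≫ (totHom f).f n = f.f i ≫ Y.totι i n hi :=
  GradedObject.ι_mapMap _ _ _ _ _

lemma map_totι_apply {X Y : Bicomplex k} (f : X ⟶ Y) (i : ℤ × ℤ) (n : ℤ) (hi : i.1 + i.2 = n)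
    (x : X.X i) : (totHom f).f n (X.totι i n hi x) = Y.totι i n hi (f.f i x) :=
  ConcreteCategory.congr_hom (totι_map f i n hi) x

/-- The projection onto a summand of the total complex. -/
def totπ (n : ℤ) (i : ℤ × ℤ) : X.totObj.X n ⟶ X.X i :=
  X.totDesc fun a _ => if h : a = i then eqToHom (by rw [h]) else 0

lemma totι_π_self (n : ℤ) (i : ℤ × ℤ) (hi : i.1 + i.2 = n) :
    X.totι i n hi ≫ X.totπ n i = 𝟙 _ := by
  rw [totπ, totι_desc, dif_pos rfl, eqToHom_refl]

lemma totι_π_of_ne (n : ℤ) {a i : ℤ × ℤ} (ha : a.1 + a.2 = n) (h : a ≠ i) :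
    X.totι a n ha ≫ X.totπ n i = 0 := by
  rw [totπ, totι_desc, dif_neg h]

lemma totπ_totι_self_apply (n : ℤ) (i : ℤ × ℤ) (hi : i.1 + i.2 = n) (x : X.X i) :
    X.totπ n i (X.totι i n hi x) = x :=
  ConcreteCategory.congr_hom (X.totι_π_self n i hi) x

lemma totπ_totι_of_ne_apply (n : ℤ) {a i : ℤ × ℤ} (ha : a.1 + a.2 = n) (h : a ≠ i) (x : X.X a) :
    X.totπ n i (X.totι a n ha x) = 0 :=
  ConcreteCategory.congr_hom (X.totι_π_of_ne n ha h) x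

lemma totπ_eq_zero (n : ℤ) (i : ℤ × ℤ) (hi : i.1 + i.2 ≠ n) : X.totπ n i = 0 :=
  X.tot_hom_ext fun a ha => by
    rw [totι_π_of_ne _ _ _ (by rintro rfl; exact hi ha), comp_zero]

lemma totπ_apply_of_ne (n : ℤ) (i : ℤ × ℤ) (hi : i.1 + i.2 ≠ n) (x : X.totObj.X n) :
    X.totπ n i x = 0 := by
  rw [totπ_eq_zero _ _ _ hi]
  rfl

lemma map_totπ {X Y : Bicomplex k} (f : X ⟶ Y) (n : ℤ) (i : ℤ × ℤ) :
    (totHom f).f n ≫ Y.totπ n i = X.totπ n i ≫ f.f i :=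
  X.tot_hom_ext fun a ha => by
    rw [← Category.assoc, ← Category.assoc, totι_map, Category.assoc]
    by_cases h : a = i
    · subst h
      rw [totι_π_self, totι_π_self, Category.comp_id, Category.id_comp]
    · rw [totι_π_of_ne _ _ _ h, totι_π_of_ne _ _ _ h, comp_zero, zero_comp]

lemma totπ_map_apply {X Y : Bicomplex k} (f : X ⟶ Y) (n : ℤ) (i : ℤ × ℤ) (x : X.totObj.X n) :
    Y.totπ n i ((totHom f).f n x) = f.f i (X.totπ n i x) :=
  ConcreteCategory.congr_hom (map_totπ f n i) x

/-- Only two summands reach a given bidegree: the one above it in the same column and the one to its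
right. The second contribution enters through an unspecified `c`, since it will only be used when
the component to the right vanishes. -/
lemma tot_d_π (n m : ℤ) (h : m + 1 = n) (i : ℤ × ℤ) (hi : i.1 + i.2 = n) :
    ∃ c : X.X (i.1 + 1, i.2 - 1) ⟶ X.X (i.1, i.2 - 1),
      X.totObj.d n m ≫ X.totπ m (i.1, i.2 - 1) =
        X.totπ n i ≫ X.dv i + X.totπ n (i.1 + 1, i.2 - 1) ≫ c := by
  refine ⟨X.dh (i.1 + 1, i.2 - 1) ≫ eqToHom (by simp), X.tot_hom_ext fun a ha => ?_⟩
  rw [← Category.assoc, totι_d _ _ _ _ ha h, Preadditive.add_comp, Category.assoc, Category.assoc,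
    Preadditive.comp_add]
  by_cases h₁ : a = i
  · subst h₁
    rw [totι_π_self, totι_π_of_ne _ _ _ (fun h => by simp at h),
      ← Category.assoc, totι_π_self, ← Category.assoc,
      totι_π_of_ne _ _ _ (fun h => by simp [Prod.ext_iff] at h)]
    simp
  · by_cases h₂ : a = (i.1 + 1, i.2 - 1)
    · subst h₂
      rw [totι_π_of_ne (a := (i.1 + 1, i.2 - 1 - 1)) _ _ _ (fun h => by simp at h),
        ← Category.assoc (X.totι _ _ _), totι_π_of_ne _ _ _ (fun h => h₁ h), ← Category.assoc (X.totι _ _ _),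
        totι_π_self, zero_comp, zero_add, comp_zero, add_zero, Category.id_comp]
      congr 1
      rw [totπ, totι_desc, dif_pos (by simp)]
    · rw [totι_π_of_ne _ _ _ (fun h => h₂ (by
          simp only [Prod.ext_iff] at h ⊢
          exact ⟨by linarith [h.1], h.2⟩)), totι_π_of_ne _ _ _ (fun h => h₁ (by
          simp only [Prod.ext_iff] at h ⊢
          exact ⟨h.1, by linarith [h.2]⟩)), ← Category.assoc, totι_π_of_ne _ _ _ h₁,
          ← Category.assoc, totι_π_of_ne _ _ _ h₂]
      simp

/-- The quotient map by the sum of the images of all summands vanishes on each summand, hence is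
zero. -/
lemma tot_induction {n : ℤ} {motive : X.totObj.X n → Prop}
    (ι : ∀ i hi (x : X.X i), motive (X.totι i n hi x))
    (add : ∀ a b, motive a → motive b → motive (a + b)) (a : X.totObj.X n) : motive a := by
  let S : Submodule k (X.totObj.X n) :=
    ⨆ i : { i : ℤ × ℤ // i.1 + i.2 = n }, LinearMap.range (X.totι i.1 n i.2).hom
  have hS : ModuleCat.ofHom S.mkQ = 0 := X.tot_hom_ext fun i hi => by
    ext x
    rw [comp_zero]
    exact (Submodule.Quotient.mk_eq_zero _).2
      (Submodule.mem_iSup_of_mem (⟨i, hi⟩ : { i : ℤ × ℤ // i.1 + i.2 = n })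
        (LinearMap.mem_range_self _ x))
  have ha : a ∈ S := (Submodule.Quotient.mk_eq_zero _).1 (ConcreteCategory.congr_hom hS a)
  have h0 : motive 0 := by
    have := ι (0, n) (zero_add n) 0
    rwa [map_zero] at this
  refine Submodule.iSup_induction _ (motive := motive) ha ?_ h0 add
  rintro ⟨i, hi⟩ _ ⟨x, rfl⟩
  exact ι i hi x

/-- Elements of a direct sum have finite support; this starts the inductions on columns below. -/
lemma exists_totπ_eq_zero {n : ℤ} (a : X.totObj.X n) :
    ∃ N : ℕ, ∀ i : ℤ × ℤ, (N : ℤ) ≤ i.1 → X.totπ n i a = 0 := by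
  induction a using tot_induction with
  | ι i hi x =>
    refine ⟨(i.1 + 1).toNat, fun j hj => totπ_totι_of_ne_apply _ _ _ (fun h => ?_) _⟩
    rw [h] at hj
    have := Int.self_le_toNat (j.1 + 1)
    omega
  | add a b ha hb =>
    obtain ⟨N, hN⟩ := ha
    obtain ⟨M, hM⟩ := hb
    exact ⟨N + M, fun i hi => by rw [map_add, hN _ (by omega), hM _ (by omega), add_zero]⟩

lemma eq_zero_of_totπ {n : ℤ} (a : X.totObj.X n) (ha : ∀ i : ℤ × ℤ, X.totπ n i a = 0) :
    a = 0 := by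
  have : ∃ s : Finset (ℤ × ℤ), a = ∑ i ∈ s, if hi : i.1 + i.2 = n then
      X.totι i n hi (X.totπ n i a) else 0 := by
    -- Allowing every larger finite set lets two summands be expanded over a common set in the
    -- additive step.
    suffices ∃ s : Finset (ℤ × ℤ), ∀ t : Finset (ℤ × ℤ), s ⊆ t →
      a = ∑ i ∈ t, if hi : i.1 + i.2 = n then X.totι i n hi (X.totπ n i a) else 0 from
      let ⟨s, hs⟩ := this
      ⟨s, hs s subset_rfl⟩
    clear ha
    induction a using tot_induction with
    | ι i hi x =>
      refine ⟨{i}, fun t ht => ?_⟩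
      rw [Finset.sum_eq_single_of_mem i (by simpa using ht) (fun j _ hj => ?_), dif_pos hi,
        totπ_totι_self_apply]
      rw [totπ_totι_of_ne_apply _ _ _ hj.symm]
      simp
    | add a b ha hb =>
      obtain ⟨s, hs⟩ := ha
      obtain ⟨s', hs'⟩ := hb
      refine ⟨s ∪ s', fun t ht => ?_⟩
      conv_lhs => rw [hs t (Finset.union_subset_left ht), hs' t (Finset.union_subset_right ht)]
      rw [← Finset.sum_add_distrib]
      refine Finset.sum_congr rfl fun i _ => ?_
      split_ifs
      · rw [map_add, map_add]
      · rw [add_zero]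
  obtain ⟨s, hs⟩ := this
  rw [hs]
  refine Finset.sum_eq_zero fun i _ => ?_
  rw [ha]
  simp

variable {X}

/-- In the top column of `a` the horizontal contribution would come from the next column, where `a`
vanishes. -/
lemma totπ_d_apply {n m : ℤ} (h : m + 1 = n) (i : ℤ × ℤ) (hi : i.1 + i.2 = n) (a : X.totObj.X n)
    (ha : ∀ j : ℤ × ℤ, i.1 < j.1 → X.totπ n j a = 0) :
    X.totπ m (i.1, i.2 - 1) (X.totObj.d n m a) = X.dv i (X.totπ n i a) := by
  obtain ⟨c, hc⟩ := X.tot_d_π n m h i hi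
  refine (ConcreteCategory.congr_hom hc a).trans ?_
  refine (congr_arg (X.dv i (X.totπ n i a) + c ·) (ha (i.1 + 1, i.2 - 1) (by simp))).trans ?_
  rw [map_zero, add_zero]

/-- Removing the top column by a boundary. -/
lemma totπ_sub_d_apply {n m : ℤ} (h : m + 1 = n) (i : ℤ × ℤ) (hi : i.1 + i.2 = n) (z : X.X i)
    (b : X.totObj.X m) (hb : ∀ j : ℤ × ℤ, i.1 < j.1 → X.totπ m j b = 0)
    (hz : X.dv i z = X.totπ m (i.1, i.2 - 1) b) (j : ℤ × ℤ) (hj : i.1 ≤ j.1) :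
    X.totπ m j (b - X.totObj.d n m (X.totι i n hi z)) = 0 := by
  rw [d_totι_apply _ _ _ _ _ h, map_sub, map_add,
    totπ_totι_of_ne_apply (a := (i.1 - 1, i.2)) _ _ _ (by rintro rfl; dsimp at hj; omega), zero_add]
  by_cases h₁ : (i.1, i.2 - 1) = j
  · subst h₁
    rw [totπ_totι_self_apply, hz, sub_self]
  · rw [totπ_totι_of_ne_apply _ _ _ h₁, sub_zero]
    obtain hj | hj := hj.lt_or_eq
    · exact hb j hj
    · exact totπ_apply_of_ne _ _ _ (fun h₂ => h₁ (Prod.ext hj (by dsimp; omega))) _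

end

variable {X Y : Bicomplex k} (f : X ⟶ Y)

lemma tot_surjective (hf : ∀ i, Function.Surjective (f.f i)) (n : ℤ) :
    Function.Surjective ((totHom f).f n) := by
  intro y
  induction y using tot_induction with
  | ι i hi y =>
    obtain ⟨x, rfl⟩ := hf i y
    exact ⟨X.totι i n hi x, map_totι_apply _ _ _ _ _⟩
  | add a b ha hb =>
    obtain ⟨a, rfl⟩ := ha
    obtain ⟨b, rfl⟩ := hb
    exact ⟨a + b, map_add _ _ _⟩

/-- Induction on the number of columns supporting the data. In the top column the equations are
purely vertical and `LiftsAt` solves them; subtracting the solution and its total boundary lowers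
the top column. Nothing is left once column zero has been removed. -/
lemma sphereLift_tot (hf : ∀ i, LiftsAt f i) :
    ChainComplexElements.SphereLift (totHom f) := by
  intro n m l hnm hml
  have key (N : ℕ) : ∀ (y : Y.totObj.X n) (x : X.totObj.X m),
      (∀ j : ℤ × ℤ, (N : ℤ) ≤ j.1 → Y.totπ n j y = 0) →
      (∀ j : ℤ × ℤ, (N : ℤ) ≤ j.1 → X.totπ m j x = 0) →
      X.totObj.d m l x = 0 → (totHom f).f m x = Y.totObj.d n m y →
      ∃ x', (totHom f).f n x' = y ∧ X.totObj.d n m x' = x := by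
    induction N with
    | zero =>
      intro y x hy hx _ _
      have hy' : y = 0 := Y.eq_zero_of_totπ y fun i => by
        by_cases hi : 0 ≤ i.1
        · exact hy i hi
        · exact Y.eq_zero_of_neg _ _ (by omega)
      have hx' : x = 0 := X.eq_zero_of_totπ x fun i => by
        by_cases hi : 0 ≤ i.1
        · exact hx i hi
        · exact X.eq_zero_of_neg _ _ (by omega)
      exact ⟨0, by rw [map_zero, hy'], by rw [map_zero, hx']⟩
    | succ N ih =>
      intro y x hy hx hdx hxy
      -- The bidegree of total degree `n` in the top column.
      let i : ℤ × ℤ := ((N : ℤ), n - N)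
      have hi : i.1 + i.2 = n := by simp [i]
      have hi' : (i.1, i.2 - 1).1 + (i.1, i.2 - 1).2 = m := by simp [i]; omega
      obtain ⟨z, hz, hz'⟩ := hf i (Y.totπ n i y) (X.totπ m (i.1, i.2 - 1) x) (by
          rw [← totπ_d_apply hml (i.1, i.2 - 1) hi' x (fun j hj => hx j (by
            simp only [i] at hj; push_cast; omega)), hdx, map_zero]) (by
          rw [← totπ_map_apply, hxy]
          exact totπ_d_apply hnm i hi y (fun j hj => hy j (by
            simp only [i] at hj; push_cast; omega)))
      obtain ⟨w, hw, hw'⟩ := ih (y - Y.totι i n hi (f.f i z)) (x - X.totObj.d n m (X.totι i n hi z))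
        (fun j hj => by
          rw [map_sub, hz]
          by_cases hij : i = j
          · subst hij
            rw [totπ_totι_self_apply, sub_self]
          · rw [totπ_totι_of_ne_apply _ _ _ hij, sub_zero]
            by_cases hj' : (N : ℤ) = j.1
            · exact totπ_apply_of_ne _ _ _ (fun h => hij (Prod.ext hj' (by
                simp only [i]; omega))) _
            · exact hy j (by push_cast; omega))
        (fun j hj => totπ_sub_d_apply hnm i hi z x (fun j hj => hx j (by
            simp only [i] at hj; push_cast; omega)) hz' j hj)
        (by rw [map_sub, hdx, ChainComplexElements.d_d_apply, sub_zero])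
        (by rw [map_sub, map_sub, hxy, ← map_totι_apply]
            congr 1
            exact (ChainComplexElements.comm_apply (totHom f) n m _).symm)
      refine ⟨w + X.totι i n hi z, ?_, ?_⟩
      · rw [map_add, hw, map_totι_apply, sub_add_cancel]
      · rw [map_add, hw', sub_add_cancel]
  intro y x hx hxy
  obtain ⟨N, hN⟩ := Y.exists_totπ_eq_zero y
  obtain ⟨M, hM⟩ := X.exists_totπ_eq_zero x
  exact key (N + M) y x (fun j hj => hN j (by push_cast at hj; omega))
    (fun j hj => hM j (by push_cast at hj; omega)) hx hxy

/-- A problem in column zero is also a problem in the total complexes, where a surjective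
quasi-isomorphism provides a solution `a`. Its components in positive columns can be removed from
the top down by boundaries killed by `f`, changing neither the image nor the boundary of `a`; what
remains lies in column zero. -/
lemma liftsAt_zero_column (hf : surjLifts k (fun p => 0 < p) f) (h : QuasiIso (totHom f))
    (q : ℤ) : LiftsAt f (0, q) := by
  intro y x hx hxy
  have hq : (0, q).1 + (0, q).2 = q := zero_add q
  have hq' : (0, q - 1).1 + (0, q - 1).2 = q - 1 := zero_add (q - 1)
  have key (N : ℕ) : ∀ a : X.totObj.X q, (∀ j : ℤ × ℤ, (N : ℤ) < j.1 → X.totπ q j a = 0) →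
      (totHom f).f q a = Y.totι (0, q) q hq y →
      X.totObj.d q (q - 1) a = X.totι (0, q - 1) (q - 1) hq' x →
      ∃ x' : X.X (0, q), f.f _ x' = y ∧ X.dv _ x' = x := by
    induction N with
    | zero =>
      intro a ha hfa hda
      refine ⟨X.totπ q (0, q) a, ?_, ?_⟩
      · rw [← totπ_map_apply, hfa, totπ_totι_self_apply]
      · rw [← totπ_d_apply (m := q - 1) (by omega) _ hq a ha, hda]
        exact totπ_totι_self_apply _ _ _ _ _
    | succ N ih =>
      intro a ha hfa hda
      let i : ℤ × ℤ := ((N : ℤ) + 1, q + 1 - (N + 1))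
      have hi : i.1 + i.2 = q + 1 := by simp only [i]; ring
      have hi' : (i.1, i.2 - 1).1 + (i.1, i.2 - 1).2 = q := by simp only [i]; ring
      have ha' : ∀ j : ℤ × ℤ, i.1 < j.1 → X.totπ q j a = 0 := fun j hj => ha j (by
        push_cast; exact hj)
      -- The top component of `a` is a vertical cycle killed by `f`, since the image and boundary of
      -- `a` live in column zero. Lifting over `0` in this positive column makes it a vertical
      -- boundary of an element killed by `f`.
      obtain ⟨z, hz, hz'⟩ := hf.2 i (by simp only [i]; omega) 0 (X.totπ q (i.1, i.2 - 1) a) (by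
          rw [← totπ_d_apply (m := q - 1) (by omega) (i.1, i.2 - 1) hi' a ha', hda]
          exact totπ_totι_of_ne_apply _ _ _ (fun h => by
            have := congr_arg Prod.fst h; simp only [i] at this; omega) _) (by
          rw [← totπ_map_apply, hfa, map_zero]
          exact totπ_totι_of_ne_apply _ _ _ (fun h => by
            have := congr_arg Prod.fst h; simp only [i] at this; omega) _)
      refine ih (a - X.totObj.d (q + 1) q (X.totι i (q + 1) hi z)) (fun j hj =>
        totπ_sub_d_apply rfl i hi z a ha' hz' j (by simp only [i]; omega)) ?_ ?_
      · rw [map_sub, hfa]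
        refine Eq.trans (congr_arg _ ?_) (sub_zero _)
        refine (ChainComplexElements.comm_apply (totHom f) (q + 1) q _).symm.trans ?_
        refine (congr_arg _ (map_totι_apply f i _ hi z)).trans ?_
        rw [hz, map_zero, map_zero]
      · rw [map_sub, hda, ChainComplexElements.d_d_apply, sub_zero]
  obtain ⟨a, ha, ha'⟩ := (ChainComplexElements.sphereLift_iff _).2 ⟨tot_surjective f hf.1, h⟩
    (i := q) (j := q - 1) (l := q - 1 - 1) (by omega) (by omega)
    (Y.totι (0, q) q hq y) (X.totι (0, q - 1) (q - 1) hq' x) (by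
      refine (d_totι_apply X (0, q - 1) _ _ hq' (by omega) x).trans ?_
      dsimp only at hx ⊢
      rw [hx, X.eq_zero_of_neg _ (X.dh (0, q - 1) x) (by simp), map_zero, map_zero, add_zero]) (by
      refine (map_totι_apply f (0, q - 1) _ hq' x).trans ?_
      refine Eq.trans ?_ (d_totι_apply Y (0, q) _ _ hq (by omega) y).symm
      rw [Y.eq_zero_of_neg _ (Y.dh (0, q) y) (by simp), map_zero, zero_add]
      exact congr_arg _ hxy)
  obtain ⟨N, hN⟩ := X.exists_totπ_eq_zero a
  exact key N a (fun j hj => hN j hj.le) ha ha'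

/-- Identifies the fibrations that are weak equivalences. Positive columns are part of being a
fibration, negative columns are zero, and only column zero uses the quasi-isomorphism on totals. -/
lemma surjLifts_top_iff : surjLifts k (fun _ => True) f ↔
    surjLifts k (fun p => 0 < p) f ∧ QuasiIso (totHom f) := by
  constructor
  · intro h
    exact ⟨⟨h.1, fun i _ => h.2 i trivial⟩, ((ChainComplexElements.sphereLift_iff _).1
      (sphereLift_tot f fun i => h.2 i trivial)).2⟩
  · rintro ⟨h, h'⟩
    refine ⟨h.1, fun ⟨p, q⟩ _ => ?_⟩
    obtain hp | rfl | hp := lt_trichotomy p 0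
    · intro y x _ _
      exact ⟨0, (Y.eq_zero_of_neg (p, q) _ hp).trans (Y.eq_zero_of_neg (p, q) _ hp).symm,
        (X.eq_zero_of_neg (p, q - 1) _ hp).trans (X.eq_zero_of_neg (p, q - 1) _ hp).symm⟩
    · exact liftsAt_zero_column f h h' q
    · exact h.2 (p, q) hp

end Bicomplex

/-! ### Lifting against degreewise split inclusions via twisted fibre products. -/

namespace Bicomplex

variable {k : Type u} [CommRing k]

/-- A short exact sequence of bicomplexes with a degreewise splitting. -/
structure SplitExact {A B C : Bicomplex k} (f : A ⟶ B) (g : B ⟶ C) where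
  /-- The degreewise retraction. -/
  r : ∀ i, B.X i ⟶ A.X i
  /-- The degreewise section. -/
  s : ∀ i, C.X i ⟶ B.X i
  f_r : ∀ i, f.f i ≫ r i = 𝟙 _
  s_g : ∀ i, s i ≫ g.f i = 𝟙 _
  total : ∀ i, r i ≫ f.f i + g.f i ≫ s i = 𝟙 _

namespace SplitExact

variable {A B C : Bicomplex k} {f : A ⟶ B} {g : B ⟶ C} (S : SplitExact f g)

include S in
lemma f_g (i : ℤ × ℤ) : f.f i ≫ g.f i = 0 := by
  have h := f.f i ≫= S.total i =≫ g.f i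
  simp only [Preadditive.comp_add, Preadditive.add_comp, Category.assoc, S.s_g, Category.comp_id,
    reassoc_of% S.f_r i] at h
  simpa using h

lemma f_r_apply (i : ℤ × ℤ) (a : A.X i) : S.r i (f.f i a) = a :=
  ConcreteCategory.congr_hom (S.f_r i) a

lemma s_g_apply (i : ℤ × ℤ) (c : C.X i) : g.f i (S.s i c) = c :=
  ConcreteCategory.congr_hom (S.s_g i) c

include S in
lemma f_g_apply (i : ℤ × ℤ) (a : A.X i) : g.f i (f.f i a) = 0 :=
  ConcreteCategory.congr_hom (S.f_g i) a

lemma total_apply (i : ℤ × ℤ) (b : B.X i) : f.f i (S.r i b) + S.s i (g.f i b) = b :=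
  ConcreteCategory.congr_hom (S.total i) b

include S in
lemma injective (i : ℤ × ℤ) : Function.Injective (f.f i) :=
  Function.LeftInverse.injective (S.f_r_apply i)

lemma f_r_apply' (i : ℤ × ℤ) (b : B.X i) : f.f i (S.r i b) = b - S.s i (g.f i b) :=
  eq_sub_of_add_eq (S.total_apply i b)

/-- The horizontal connecting map of the splitting. -/
def connH (i : ℤ × ℤ) (c : C.X i) : A.X (i.1 - 1, i.2) := S.r _ (B.dh i (S.s i c))

/-- The vertical connecting map of the splitting. -/
def connV (i : ℤ × ℤ) (c : C.X i) : A.X (i.1, i.2 - 1) := S.r _ (B.dv i (S.s i c))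

/-- Seen in `B`, the connecting map measures the failure of the section to commute with the
differential. With the injectivity of `f`, this turns the bicomplex identities of `B` and `C` into
the cocycle identities that follow. -/
lemma f_connH (i : ℤ × ℤ) (c : C.X i) :
    f.f _ (S.connH i c) = B.dh i (S.s i c) - S.s _ (C.dh i c) := by
  rw [connH, f_r_apply', comm_h_apply, s_g_apply]

lemma f_connV (i : ℤ × ℤ) (c : C.X i) :
    f.f _ (S.connV i c) = B.dv i (S.s i c) - S.s _ (C.dv i c) := by
  rw [connV, f_r_apply', comm_v_apply, s_g_apply]

lemma dh_connH (i : ℤ × ℤ) (c : C.X i) : A.dh _ (S.connH i c) + S.connH _ (C.dh i c) = 0 := by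
  apply S.injective
  rw [map_add, map_zero, comm_h_apply, f_connH, f_connH, map_sub, dh_dh_apply, dh_dh_apply,
    map_zero]
  abel

lemma dv_connV (i : ℤ × ℤ) (c : C.X i) : A.dv _ (S.connV i c) + S.connV _ (C.dv i c) = 0 := by
  apply S.injective
  rw [map_add, map_zero, comm_v_apply, f_connV, f_connV, map_sub, dv_dv_apply, dv_dv_apply,
    map_zero]
  abel

lemma dh_connV (i : ℤ × ℤ) (c : C.X i) : A.dv _ (S.connH i c) + S.connV _ (C.dh i c) +
    (A.dh _ (S.connV i c) + S.connH _ (C.dv i c)) = 0 := by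
  apply S.injective
  have h₁ := comm_v_apply (i.1 - 1, i.2) (S.connH i c) f
  have h₂ := S.f_connV (i.1 - 1, i.2) (C.dh i c)
  have h₃ := comm_h_apply (i.1, i.2 - 1) (S.connV i c) f
  have h₄ := S.f_connH (i.1, i.2 - 1) (C.dv i c)
  have h₅ := dv_dh_apply B i (S.s i c)
  have h₆ := dv_dh_apply C i c
  rw [f_connH, map_sub] at h₁
  rw [f_connV, map_sub] at h₃
  dsimp only at h₁ h₂ h₃ h₄ h₅ h₆ ⊢
  rw [map_add, map_add, map_add, h₁, h₂, h₃, h₄, h₅, h₆, map_neg, map_zero]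
  abel

section

variable {X Y : Bicomplex k} (p : X ⟶ Y) (v : B ⟶ Y)

/-- The modules of the twisted fibre product governing a lifting problem. -/
def twist (i : ℤ × ℤ) : Submodule k (C.X i × X.X i) :=
  LinearMap.ker ((p.f i).hom ∘ₗ LinearMap.snd k _ _ -
    (v.f i).hom ∘ₗ (S.s i).hom ∘ₗ LinearMap.fst k _ _)

lemma mem_twist_iff {i : ℤ × ℤ} (x : C.X i × X.X i) :
    x ∈ S.twist p v i ↔ p.f i x.2 = v.f i (S.s i x.1) :=
  LinearMap.mem_ker.trans sub_eq_zero

variable (u : A ⟶ X) (w : f ≫ v = u ≫ p)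

lemma square_apply {u : A ⟶ X} (w : f ≫ v = u ≫ p) (i : ℤ × ℤ) (a : A.X i) :
    p.f i (u.f i a) = v.f i (f.f i a) :=
  (congr_arg (fun g => Hom.f g i a) w).symm

/-- Without the correction by `u`, the fibre product would not be stable under the differential, as
`S.s` does not commute with it; the connecting map compensates exactly this defect. -/
lemma twist_dh_mem {u : A ⟶ X} (w : f ≫ v = u ≫ p) {i : ℤ × ℤ} (x : C.X i × X.X i)
    (hx : x ∈ S.twist p v i) :
    (C.dh i x.1, X.dh i x.2 - u.f _ (S.connH i x.1)) ∈ S.twist p v (i.1 - 1, i.2) := by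
  rw [mem_twist_iff] at hx ⊢
  dsimp only
  rw [map_sub, comm_h_apply, hx, square_apply p v w, f_connH, map_sub, comm_h_apply,
    sub_sub_cancel]

lemma twist_dv_mem {u : A ⟶ X} (w : f ≫ v = u ≫ p) {i : ℤ × ℤ} (x : C.X i × X.X i)
    (hx : x ∈ S.twist p v i) :
    (C.dv i x.1, X.dv i x.2 - u.f _ (S.connV i x.1)) ∈ S.twist p v (i.1, i.2 - 1) := by
  rw [mem_twist_iff] at hx ⊢
  dsimp only
  rw [map_sub, comm_v_apply, hx, square_apply p v w, f_connV, map_sub, comm_v_apply,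
    sub_sub_cancel]

/-- The horizontal differential of the twisted fibre product. -/
def twistDh {u : A ⟶ X} (w : f ≫ v = u ≫ p) (i : ℤ × ℤ) :
    S.twist p v i →ₗ[k] S.twist p v (i.1 - 1, i.2) where
  toFun x := ⟨(C.dh i x.1.1, X.dh i x.1.2 - u.f _ (S.connH i x.1.1)), S.twist_dh_mem p v w x.1 x.2⟩
  map_add' x y := Subtype.ext (Prod.ext (map_add _ _ _) (by simp [connH]; abel))
  map_smul' c x := Subtype.ext (Prod.ext (map_smul _ _ _) (by simp [connH, smul_sub]))

/-- The vertical differential of the twisted fibre product. -/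
def twistDv {u : A ⟶ X} (w : f ≫ v = u ≫ p) (i : ℤ × ℤ) :
    S.twist p v i →ₗ[k] S.twist p v (i.1, i.2 - 1) where
  toFun x := ⟨(C.dv i x.1.1, X.dv i x.1.2 - u.f _ (S.connV i x.1.1)), S.twist_dv_mem p v w x.1 x.2⟩
  map_add' x y := Subtype.ext (Prod.ext (map_add _ _ _) (by simp [connV]; abel))
  map_smul' c x := Subtype.ext (Prod.ext (map_smul _ _ _) (by simp [connV, smul_sub]))

/-- The twisted fibre product. -/
def twistObj {u : A ⟶ X} (w : f ≫ v = u ≫ p) : Bicomplex k where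
  X i := ModuleCat.of k (S.twist p v i)
  isZero_of_neg i hi := by
    have := ModuleCat.subsingleton_of_isZero (C.isZero_of_neg i hi)
    have := ModuleCat.subsingleton_of_isZero (X.isZero_of_neg i hi)
    exact ModuleCat.isZero_of_subsingleton _
  dh i := ModuleCat.ofHom (S.twistDh p v w i)
  dv i := ModuleCat.ofHom (S.twistDv p v w i)
  dh_dh i := ModuleCat.hom_ext (LinearMap.ext fun x => by
    refine Subtype.ext (Prod.ext (dh_dh_apply C i x.1.1) ?_)
    refine (congr_arg (· - _) (map_sub (X.dh _).hom _ _)).trans ?_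
    refine (congr_arg₂ (fun a b => a - b - _) (dh_dh_apply X i _)
      (comm_h_apply _ (S.connH i x.1.1) u).symm).trans ?_
    refine Eq.trans ?_ (neg_eq_zero.2 ((congr_arg (u.f _) (S.dh_connH i x.1.1)).trans
      (map_zero (u.f _).hom)))
    refine Eq.trans ?_ (congr_arg Neg.neg (map_add (u.f _).hom _ _)).symm
    exact (congr_arg (· - _) (zero_sub _)).trans (neg_add' _ _).symm)
  dv_dv i := ModuleCat.hom_ext (LinearMap.ext fun x => by
    refine Subtype.ext (Prod.ext (dv_dv_apply C i x.1.1) ?_)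
    refine (congr_arg (· - _) (map_sub (X.dv _).hom _ _)).trans ?_
    refine (congr_arg₂ (fun a b => a - b - _) (dv_dv_apply X i _)
      (comm_v_apply _ (S.connV i x.1.1) u).symm).trans ?_
    refine Eq.trans ?_ (neg_eq_zero.2 ((congr_arg (u.f _) (S.dv_connV i x.1.1)).trans
      (map_zero (u.f _).hom)))
    refine Eq.trans ?_ (congr_arg Neg.neg (map_add (u.f _).hom _ _)).symm
    exact (congr_arg (· - _) (zero_sub _)).trans (neg_add' _ _).symm)
  dv_dh i := ModuleCat.hom_ext (LinearMap.ext fun x => by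
    refine Subtype.ext (Prod.ext (ConcreteCategory.congr_hom (C.dv_dh i) x.1.1) ?_)
    have h := (congr_arg (u.f _) (S.dh_connV i x.1.1)).trans (map_zero (u.f _).hom)
    have h₁ := dv_dh_apply X i x.1.2
    have h₂ := comm_v_apply _ (S.connH i x.1.1) u
    have h₃ := comm_h_apply _ (S.connV i x.1.1) u
    refine (congr_arg₂ (fun a b => a - _ + (b - _)) (map_sub (X.dv _).hom _ _)
      (map_sub (X.dh _).hom _ _)).trans ?_
    have e (a b c d e f : X.X (i.1 - 1, i.2 - 1)) (h : a = -b) (h' : c + d + (e + f) = 0) :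
        a - c - d + (b - e - f) = 0 := by
      rw [h, ← neg_eq_zero, ← h']
      abel
    refine e _ _ _ _ _ _ h₁ ?_
    rw [← h, map_add, map_add, map_add]
    exact congr_arg₂ (fun a b => a + _ + (b + _)) h₂.symm h₃.symm)

/-- The projection of the twisted fibre product. -/
def twistFst {u : A ⟶ X} (w : f ≫ v = u ≫ p) : S.twistObj p v w ⟶ C where
  f i := ModuleCat.ofHom (LinearMap.fst k _ _ ∘ₗ (S.twist p v i).subtype)
  comm_h _ := rfl
  comm_v _ := rfl

/-- The fibre of the projection is a fibre of `p`, and the twist merely translates the prescribed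
boundary by `u` of the connecting map. The translated element is a vertical cycle by `dv_connV`. -/
lemma surjLifts_twistFst {u : A ⟶ X} (w : f ≫ v = u ≫ p) {P : ℤ → Prop}
    (hp : surjLifts k P p) : surjLifts k P (S.twistFst p v w) := by
  constructor
  · intro i c
    obtain ⟨x, hx⟩ := hp.1 i (v.f i (S.s i c))
    exact ⟨(⟨(c, x), (S.mem_twist_iff p v _).2 hx⟩ : S.twist p v i), rfl⟩
  · intro i hi c x hx hcx
    obtain ⟨⟨c₀, x₀⟩, h⟩ : S.twist p v (i.1, i.2 - 1) := x
    obtain rfl : c₀ = C.dv i c := hcx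
    have h' := (S.mem_twist_iff p v _).1 h
    have hx' : X.dv _ x₀ - u.f _ (S.connV _ (C.dv i c)) = 0 :=
      congr_arg (fun y : S.twist p v _ => y.1.2) hx
    obtain ⟨x', hx₁, hx₂⟩ := hp.2 i hi (v.f i (S.s i c)) (x₀ + u.f _ (S.connV i c)) (by
        rw [map_add, sub_eq_zero.1 hx', ← comm_v_apply, ← map_add, add_comm, dv_connV, map_zero])
      (by
        rw [map_add, square_apply p v w, f_connV, h', map_sub, comm_v_apply]
        exact add_sub_cancel _ _)
    exact ⟨(⟨(c, x'), (S.mem_twist_iff p v _).2 hx₁⟩ : S.twist p v i), rfl,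
      Subtype.ext (Prod.ext rfl (sub_eq_of_eq_add hx₂))⟩

/-- The lift determined by a section of the twisted fibre product. -/
def lift {u : A ⟶ X} (w : f ≫ v = u ≫ p) (t : C ⟶ S.twistObj p v w)
    (ht : t ≫ S.twistFst p v w = 𝟙 C) : B ⟶ X :=
  -- The second component of the section commutes with the differentials up to `u` of the connecting
  -- map. The retraction `S.r` has the opposite defect, so the two cancel in the sum.
  let τ (i) : C.X i ⟶ X.X i := t.f i ≫
    ModuleCat.ofHom (LinearMap.snd k _ _ ∘ₗ (S.twist p v i).subtype)
  have h₁ (i : ℤ × ℤ) (c : C.X i) : (show S.twist p v i from t.f i c).1.1 = c :=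
    congr_arg (fun g => Hom.f g i c) ht
  { f i := S.r i ≫ u.f i + g.f i ≫ τ i
    comm_h i := by
      ext b
      have h₂ (c : C.X i) : τ _ (C.dh i c) = X.dh i (τ i c) - u.f _ (S.connH i c) := by
        refine (congr_arg (fun y : S.twist p v _ => y.1.2) (comm_h_apply i c t)).trans ?_
        exact congr_arg (fun y => _ - u.f _ (S.connH i y)) (h₁ i c)
      change u.f _ (S.r _ (B.dh i b)) + τ _ (g.f _ (B.dh i b)) =
        X.dh i (u.f i (S.r i b) + τ i (g.f i b))
      have h₃ : S.r _ (B.dh i b) = A.dh i (S.r i b) + S.connH i (g.f i b) := by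
        apply S.injective
        rw [map_add, f_connH, comm_h_apply, f_r_apply', f_r_apply', map_sub, comm_h_apply]
        abel
      rw [h₃, comm_h_apply, h₂, map_add, map_add, comm_h_apply]
      abel
    comm_v i := by
      ext b
      have h₂ (c : C.X i) : τ _ (C.dv i c) = X.dv i (τ i c) - u.f _ (S.connV i c) := by
        refine (congr_arg (fun y : S.twist p v _ => y.1.2) (comm_v_apply i c t)).trans ?_
        exact congr_arg (fun y => _ - u.f _ (S.connV i y)) (h₁ i c)
      change u.f _ (S.r _ (B.dv i b)) + τ _ (g.f _ (B.dv i b)) =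
        X.dv i (u.f i (S.r i b) + τ i (g.f i b))
      have h₃ : S.r _ (B.dv i b) = A.dv i (S.r i b) + S.connV i (g.f i b) := by
        apply S.injective
        rw [map_add, f_connV, comm_v_apply, f_r_apply', f_r_apply', map_sub, comm_v_apply]
        abel
      rw [h₃, comm_v_apply, h₂, map_add, map_add, comm_v_apply]
      abel }

end

include S in
/-- A split inclusion lifts against the maps that have sections after pullback to the cokernel. -/
lemma hasLiftingProperty {P : ℤ → Prop}
    (hC : ∀ {E : Bicomplex k} (q : E ⟶ C), surjLifts k P q → ∃ t : C ⟶ E, t ≫ q = 𝟙 C) :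
    surjLifts k P ≤ fun _ _ p => HasLiftingProperty f p := by
  intro X Y p hp
  refine ⟨fun {u v} sq => ?_⟩
  -- Since `B` is degreewise `A ⊕ C` and the lift is prescribed on `A`, only its values on `C` have
  -- to be found, and these form a section of the twisted fibre product.
  obtain ⟨t, ht⟩ := hC _ (S.surjLifts_twistFst p v sq.w.symm hp)
  refine ⟨⟨⟨S.lift p v sq.w.symm t ht, ?_, ?_⟩⟩⟩
  · ext i a
    change u.f i (S.r i (f.f i a)) + (show S.twist p v i from t.f i (g.f i (f.f i a))).1.2 = u.f i a
    rw [f_r_apply, S.f_g_apply, map_zero]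
    exact add_zero _
  · ext i b
    have h₁ (c : C.X i) : (show S.twist p v i from t.f i c).1.1 = c :=
      congr_arg (fun g => Hom.f g i c) ht
    have h₂ := (S.mem_twist_iff p v _).1 (show S.twist p v i from t.f i (g.f i b)).2
    rw [h₁] at h₂
    change p.f i (u.f i (S.r i b) + (show S.twist p v i from t.f i (g.f i b)).1.2) = v.f i b
    rw [map_add, square_apply p v sq.w.symm, h₂, ← map_add, total_apply]

end SplitExact

end Bicomplex

/-! ### Contractions of one differential and their tensor products. -/

namespace BigradedTensor

variable {k : Type u} [CommRing k]

open MonoidalCategory hiding tensorObj tensorHom tensorUnit associator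
  leftUnitor rightUnitor whiskerLeft whiskerRight
open scoped MonoidalCategory
open GradedObject.Monoidal hiding tensorHom_def tensorHom_comp_tensorHom
  tensorHom_comp_tensorHom_assoc leftUnitor_naturality rightUnitor_naturality associator_naturality id_tensorHom_id

/-- A contraction of a differential `d` which anticommutes with another differential `e`. -/
structure Contraction (σ τ : ℤ × ℤ → ℤ × ℤ) {X : GradedObject (ℤ × ℤ) (ModuleCat.{u} k)}
    (d : ∀ i, X i ⟶ X (σ i)) (e : ∀ i, X i ⟶ X (τ i)) where
  /-- The contracting homotopy. -/
  s : ∀ a b, σ b = a → (X a ⟶ X b)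
  contr : ∀ b, s (σ b) b rfl ≫ d b + d (σ b) ≫ s (σ (σ b)) (σ b) rfl = 𝟙 _
  -- With this sign, `s` contracts not only `d` but also `d + e` on the total complex, and averaging
  -- over `s` preserves compatibility with `e`.
  anticomm : ∀ a b (h : σ b = a) (h' : σ (τ b) = τ a),
    s a b h ≫ e b = -e a ≫ s (τ a) (τ b) h'

namespace Contraction

variable {σ τ : ℤ × ℤ → ℤ × ℤ} {X Y : GradedObject (ℤ × ℤ) (ModuleCat.{u} k)}
  {d : ∀ i, X i ⟶ X (σ i)} {e : ∀ i, X i ⟶ X (τ i)}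
  {d' : ∀ i, Y i ⟶ Y (σ i)} {e' : ∀ i, Y i ⟶ Y (τ i)}

/-- Transport of a contraction along an isomorphism. -/
def ofIso (S : Contraction σ τ d e) (f : X ≅ Y) (hd : ∀ i, d i ≫ f.hom (σ i) = f.hom i ≫ d' i)
    (he : ∀ i, e i ≫ f.hom (τ i) = f.hom i ≫ e' i) : Contraction σ τ d' e' :=
  have h₁ (i) : f.hom i ≫ f.inv i = 𝟙 _ := congr_fun f.hom_inv_id i
  have h₂ (i) : f.inv i ≫ f.hom i = 𝟙 _ := congr_fun f.inv_hom_id i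
  have hd' (i) : d' i = f.inv i ≫ d i ≫ f.hom _ := by rw [hd, reassoc_of% h₂ i]
  have he' (i) : e' i = f.inv i ≫ e i ≫ f.hom _ := by rw [he, reassoc_of% h₂ i]
  { s a b h := f.inv a ≫ S.s a b h ≫ f.hom b
    contr b := by
      have := f.inv _ ≫= S.contr b =≫ f.hom _
      rw [hd', hd']
      simp only [Category.assoc, reassoc_of% h₁, Preadditive.add_comp, Preadditive.comp_add,
        Category.id_comp, h₂] at this ⊢
      exact this
    anticomm a b h h' := by
      have := f.inv _ ≫= S.anticomm a b h h' =≫ f.hom _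
      rw [he', he']
      simp only [Category.assoc, reassoc_of% h₁, Preadditive.neg_comp, Preadditive.comp_neg] at this ⊢
      exact this }

section

variable (hσ : IsShift σ) (hb : Function.Bijective σ)

include hσ in
lemma add_eq_of_shift (hb : Function.Bijective σ) {a a' b i j : ℤ × ℤ} (h : σ a' = a) (h' : σ j = i) (hab : a + b = i) :
    a' + b = j := by
  apply hb.1
  rw [← hσ.left, h, hab, h']

/-- The homotopy `s ⊗ 1`. -/
def tensorHomotopy (s : ∀ a b, σ b = a → (X a ⟶ X b)) (Y : GradedObject (ℤ × ℤ) (ModuleCat.{u} k))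
    (i j : ℤ × ℤ) (h : σ j = i) : tensorObj X Y i ⟶ tensorObj X Y j :=
  tensorObjDesc fun a b hab =>
    (s a _ (Function.surjInv_eq hb.2 a) ▷ Y b) ≫
      ιTensorObj X Y _ b j (add_eq_of_shift hσ hb (Function.surjInv_eq hb.2 a) h hab)

lemma ι_tensorHomotopy (s : ∀ a b, σ b = a → (X a ⟶ X b))
    (Y : GradedObject (ℤ × ℤ) (ModuleCat.{u} k)) (i j : ℤ × ℤ) (h : σ j = i) (a a' b : ℤ × ℤ)
    (ha : σ a' = a) (hab : a + b = i) :
    ιTensorObj X Y a b i hab ≫ tensorHomotopy hσ hb s Y i j h =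
      (s a a' ha ▷ Y b) ≫ ιTensorObj X Y a' b j (add_eq_of_shift hσ hb ha h hab) := by
  obtain rfl : a' = Function.surjInv hb.2 a := hb.1 (ha.trans (Function.surjInv_eq hb.2 a).symm)
  exact ι_tensorObjDesc _ _ _ _

variable (dY : ∀ i, Y i ⟶ Y (σ i)) (eY : ∀ i, Y i ⟶ Y (τ i)) (hτ : IsShift τ)

/-- The contraction `s ⊗ 1` of a tensor product. -/
def tensor (S : Contraction σ τ d e) :
    Contraction σ τ (tensorD hσ d dY) (tensorD hτ e eY) where
  s := tensorHomotopy hσ hb S.s Y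
  -- The cross terms `s ⊗ d` occur twice with opposite signs, because `s` changes the parity of the
  -- total degree; what remains is the contraction identity of the first factor.
  contr j := by
    apply tensorObj_ext
    intro a b hab
    obtain ⟨a', rfl⟩ := hb.2 a
    have h₁ := S.contr a'
    rw [Category.comp_id, Preadditive.comp_add, ← Category.assoc,
      ι_tensorHomotopy hσ hb S.s Y _ _ rfl (σ a') a' b rfl hab, Category.assoc, ι_tensorD,
      ι_tensorD_assoc, Preadditive.add_comp, Category.assoc, Linear.units_smul_comp, Category.assoc,
      ι_tensorHomotopy hσ hb S.s Y _ _ rfl (σ (σ a')) (σ a') b rfl,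
      ι_tensorHomotopy hσ hb S.s Y _ _ rfl (σ a') a' (σ b) rfl,
      Preadditive.comp_add, Linear.comp_units_smul, hσ.sgn, ← whisker_exchange_assoc]
    have h₂ := congr_arg (fun f => f ▷ Y b ≫ ιTensorObj X Y (σ a') b (σ j) hab) h₁
    simp only [MonoidalPreadditive.add_whiskerRight, comp_whiskerRight, Preadditive.add_comp,
      Category.assoc, id_whiskerRight, Category.id_comp] at h₂
    refine Eq.trans ?_ h₂
    rw [Units.neg_smul]
    abel
  anticomm i j h h' := by
    apply tensorObj_ext
    intro a b hab
    obtain ⟨a', rfl⟩ := hb.2 a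
    -- Both shifts are translations, hence commute.
    have h₀ : σ (τ a') = τ (σ a') := by
      have h₁ (x) : σ x = σ 0 + x := by rw [hσ.left, zero_add]
      have h₂ (x) : τ x = τ 0 + x := by rw [hτ.left, zero_add]
      rw [h₁, h₂, h₂ (σ a'), h₁ a']
      abel
    have h₁ := S.anticomm (σ a') a' rfl h₀
    have hs : sgn (σ a') = - sgn a' := hσ.sgn _
    rw [← Category.assoc, ι_tensorHomotopy hσ hb S.s Y _ _ h (σ a') a' b rfl hab, Category.assoc,
      ι_tensorD, Preadditive.comp_neg, ι_tensorD_assoc, Preadditive.add_comp, Category.assoc, Linear.units_smul_comp,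
      Category.assoc,
      ι_tensorHomotopy hσ hb S.s Y _ _ h' (τ (σ a')) (τ a') b h₀,
      ι_tensorHomotopy hσ hb S.s Y _ _ h' (σ a') a' (τ b) rfl,
      Preadditive.comp_add, Linear.comp_units_smul, hs, ← whisker_exchange_assoc,
      ← comp_whiskerRight_assoc, h₁, Units.neg_smul,
      ← comp_whiskerRight_assoc]
    have h₂ : (-(e (σ a') ≫ S.s _ _ h₀)) ▷ Y b = -((e (σ a') ≫ S.s _ _ h₀) ▷ Y b) :=
      (tensorRight (Y b)).map_neg (f := _)
    rw [h₂, Preadditive.neg_comp]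
    abel

end

end Contraction

end BigradedTensor

/-! ### Averaging over contractions and sections over projective bicomplexes. -/

lemma exists_pi_of_bijective {ι : Type*} {T : ι → Type*} {σ : ι → ι} (hσ : Function.Bijective σ)
    (F : ∀ b, T (σ b)) : ∃ ψ : ∀ i, T i, ∀ b, ψ (σ b) = F b :=
  ⟨(Equiv.ofBijective σ hσ).piCongrLeft T F, fun b =>
    Equiv.piCongrLeft_apply_apply T (Equiv.ofBijective σ hσ) F b⟩

namespace Bicomplex

open BigradedTensor

variable {k : Type u} [CommRing k]

/-- Averaging a degreewise map over a contraction of the source makes it commute with the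
differentials. -/
lemma exists_average {σ : ℤ × ℤ → ℤ × ℤ} (hσ : Function.Bijective σ)
    {C E : GradedObject (ℤ × ℤ) (ModuleCat.{u} k)}
    {d : ∀ i, C i ⟶ C (σ i)} {d' : ∀ i, E i ⟶ E (σ i)} (hd : ∀ i, d i ≫ d (σ i) = 0)
    (hd' : ∀ i, d' i ≫ d' (σ i) = 0) (s : ∀ a b, σ b = a → (C a ⟶ C b)) (ψ₀ : ∀ i, C i ⟶ E i) :
    ∃ ψ : ∀ i, C i ⟶ E i,
      (∀ b, ψ (σ b) = s (σ b) b rfl ≫ ψ₀ b ≫ d' b + d (σ b) ≫ s _ (σ b) rfl ≫ ψ₀ (σ b)) ∧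
        ∀ i, d i ≫ ψ (σ i) = ψ i ≫ d' i := by
  -- The averaged map is naturally given at the bidegrees `σ b`; bijectivity of `σ` turns this into
  -- a family over all bidegrees. If `ψ₀` is a section of a map commuting with the differentials,
  -- the contraction identity makes the average a section as well.
  obtain ⟨ψ, hψ⟩ := exists_pi_of_bijective hσ (T := fun i => C i ⟶ E i)
    (fun b => s (σ b) b rfl ≫ ψ₀ b ≫ d' b + d (σ b) ≫ s _ (σ b) rfl ≫ ψ₀ (σ b))
  refine ⟨ψ, hψ, fun i => ?_⟩
  obtain ⟨b, rfl⟩ := hσ.2 i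
  -- Both sides reduce to `d ≫ s ≫ ψ₀ ≫ d'`, the other terms containing a square of a differential.
  rw [hψ, hψ, Preadditive.comp_add, reassoc_of% hd (σ b), zero_comp, add_zero,
    Preadditive.add_comp, Category.assoc, Category.assoc, hd', comp_zero, comp_zero, zero_add,
    Category.assoc, Category.assoc]

lemma bijective_h : Function.Bijective (fun i : ℤ × ℤ => (i.1 - 1, i.2)) :=
  ⟨fun a b h => by simpa [Prod.ext_iff] using h, fun a => ⟨(a.1 + 1, a.2), by simp⟩⟩

lemma bijective_v : Function.Bijective (fun i : ℤ × ℤ => (i.1, i.2 - 1)) :=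
  ⟨fun a b h => by simpa [Prod.ext_iff] using h, fun a => ⟨(a.1, a.2 + 1), by simp⟩⟩

/-- A horizontal contraction anticommuting with the vertical differential. -/
abbrev HContraction (C : Bicomplex k) :=
  Contraction (fun i => (i.1 - 1, i.2)) (fun i => (i.1, i.2 - 1)) C.dh C.dv

/-- A vertical contraction anticommuting with the horizontal differential. -/
abbrev VContraction (C : Bicomplex k) :=
  Contraction (fun i => (i.1, i.2 - 1)) (fun i => (i.1 - 1, i.2)) C.dv C.dh

section

variable {C E : Bicomplex k} (q : E ⟶ C)

/-- Vertical cycles can be lifted linearly. -/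
lemma exists_cycle_section [∀ i, Projective (C.X i)] (hC : ∀ i, C.dv i = 0) {P : ℤ → Prop}
    (hq : surjLifts k P q) : ∃ ψ : ∀ i, C.X i ⟶ E.X i,
      (∀ i : ℤ × ℤ, P i.1 → ψ i ≫ q.f i = 𝟙 _ ∧ ψ i ≫ E.dv i = 0) ∧
      ∀ i : ℤ × ℤ, ¬ P i.1 → ψ i = 0 := by
  classical
  have (i : ℤ × ℤ) (hi : P i.1) : ∃ ψ : C.X i ⟶ E.X i, ψ ≫ q.f i = 𝟙 _ ∧ ψ ≫ E.dv i = 0 := by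
    -- The restriction of `q` to vertical cycles is surjective, by `LiftsAt` with prescribed
    -- boundary zero; projectivity of `C.X i` then splits it.
    let π : ModuleCat.of k (LinearMap.ker (E.dv i).hom) ⟶ C.X i :=
      ModuleCat.ofHom ((q.f i).hom ∘ₗ (LinearMap.ker (E.dv i).hom).subtype)
    have : Epi π := (ModuleCat.epi_iff_surjective _).2 fun c => by
      obtain ⟨x, hx, hx'⟩ := hq.2 i hi c 0 (map_zero _) (by rw [hC, map_zero]; rfl)
      exact ⟨⟨x, hx'⟩, hx⟩
    refine ⟨Projective.factorThru (𝟙 _) π ≫ ModuleCat.ofHom (LinearMap.ker (E.dv i).hom).subtype,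
      ?_, ?_⟩
    · exact Projective.factorThru_comp (𝟙 _) π
    · ext x
      exact (show LinearMap.ker (E.dv i).hom from Projective.factorThru (𝟙 _) π x).2
  choose ψ hψ using this
  exact ⟨fun i => if hi : P i.1 then ψ i hi else 0, fun i hi => by
    dsimp only
    rw [dif_pos hi]
    exact hψ i hi,
    fun i hi => dif_neg hi⟩

/-- Projective objects with vanishing vertical differential and a horizontal contraction lift
against the maps with the vertical lifting property in positive columns. -/
lemma exists_section_of_hContraction [∀ i, Projective (C.X i)] (hC : ∀ i, C.dv i = 0)
    (S : HContraction C) (hq : surjLifts k (fun p => 0 < p) q) : ∃ t : C ⟶ E, t ≫ q = 𝟙 C := by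
  obtain ⟨ψ₀, h₁, h₂⟩ := exists_cycle_section q hC hq
  obtain ⟨ψ, hψ, h₃⟩ := exists_average bijective_h C.dh_dh E.dh_dh S.s ψ₀
  dsimp only at hψ h₃
  -- Vertical cycles can be lifted only from positive columns. This suffices: the average uses `ψ₀`
  -- in column zero only after `C.dh` out of that column, which is zero, or after a homotopy out of
  -- column `-1`, which is zero as well.
  have key (b : ℤ × ℤ) : C.dh (b.1 - 1, b.2) = 0 ∨ 0 < b.1 - 1 := by
    by_cases hb : 0 < b.1 - 1
    · exact Or.inr hb
    · exact Or.inl ((C.isZero_of_neg _ (by dsimp; omega)).eq_of_tgt _ _)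
  have key' (b : ℤ × ℤ) : (∀ f : C.X (b.1 - 1, b.2) ⟶ C.X b, f = 0) ∨ 0 < b.1 := by
    by_cases hb : 0 < b.1
    · exact Or.inr hb
    · exact Or.inl fun f => (C.isZero_of_neg _ (by dsimp; omega)).eq_of_src _ _
  refine ⟨{ f := ψ, comm_h := h₃, comm_v := fun i => ?_ }, ?_⟩
  · obtain ⟨b, rfl⟩ := bijective_h.2 i
    dsimp only
    rw [hC, zero_comp, hψ, Preadditive.add_comp, Category.assoc, Category.assoc, Category.assoc,
      Category.assoc]
    have e₁ : S.s (b.1 - 1, b.2) b rfl ≫ ψ₀ b ≫ E.dh b ≫ E.dv (b.1 - 1, b.2) = 0 := by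
      obtain h | h := key' b
      · rw [h (S.s _ _ _), zero_comp]
      · rw [eq_neg_of_add_eq_zero_left (E.dv_dh b), Preadditive.comp_neg,
          reassoc_of% (h₁ b h).2, zero_comp, neg_zero, comp_zero]
    rw [e₁, zero_add]
    obtain h | h := key b
    · rw [h, zero_comp]
    · rw [(h₁ (b.1 - 1, b.2) h).2, comp_zero, comp_zero]
  · ext i : 1
    obtain ⟨b, rfl⟩ := bijective_h.2 i
    dsimp only
    have e₁ : S.s (b.1 - 1, b.2) b rfl ≫ ψ₀ b ≫ q.f b = S.s (b.1 - 1, b.2) b rfl := by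
      obtain h | h := key' b
      · rw [h (S.s _ _ _), zero_comp]
      · rw [(h₁ b h).1, Category.comp_id]
    have e₂ : C.dh (b.1 - 1, b.2) ≫ S.s _ (b.1 - 1, b.2) rfl ≫ ψ₀ (b.1 - 1, b.2) ≫
        q.f (b.1 - 1, b.2) = C.dh (b.1 - 1, b.2) ≫ S.s _ (b.1 - 1, b.2) rfl := by
      obtain h | h := key b
      · rw [h, zero_comp, zero_comp]
      · rw [(h₁ (b.1 - 1, b.2) h).1, Category.comp_id]
    change ψ (b.1 - 1, b.2) ≫ q.f (b.1 - 1, b.2) = 𝟙 (C.X (b.1 - 1, b.2))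
    rw [hψ, Preadditive.add_comp, Category.assoc, Category.assoc, Category.assoc, Category.assoc,
      q.comm_h, reassoc_of% e₁, e₂]
    exact S.contr b

/-- Projective objects with vanishing vertical differential in column zero lift against the maps
with the vertical lifting property. -/
lemma exists_section_of_column_zero [∀ i, Projective (C.X i)] (hC : ∀ i, C.dv i = 0)
    (hC₀ : ∀ i : ℤ × ℤ, i.1 ≠ 0 → IsZero (C.X i)) (hq : surjLifts k (fun _ => True) q) :
    ∃ t : C ⟶ E, t ≫ q = 𝟙 C := by
  obtain ⟨ψ, h₁, -⟩ := exists_cycle_section q hC hq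
  refine ⟨{ f := ψ, comm_h := fun i => ?_, comm_v := fun i => ?_ }, ?_⟩
  · by_cases hi : i.1 = 0
    · exact (E.isZero_of_neg _ (by dsimp; omega)).eq_of_tgt _ _
    · exact (hC₀ i hi).eq_of_src _ _
  · rw [hC, zero_comp, (h₁ i trivial).2]
  · ext i : 1
    exact (h₁ i trivial).1

/-- Projective objects with a vertical contraction, which are in column zero or have a
horizontal contraction, lift against surjections. -/
lemma exists_section_of_vContraction [∀ i, Projective (C.X i)] (T : VContraction C)
    (hC : Nonempty (HContraction C) ∨ ∀ i : ℤ × ℤ, i.1 ≠ 0 → IsZero (C.X i))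
    (hq : ∀ i, Function.Surjective (q.f i)) : ∃ t : C ⟶ E, t ≫ q = 𝟙 C := by
  have (i : ℤ × ℤ) : Epi (q.f i) := (ModuleCat.epi_iff_surjective _).2 (hq i)
  have hψ₀ : ∃ ψ₀ : ∀ i, C.X i ⟶ E.X i, ∀ i, ψ₀ i ≫ q.f i = 𝟙 _ :=
    ⟨fun i => Projective.factorThru (𝟙 _) (q.f i), fun i => Projective.factorThru_comp _ _⟩
  -- First make the section horizontal, by averaging, or for free when `C` is in column zero since
  -- `E` vanishes in column `-1`.
  have hψ₁ : ∃ ψ : ∀ i, C.X i ⟶ E.X i, (∀ i, ψ i ≫ q.f i = 𝟙 _) ∧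
      ∀ i, C.dh i ≫ ψ _ = ψ i ≫ E.dh i := by
    obtain ⟨ψ₀, h₀⟩ := hψ₀
    obtain ⟨⟨S⟩⟩ | hC := hC
    · obtain ⟨ψ, hψ, h⟩ := exists_average bijective_h C.dh_dh E.dh_dh S.s ψ₀
      dsimp only at hψ
      refine ⟨ψ, fun i => ?_, h⟩
      obtain ⟨b, rfl⟩ := bijective_h.2 i
      dsimp only
      rw [hψ, Preadditive.add_comp, Category.assoc, Category.assoc, Category.assoc, Category.assoc,
        q.comm_h, reassoc_of% h₀ b, h₀, Category.comp_id]
      exact S.contr b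
    · refine ⟨ψ₀, h₀, fun i => ?_⟩
      by_cases hi : i.1 = 0
      · exact (E.isZero_of_neg _ (by dsimp; omega)).eq_of_tgt _ _
      · exact (hC i hi).eq_of_src _ _
  obtain ⟨ψ₁, h₁, h₁'⟩ := hψ₁
  -- Vertical averaging keeps horizontal compatibility: moving `dh` past the homotopy and past a
  -- vertical differential costs two signs, which cancel.
  obtain ⟨ψ, hψ, h⟩ := exists_average bijective_v C.dv_dv E.dv_dv T.s ψ₁
  dsimp only at hψ
  refine ⟨{ f := ψ, comm_h := fun i => ?_, comm_v := h }, ?_⟩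
  · obtain ⟨b, rfl⟩ := bijective_v.2 i
    have ha := T.anticomm (b.1, b.2 - 1) b rfl rfl
    have hb := T.anticomm (b.1, b.2 - 1 - 1) (b.1, b.2 - 1) rfl rfl
    have hψ' := hψ (b.1 - 1, b.2)
    have hc := eq_neg_of_add_eq_zero_left (C.dv_dh (b.1, b.2 - 1))
    have he := eq_neg_of_add_eq_zero_right (E.dv_dh b)
    dsimp only at ha hb hψ' hc he ⊢
    rw [hψ', hψ, Preadditive.comp_add, Preadditive.add_comp, Category.assoc, Category.assoc,
      Category.assoc, Category.assoc, ← h₁', reassoc_of% hb, reassoc_of% hc, he,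
      Preadditive.comp_neg, Preadditive.comp_neg, ← reassoc_of% h₁' b, reassoc_of% ha]
    simp
  · ext i : 1
    obtain ⟨b, rfl⟩ := bijective_v.2 i
    change ψ (b.1, b.2 - 1) ≫ q.f (b.1, b.2 - 1) = 𝟙 (C.X (b.1, b.2 - 1))
    rw [hψ, Preadditive.add_comp, Category.assoc, Category.assoc, Category.assoc, Category.assoc,
      q.comm_v, reassoc_of% h₁ b, h₁, Category.comp_id]
    exact T.contr b

end

end Bicomplex

/-! ### Tensor products of degreewise split sequences. -/

namespace Bicomplex

open BigradedTensor

variable {k : Type u} [CommRing k]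

section

variable {X Y Z X' Y' Z' : Bicomplex k}

/-- The tensor product of degreewise maps. -/
def tensorMap (u : ∀ i, X.X i ⟶ X'.X i) (v : ∀ i, Y.X i ⟶ Y'.X i) (i : ℤ × ℤ) :
    (tensorObj X Y).X i ⟶ (tensorObj X' Y').X i :=
  GradedObject.Monoidal.tensorHom u v i

/-- The inclusion of a summand of the tensor product. -/
def tensorι (X Y : Bicomplex k) (a b i : ℤ × ℤ) (h : a + b = i) :
    MonoidalCategory.tensorObj (X.X a) (Y.X b) ⟶ (tensorObj X Y).X i :=
  GradedObject.Monoidal.ιTensorObj X.X Y.X a b i h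

lemma tensorHom_f_apply (f : X ⟶ X') (g : Y ⟶ Y') (i : ℤ × ℤ) :
    (tensorHom f g).f i = tensorMap f.f g.f i := rfl

lemma tensorHom_id_f (f : X ⟶ X') (i : ℤ × ℤ) :
    (tensorHom f (𝟙 Y)).f i = tensorMap f.f (fun i => 𝟙 (Y.X i)) i := rfl

lemma tensor_hom_ext {i : ℤ × ℤ} {A : ModuleCat.{u} k} {f g : (tensorObj X Y).X i ⟶ A}
    (h : ∀ a b hab, tensorι X Y a b i hab ≫ f = tensorι X Y a b i hab ≫ g) : f = g :=
  GradedObject.Monoidal.tensorObj_ext _ _ h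

/-- The map out of a tensor product given by its restrictions to the summands. -/
def tensorDesc {i : ℤ × ℤ} {A : ModuleCat.{u} k}
    (φ : ∀ a b, a + b = i → (MonoidalCategory.tensorObj (X.X a) (Y.X b) ⟶ A)) :
    (tensorObj X Y).X i ⟶ A :=
  GradedObject.Monoidal.tensorObjDesc φ

lemma tensorι_desc {i : ℤ × ℤ} {A : ModuleCat.{u} k}
    (φ : ∀ a b, a + b = i → (MonoidalCategory.tensorObj (X.X a) (Y.X b) ⟶ A)) (a b : ℤ × ℤ)
    (hab : a + b = i) : tensorι X Y a b i hab ≫ tensorDesc φ = φ a b hab :=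
  GradedObject.Monoidal.ι_tensorObjDesc _ _ _ _

lemma tensorι_map (u : ∀ i, X.X i ⟶ X'.X i) (v : ∀ i, Y.X i ⟶ Y'.X i) (a b i : ℤ × ℤ)
    (h : a + b = i) : tensorι X Y a b i h ≫ tensorMap u v i =
      MonoidalCategory.tensorHom (u a) (v b) ≫ tensorι X' Y' a b i h :=
  GradedObject.Monoidal.ι_tensorHom _ _ _ _ _ _

lemma tensorMap_comp (u : ∀ i, X.X i ⟶ Y.X i) (u' : ∀ i, Y.X i ⟶ Z.X i)
    (v : ∀ i, X'.X i ⟶ Y'.X i) (v' : ∀ i, Y'.X i ⟶ Z'.X i) (i : ℤ × ℤ) :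
    tensorMap u v i ≫ tensorMap u' v' i =
      tensorMap (fun i => u i ≫ u' i) (fun i => v i ≫ v' i) i :=
  tensor_hom_ext fun a b hab => by
    rw [reassoc_of% tensorι_map u v a b i hab, tensorι_map, tensorι_map,
      MonoidalCategory.tensorHom_comp_tensorHom_assoc]

lemma tensorMap_id (i : ℤ × ℤ) :
    tensorMap (fun i => 𝟙 (X.X i)) (fun i => 𝟙 (Y.X i)) i = 𝟙 _ :=
  tensor_hom_ext fun a b hab => by
    rw [tensorι_map, MonoidalCategory.id_tensorHom_id, Category.id_comp, Category.comp_id]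

lemma tensorMap_add_left (u u' : ∀ i, X.X i ⟶ X'.X i) (v : ∀ i, Y.X i ⟶ Y'.X i) (i : ℤ × ℤ) :
    tensorMap (fun i => u i + u' i) v i = tensorMap u v i + tensorMap u' v i :=
  tensor_hom_ext fun a b hab => by
    rw [Preadditive.comp_add, tensorι_map, tensorι_map, tensorι_map,
      MonoidalPreadditive.add_tensor, Preadditive.add_comp]

lemma tensorMap_add_right (u : ∀ i, X.X i ⟶ X'.X i) (v v' : ∀ i, Y.X i ⟶ Y'.X i) (i : ℤ × ℤ) :
    tensorMap u (fun i => v i + v' i) i = tensorMap u v i + tensorMap u v' i :=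
  tensor_hom_ext fun a b hab => by
    rw [Preadditive.comp_add, tensorι_map, tensorι_map, tensorι_map,
      MonoidalPreadditive.tensor_add, Preadditive.add_comp]

lemma tensorMap_zero_right (u : ∀ i, X.X i ⟶ X'.X i) (i : ℤ × ℤ) :
    tensorMap u (fun i => (0 : Y.X i ⟶ Y'.X i)) i = 0 :=
  tensor_hom_ext fun a b hab => by
    rw [tensorι_map, MonoidalPreadditive.tensor_zero, zero_comp, comp_zero]

end

namespace SplitExact

open scoped MonoidalCategory

/-- The tensor product of a split exact sequence with a bicomplex. -/
def whiskerRight {A B C : Bicomplex k} {f : A ⟶ B} {g : B ⟶ C} (S : SplitExact f g)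
    (Z : Bicomplex k) : SplitExact (tensorHom f (𝟙 Z)) (tensorHom g (𝟙 Z)) where
  r i := tensorMap S.r (fun i => 𝟙 (Z.X i)) i
  s i := tensorMap S.s (fun i => 𝟙 (Z.X i)) i
  f_r i := by
    rw [tensorHom_id_f, tensorMap_comp, funext S.f_r, ← tensorMap_id]
    simp
  s_g i := by
    rw [tensorHom_id_f, tensorMap_comp, funext S.s_g, ← tensorMap_id]
    simp
  total i := by
    rw [tensorHom_id_f, tensorHom_id_f, tensorMap_comp, tensorMap_comp, ← tensorMap_add_left,
      funext S.total, ← tensorMap_id]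
    simp

section

variable {A B C A' B' C' : Bicomplex k} {f : A ⟶ B} {g : B ⟶ C} {f' : A' ⟶ B'} {g' : B' ⟶ C'}
  (S : SplitExact f g) (S' : SplitExact f' g') {P : Bicomplex k}
  {inl : tensorObj B A' ⟶ P} {inr : tensorObj A B' ⟶ P} {ι : P ⟶ tensorObj B B'}

/-- The pushout product of split exact sequences. -/
def pushoutProduct (sq : IsPushout (tensorHom f (𝟙 A')) (tensorHom (𝟙 A) f') inl inr)
    (hl : inl ≫ ι = tensorHom (𝟙 B) f') (hr : inr ≫ ι = tensorHom f (𝟙 B')) :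
    SplitExact ι (tensorHom g g') where
  -- Degreewise `B ⊗ B'` is the sum of `B ⊗ A'`, `A ⊗ C'` and `C ⊗ C'`. The first two make up the
  -- pushout and the last is the cokernel; the retraction treats the first two separately.
  r i := tensorMap (fun i => 𝟙 (B.X i)) S'.r i ≫ inl.f i +
    tensorMap S.r (fun i => g'.f i ≫ S'.s i) i ≫ inr.f i
  s i := tensorMap S.s S'.s i
  f_r i := by
    have sq' := sq.map (ev k i)
    have hl' : inl.f i ≫ ι.f i = tensorMap (fun i => 𝟙 (B.X i)) f'.f i :=
      congr_arg (fun f => Hom.f f i) hl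
    have hr' : inr.f i ≫ ι.f i = tensorMap f.f (fun i => 𝟙 (B'.X i)) i :=
      congr_arg (fun f => Hom.f f i) hr
    have w : tensorMap f.f (fun i => 𝟙 (A'.X i)) i ≫ inl.f i =
      tensorMap (fun i => 𝟙 (A.X i)) f'.f i ≫ inr.f i := sq'.w
    have e₁ (i) : f'.f i ≫ g'.f i ≫ S'.s i = 0 := by
      rw [← Category.assoc, S'.f_g, zero_comp]
    apply sq'.hom_ext
    · change inl.f i ≫ ι.f i ≫ _ = inl.f i ≫ 𝟙 _
      rw [reassoc_of% hl', Preadditive.comp_add, ← Category.assoc, ← Category.assoc,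
        tensorMap_comp, tensorMap_comp, funext e₁, tensorMap_zero_right, zero_comp, add_zero,
        funext S'.f_r, Category.comp_id]
      simp only [Category.comp_id, tensorMap_id, Category.id_comp]
    · change inr.f i ≫ ι.f i ≫ _ = inr.f i ≫ 𝟙 _
      rw [reassoc_of% hr', Preadditive.comp_add, ← Category.assoc, ← Category.assoc,
        tensorMap_comp, tensorMap_comp, funext S.f_r]
      have e₂ : tensorMap (fun i => f.f i ≫ 𝟙 (B.X i)) (fun i => 𝟙 (B'.X i) ≫ S'.r i) i =
          tensorMap (fun i => 𝟙 (A.X i)) S'.r i ≫ tensorMap f.f (fun i => 𝟙 (A'.X i)) i := by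
        rw [tensorMap_comp]
        simp only [Category.id_comp, Category.comp_id]
      -- The pushout relation moves the first term to the `inr` side, where the two terms add up to
      -- the splitting of `B'`.
      rw [e₂, Category.assoc, w, ← Category.assoc, tensorMap_comp, ← Preadditive.add_comp]
      simp only [Category.id_comp, Category.comp_id]
      rw [← tensorMap_add_right, funext S'.total, tensorMap_id, Category.id_comp]
  s_g i := by
    rw [tensorHom_f_apply, tensorMap_comp, funext S.s_g, funext S'.s_g, tensorMap_id]
  total i := by
    have hl' : inl.f i ≫ ι.f i = tensorMap (fun i => 𝟙 (B.X i)) f'.f i :=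
      congr_arg (fun f => Hom.f f i) hl
    have hr' : inr.f i ≫ ι.f i = tensorMap f.f (fun i => 𝟙 (B'.X i)) i :=
      congr_arg (fun f => Hom.f f i) hr
    rw [Preadditive.add_comp, Category.assoc, Category.assoc, hl', hr', tensorMap_comp,
      tensorMap_comp, tensorHom_f_apply, tensorMap_comp]
    simp only [Category.comp_id]
    rw [add_assoc, ← tensorMap_add_left, funext S.total, ← tensorMap_add_right, funext S'.total,
      tensorMap_id]

end

end SplitExact

/-! ### The tensor products of the generators -/

/-- The split exact sequence of a disc. -/
def discSplitExact (k : Type u) [CommRing k] (i : ℤ × ℤ) :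
    SplitExact (discInl k i) (discSnd k i) where
  r := discFst i
  s := discInr i
  f_r _ := rfl
  s_g _ := rfl
  total := disc_total i

/-- The split exact sequence of a bicomplex with zero subobject. -/
def zeroSplitExact (X : Bicomplex k) : SplitExact (fromZero X) (𝟙 X) where
  r _ := 0
  s _ := 𝟙 _
  f_r _ := (ModuleCat.isZero_of_subsingleton (ModuleCat.of k PUnit)).eq_of_src _ _
  s_g _ := Category.comp_id _
  total _ := by
    rw [zero_comp, zero_add]
    exact Category.comp_id _

/-- The horizontal contraction of a row. -/
def rowHContraction (i : ℤ × ℤ) (hi : i.1 ≠ 0) : HContraction (rowObj k i) where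
  s a b h := ModuleCat.ofHom
    { toFun x := (⟨(x.1.2, 0), fun h' => x.2.2 (by
        rintro ⟨rfl, h₁⟩
        simp only [Prod.mk.injEq] at h
        exact h' ⟨Prod.ext (by omega) h.2, by dsimp at h₁; omega⟩), fun _ => rfl⟩ : freeRow k i b)
      map_add' x y := Subtype.ext (Prod.ext rfl (add_zero 0).symm)
      map_smul' c x := Subtype.ext (Prod.ext rfl (smul_zero c).symm) }
  contr b := by
    refine ModuleCat.hom_ext (LinearMap.ext fun x => Subtype.ext (Prod.ext ?_ ?_))
    · change 0 + (if 0 ≤ b.1 - 1 - 1 then (show freeRow k i (b.1 - 1, b.2) from x).1.1 else 0) =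
        (show freeRow k i (b.1 - 1, b.2) from x).1.1
      split_ifs with h
      · exact zero_add _
      · rw [zero_add]
        refine ((show freeRow k i (b.1 - 1, b.2) from x).2.1 ?_).symm
        -- The contraction can fail only at a generator in column zero, which has no horizontal
        -- boundary to be recovered from; `hi` excludes this.
        rintro ⟨rfl, h'⟩
        dsimp at hi h'
        omega
    · change (if 0 ≤ b.1 - 1 then (show freeRow k i (b.1 - 1, b.2) from x).1.2 else 0) + 0 =
        (show freeRow k i (b.1 - 1, b.2) from x).1.2
      split_ifs with h
      · exact add_zero _
      · rw [add_zero]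
        exact ((show freeRow k i (b.1 - 1, b.2) from x).2.2 (fun h' => h h'.2)).symm
  anticomm a b h h' := by
    exact comp_zero.trans (neg_eq_zero.2 zero_comp).symm

/-- The comparison of consecutive rows in a disc, in the other direction. -/
def rowUnshift (i a b : ℤ × ℤ) (h : (b.1, b.2 - 1) = a) :
    freeRow k (i.1, i.2 - 1) a →ₗ[k] freeRow k i b where
  toFun x := ⟨(x.1.1, -x.1.2), fun h' => x.2.1 (by
      rintro ⟨rfl, h₁⟩
      simp only [Prod.mk.injEq] at h
      exact h' ⟨Prod.ext h.1 (by omega), by dsimp at h₁; omega⟩), fun h' => by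
      refine neg_eq_zero.2 (x.2.2 ?_)
      rintro ⟨rfl, h₁⟩
      simp only [Prod.mk.injEq] at h
      exact h' ⟨Prod.ext h.1 (by dsimp; omega), by dsimp at h₁; omega⟩⟩
  map_add' x y := Subtype.ext (Prod.ext rfl (neg_add _ _))
  map_smul' c x := Subtype.ext (Prod.ext rfl (smul_neg _ _).symm)

/-- The vertical contraction of a disc. -/
def discVContraction (k : Type u) [CommRing k] (i : ℤ × ℤ) : VContraction (discObj k i) where
  s a b h := ModuleCat.ofHom (LinearMap.inr k _ _ ∘ₗ rowUnshift i a b h ∘ₗ LinearMap.fst k _ _)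
  contr b := by
    refine ModuleCat.hom_ext (LinearMap.ext fun x => Prod.ext ?_ ?_)
    · refine (add_zero _).trans (Subtype.ext (Prod.ext rfl (neg_neg _)))
    · refine (zero_add _).trans (Subtype.ext (Prod.ext rfl (neg_neg _)))
  anticomm a b h h' := by
    subst h
    refine ModuleCat.hom_ext (LinearMap.ext fun x => Prod.ext ?_ ?_)
    · exact (map_zero (freeRowDh _ b)).trans neg_zero.symm
    · refine Subtype.ext (Prod.ext neg_zero.symm ?_)
      change (if 0 ≤ b.1 - 1 then _ else 0) = - -(if 0 ≤ b.1 - 1 then _ else 0)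
      rw [neg_neg]
      rfl

/-- A row generated in column zero has lost the horizontal differential of its generator to
truncation, and rows generated further left are zero. -/
lemma isZero_rowObj {i a : ℤ × ℤ} (hi : i.1 ≤ 0) (ha : a.1 ≠ 0) : IsZero ((rowObj k i).X a) := by
  have : Subsingleton (freeRow k i a) := ⟨fun x y => by
    have (z : freeRow k i a) : z.1 = 0 :=
      Prod.ext (z.2.1 (fun h => by have := congr_arg Prod.fst h.1; omega))
        (z.2.2 (fun h => by rw [h.1] at h; dsimp at h; omega))
    exact Subtype.ext ((this x).trans (this y).symm)⟩
  exact ModuleCat.isZero_of_subsingleton (ModuleCat.of k (freeRow k i a))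

lemma isZero_discObj {i a : ℤ × ℤ} (hi : i.1 ≤ 0) (ha : a.1 ≠ 0) : IsZero ((discObj k i).X a) := by
  have h (j : ℤ × ℤ) (hj : j.1 ≤ 0) : Subsingleton (freeRow k j a) :=
    ModuleCat.subsingleton_of_isZero (isZero_rowObj hj ha)
  have := h i hi
  have := h (i.1, i.2 - 1) hi
  exact ModuleCat.isZero_of_subsingleton
    (ModuleCat.of k (freeRow k (i.1, i.2 - 1) a × freeRow k i a))

section

variable (X Y : Bicomplex k)

open GradedObject.Monoidal

lemma isZero_tensorObj (hX : ∀ i : ℤ × ℤ, i.1 ≠ 0 → IsZero (X.X i))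
    (hY : ∀ i : ℤ × ℤ, i.1 ≠ 0 → IsZero (Y.X i)) (i : ℤ × ℤ) (hi : i.1 ≠ 0) :
    IsZero ((tensorObj X Y).X i) := by
  rw [IsZero.iff_id_eq_zero]
  refine tensor_hom_ext fun a b hab => ?_
  have hz : IsZero (MonoidalCategory.tensorObj (X.X a) (Y.X b)) := by
    by_cases ha : a.1 = 0
    · refine (MonoidalCategory.tensorLeft (X.X a)).map_isZero (hY b ?_)
      have := congr_arg Prod.fst hab
      simp only [Prod.fst_add] at this
      omega
    · exact (MonoidalCategory.tensorRight (Y.X b)).map_isZero (hX a ha)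
  exact hz.eq_of_src _ _

lemma tensorObj_dv_eq_zero (hX : ∀ i, X.dv i = 0) (hY : ∀ i, Y.dv i = 0) (i : ℤ × ℤ) :
    (tensorObj X Y).dv i = 0 :=
  tensor_hom_ext fun a b hab => by
    refine (ι_tensorD isShift_v X.dv Y.dv a b i hab).trans ?_
    rw [hX, hY, MonoidalPreadditive.zero_whiskerRight, MonoidalPreadditive.whiskerLeft_zero,
      zero_comp, zero_comp, smul_zero, add_zero, comp_zero]
    rfl

instance projective_tensorObj [∀ i, Projective (X.X i)] [∀ i, Projective (Y.X i)] (i : ℤ × ℤ) :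
    Projective ((tensorObj X Y).X i) := by
  have (a b : ℤ × ℤ) : Projective (MonoidalCategory.tensorObj (X.X a) (Y.X b)) := by
    have h (M : ModuleCat.{u} k) [h : Projective M] : Module.Projective k M :=
      (IsProjective.iff_projective (R := k) M).2 h
    have := h (X.X a)
    have := h (Y.X b)
    exact (IsProjective.iff_projective _).1
      (inferInstanceAs (Module.Projective k (TensorProduct k (X.X a) (Y.X b))))
  refine ⟨fun {E Z} g e _ => ?_⟩
  refine ⟨tensorDesc fun a b hab => Projective.factorThru (tensorι X Y a b i hab ≫ g) e,
    tensor_hom_ext fun a b hab => ?_⟩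
  rw [reassoc_of% tensorι_desc, Projective.factorThru_comp]

/-- The contraction of a tensor product given by a contraction of the first factor. -/
def HContraction.tensorRight {X : Bicomplex k} (S : HContraction X) (Y : Bicomplex k) :
    HContraction (tensorObj X Y) :=
  Contraction.tensor isShift_h bijective_h Y.dh Y.dv isShift_v S

/-- The contraction of a tensor product given by a contraction of the first factor. -/
def VContraction.tensorRight {X : Bicomplex k} (S : VContraction X) (Y : Bicomplex k) :
    VContraction (tensorObj X Y) :=
  Contraction.tensor isShift_v bijective_v Y.dv Y.dh isShift_h S

/-- The contraction of a tensor product given by a contraction of the second factor. -/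
def HContraction.tensorLeft {X : Bicomplex k} (S : HContraction X) (Y : Bicomplex k) :
    HContraction (tensorObj Y X) :=
  -- Transport along the symmetry supplies the Koszul signs that a homotopy on the second factor
  -- requires.
  Contraction.ofIso (S.tensorRight Y) (koszul X.X Y.X) (tensorD_koszulHom isShift_h _ _)
    (tensorD_koszulHom isShift_v _ _)

end

end Bicomplex

namespace Bicomplex

open Opposite

variable {k : Type u} [CommRing k]

/-! ### The special adjoint functor theorem for bicomplexes -/

section

variable {X Y Z : Bicomplex k} (t : X ⟶ Y) (s : X ⟶ Z)

/-- A map factors through a surjection if its kernel is large enough. -/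
lemma exists_factor (ht : ∀ i, Function.Surjective (t.f i))
    (h : ∀ i, LinearMap.ker (t.f i).hom ≤ LinearMap.ker (s.f i).hom) : ∃ φ : Y ⟶ Z, t ≫ φ = s := by
  have key (i) : ∃ φ : Y.X i ⟶ Z.X i, t.f i ≫ φ = s.f i := by
    refine ⟨ModuleCat.ofHom ((LinearMap.ker (t.f i).hom).liftQ (s.f i).hom (h i) ∘ₗ
      ((t.f i).hom.quotKerEquivOfSurjective (ht i)).symm.toLinearMap), ?_⟩
    ext x
    change (LinearMap.ker (t.f i).hom).liftQ (s.f i).hom (h i)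
      (((t.f i).hom.quotKerEquivOfSurjective (ht i)).symm ((t.f i).hom x)) = s.f i x
    have : ((t.f i).hom.quotKerEquivOfSurjective (ht i)).symm ((t.f i).hom x) =
        (LinearMap.ker (t.f i).hom).mkQ x := by
      rw [LinearEquiv.symm_apply_eq]
      rfl
    rw [this]
    rfl
  choose φ hφ using key
  have (i : ℤ × ℤ) : Epi (t.f i) := (ModuleCat.epi_iff_surjective _).2 (ht i)
  refine ⟨{ f := φ, comm_h := fun i => ?_, comm_v := fun i => ?_ }, hom_ext hφ⟩
  · rw [← cancel_epi (t.f i), reassoc_of% hφ i, ← reassoc_of% t.comm_h i, hφ, s.comm_h]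
  · rw [← cancel_epi (t.f i), reassoc_of% hφ i, ← reassoc_of% t.comm_v i, hφ, s.comm_v]

end

instance : WellPowered.{u} (Bicomplex k)ᵒᵖ where
  subobject_small X := by
    -- A quotient is determined by its family of kernels, and such families form a small type.
    let κ (S : Subobject X) (i : ℤ × ℤ) : Submodule k (X.unop.X i) :=
      LinearMap.ker (S.arrow.unop.f i).hom
    have hκ (S T : Subobject X) (h : κ S = κ T) : S ≤ T := by
      obtain ⟨φ, hφ⟩ := exists_factor T.arrow.unop S.arrow.unop (fun i => surjective_of_epi _ i)
        (fun i => (congr_fun h i).ge)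
      exact Subobject.le_of_comm φ.op (Quiver.Hom.unop_inj hφ)
    exact small_of_injective (f := κ) fun S T h => le_antisymm (hκ S T h) (hκ T S h.symm)

/-- The discs form a small family. -/
abbrev discs (k : Type u) [CommRing k] : ObjectProperty (Bicomplex k) :=
  ObjectProperty.ofObj (fun i : ULift.{u} (ℤ × ℤ) => discObj k i.down)

/-- Maps out of discs are elements, and elements separate maps. This is the separating family for
the adjoint functor theorem. -/
lemma isSeparating_discs : (discs k).IsSeparating := by
  intro X Y f g h
  ext i x
  have := h (discObj k i) (ObjectProperty.ofObj_apply (fun i : ULift.{u} (ℤ × ℤ) => discObj k i.down) (ULift.up i)) (discDesc x)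
  have := congr_arg (fun f => Hom.f f i (discGen k i)) this
  have h' (f : X ⟶ Y) : (discDesc x ≫ f).f i (discGen k i) = f.f i x :=
    congr_arg (f.f i) (discDesc_gen x)
  dsimp only at this
  rwa [h', h'] at this

lemma isLeftAdjoint_of_preservesColimits {D : Type*} [Category.{u} D] (F : Bicomplex k ⥤ D)
    [PreservesColimits F] : F.IsLeftAdjoint :=
  isLeftAdjoint_of_preservesColimits_of_isSeparating isSeparating_discs F

section

variable {J : Type u} [SmallCategory J] {F : J ⥤ Bicomplex k}

/-- The legs of a cocone. -/
def leg (c : Cocone F) (j : J) : F.obj j ⟶ c.pt := c.ι.app j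

/-- A cocone which is a colimit in each bidegree is a colimit. -/
def isColimitOfEv (c : Cocone F) (hc : ∀ i, IsColimit ((ev k i).mapCocone c)) : IsColimit c := by
  have : IsIso ((colimit.isColimit F).desc c) := by
    apply isIso_of_bijective
    intro i
    rw [← ConcreteCategory.isIso_iff_bijective]
    let h₁ := isColimitOfPreserves (ev k i) (colimit.isColimit F)
    let e := h₁.coconePointUniqueUpToIso (hc i)
    have : (ev k i).map ((colimit.isColimit F).desc c) = e.hom :=
      h₁.hom_ext fun j => ((congr_arg (fun f => Hom.f f i) ((colimit.isColimit F).fac c j)).trans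
        (IsColimit.comp_coconePointUniqueUpToIso_hom h₁ (hc i) j).symm)
    have h₂ : IsIso ((ev k i).map ((colimit.isColimit F).desc c)) := by
      rw [this]
      infer_instance
    exact h₂
  exact IsColimit.ofPointIso (colimit.isColimit F)

section

variable {c : Cocone F} (hc : IsColimit c) (G : ModuleCat.{u} k ⥤ ModuleCat.{u} k)
  [PreservesColimitsOfShape J G] (i : ℤ × ℤ) {A : ModuleCat.{u} k}

include hc

/-- The functor `G` is a parameter in order to cover both tensoring with a module and the identity,
the two functors applied to the summands of tensor products and of total complexes. -/
lemma exists_desc_ev (τ : ∀ j, G.obj ((F.obj j).X i) ⟶ A)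
    (hτ : ∀ {j j' : J} (φ : j ⟶ j'), G.map ((F.map φ).f i) ≫ τ j' = τ j) :
    ∃ m : G.obj (c.pt.X i) ⟶ A, ∀ j, G.map ((leg c j).f i) ≫ m = τ j := by
  let s : Cocone ((F ⋙ ev k i) ⋙ G) :=
    { pt := A
      ι :=
        { app := τ
          naturality j j' φ := (hτ φ).trans (Category.comp_id _).symm } }
  let hc' := isColimitOfPreserves G (isColimitOfPreserves (ev k i) hc)
  exact ⟨hc'.desc s, hc'.fac s⟩

lemma hom_ext_ev {m m' : G.obj (c.pt.X i) ⟶ A}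
    (h : ∀ j, G.map ((leg c j).f i) ≫ m = G.map ((leg c j).f i) ≫ m') : m = m' :=
  (isColimitOfPreserves G (isColimitOfPreserves (ev k i) hc)).hom_ext h

/-- Maps out of a tensor product are determined by its summands, and on each summand tensoring with
`Z.X a` preserves the colimit. -/
lemma tensor_existsUnique (Z : Bicomplex k) (τ : ∀ j, (tensorObj Z (F.obj j)).X i ⟶ A)
    (hτ : ∀ {j j' : J} (φ : j ⟶ j'), tensorMap (fun i => 𝟙 (Z.X i)) (F.map φ).f i ≫ τ j' = τ j) :
    ∃! m : (tensorObj Z c.pt).X i ⟶ A,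
      ∀ j, tensorMap (fun i => 𝟙 (Z.X i)) (leg c j).f i ≫ m = τ j := by
  have h (a b : ℤ × ℤ) (hab : a + b = i) := exists_desc_ev hc
    (MonoidalCategory.tensorLeft (Z.X a)) b (fun j => tensorι Z (F.obj j) a b i hab ≫ τ j)
    (fun {j j'} φ => by
      rw [← hτ φ, reassoc_of% tensorι_map, MonoidalCategory.id_tensorHom]
      rfl)
  choose m hm using h
  refine ⟨tensorDesc m, fun j => tensor_hom_ext fun a b hab => ?_, fun m' hm' => ?_⟩
  · rw [reassoc_of% tensorι_map, tensorι_desc, MonoidalCategory.id_tensorHom]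
    exact hm a b hab j
  · refine tensor_hom_ext fun a b hab => ?_
    rw [tensorι_desc]
    refine hom_ext_ev hc (MonoidalCategory.tensorLeft (Z.X a)) b fun j => ?_
    rw [hm, ← hm', reassoc_of% tensorι_map, MonoidalCategory.id_tensorHom]
    rfl

lemma tot_existsUnique (n : ℤ) (τ : ∀ j, (F.obj j).totObj.X n ⟶ A)
    (hτ : ∀ {j j' : J} (φ : j ⟶ j'), (totHom (F.map φ)).f n ≫ τ j' = τ j) :
    ∃! m : c.pt.totObj.X n ⟶ A, ∀ j, (totHom (leg c j)).f n ≫ m = τ j := by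
  have h (i : ℤ × ℤ) (hi : i.1 + i.2 = n) := exists_desc_ev hc
    (𝟭 _) i (fun j => (F.obj j).totι i n hi ≫ τ j)
    (fun {j j'} φ => by
      rw [← hτ φ, reassoc_of% totι_map]
      rfl)
  choose m hm using h
  refine ⟨c.pt.totDesc m, fun j => (F.obj j).tot_hom_ext fun i hi => ?_, fun m' hm' => ?_⟩
  · rw [reassoc_of% totι_map, totι_desc]
    exact hm i hi j
  · refine c.pt.tot_hom_ext fun i hi => ?_
    rw [totι_desc]
    refine hom_ext_ev hc (𝟭 _) i fun j => ?_
    rw [hm, ← hm', reassoc_of% totι_map]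
    rfl

end

instance (Z : Bicomplex k) : PreservesColimitsOfShape J (MonoidalCategory.tensorLeft Z) where
  preservesColimit := ⟨fun hc => ⟨isColimitOfEv _ fun i =>
    IsColimit.ofExistsUnique fun s => tensor_existsUnique hc i Z s.ι.app s.w⟩⟩

instance : PreservesColimitsOfShape J (tot k) where
  preservesColimit := ⟨fun hc => ⟨HomologicalComplex.isColimitOfEval _ _ fun n =>
    IsColimit.ofExistsUnique fun s => tot_existsUnique hc n s.ι.app s.w⟩⟩

end

instance (Z : Bicomplex k) : PreservesColimitsOfSize.{u, u} (MonoidalCategory.tensorLeft Z) where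

instance : PreservesColimitsOfSize.{u, u} (tot k) where

instance : (tot k).IsLeftAdjoint := isLeftAdjoint_of_preservesColimits _

instance (Z : Bicomplex k) : (MonoidalCategory.tensorLeft Z).IsLeftAdjoint :=
  isLeftAdjoint_of_preservesColimits _

instance : MonoidalClosed (Bicomplex k) where
  closed Z := { rightAdj := _, adj := Adjunction.ofIsLeftAdjoint (MonoidalCategory.tensorLeft Z) }

end Bicomplex

namespace Bicomplex

open HomotopicalAlgebra MonoidalCategory

variable {k : Type u} [CommRing k]

/-! ### Pushout products -/

lemma surjLifts_mono {P Q : ℤ → Prop} (h : ∀ n, P n → Q n) : surjLifts k Q ≤ surjLifts k P :=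
  fun _ _ _ hf => ⟨hf.1, fun i hi => hf.2 i (h _ hi)⟩

/-- The tensor product has zero vertical differential. It inherits a horizontal contraction from
either factor not generated in column zero; if both are, it is concentrated in column zero. -/
lemma exists_section_row_tensor_row (i j : ℤ × ℤ) {E : Bicomplex k}
    (q : E ⟶ tensorObj (rowObj k i) (rowObj k j)) (hq : surjLifts k (fun _ => True) q) :
    ∃ t, t ≫ q = 𝟙 _ := by
  have hv := tensorObj_dv_eq_zero (rowObj k i) (rowObj k j) (fun _ => rfl) (fun _ => rfl)
  have hq' := surjLifts_mono (P := fun p => 0 < p) (fun _ _ => trivial) _ hq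
  by_cases hi : i.1 = 0
  · by_cases hj : j.1 = 0
    · exact exists_section_of_column_zero q hv (isZero_tensorObj _ _
        (fun _ => isZero_rowObj hi.le) (fun _ => isZero_rowObj hj.le)) hq
    · exact exists_section_of_hContraction q hv ((rowHContraction j hj).tensorLeft _) hq'
  · exact exists_section_of_hContraction q hv ((rowHContraction i hi).tensorRight _) hq'

lemma exists_section_disc_tensor_row (i j : ℤ × ℤ) (hi : i.1 ≤ 0) {E : Bicomplex k}
    (q : E ⟶ tensorObj (discObj k i) (rowObj k j)) (hq : ∀ a, Function.Surjective (q.f a)) :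
    ∃ t, t ≫ q = 𝟙 _ := by
  refine exists_section_of_vContraction q ((discVContraction k i).tensorRight _) ?_ hq
  by_cases hj : j.1 = 0
  · exact Or.inr (isZero_tensorObj _ _ (fun _ => isZero_discObj hi) (fun _ => isZero_rowObj hj.le))
  · exact Or.inl ⟨(rowHContraction j hj).tensorLeft _⟩

lemma pushoutProduct_hasLiftingProperty {P : ℤ → Prop} {A B C A' B' C' : Bicomplex k}
    {f : A ⟶ B} {g : B ⟶ C} {f' : A' ⟶ B'} {g' : B' ⟶ C'} (S : SplitExact f g)
    (S' : SplitExact f' g')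
    (hC : ∀ {E : Bicomplex k} (q : E ⟶ tensorObj C C'), surjLifts k P q → ∃ t, t ≫ q = 𝟙 _)
    {X Y : Bicomplex k} (p : X ⟶ Y) (hp : surjLifts k P p) :
    HasLiftingProperty ((Arrow.pushoutProduct.obj (.mk f)).obj (.mk f')).hom p := by
  let sq := Functor.PushoutObjObj.ofHasPushout (curriedTensor (Bicomplex k)) f f'
  exact (S.pushoutProduct S' (inl := sq.inl) (inr := sq.inr) (ι := sq.ι)
    sq.isPushout sq.inl_ι sq.inr_ι).hasLiftingProperty hC _ hp

lemma generators_pushoutProduct {A B A' B' : Bicomplex k} {f : A ⟶ B} {f' : A' ⟶ B'}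
    (hf : generators k (fun _ => True) f) (hf' : generators k (fun _ => True) f')
    {X Y : Bicomplex k} (p : X ⟶ Y) (hp : surjLifts k (fun _ => True) p) :
    HasLiftingProperty ((Arrow.pushoutProduct.obj (.mk f)).obj (.mk f')).hom p := by
  obtain ⟨i, -⟩ | ⟨i, hi⟩ := hf
  · obtain ⟨j, -⟩ | ⟨j, hj⟩ := hf'
    · exact pushoutProduct_hasLiftingProperty (discSplitExact k i) (discSplitExact k j)
        (exists_section_row_tensor_row i j) p hp
    · exact (hj trivial).elim
  · exact (hi trivial).elim

/-- The cokernel is either a product of rows, contracted horizontally by the one in a positive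
column, or a disc in a column at most zero tensored with a row, contracted vertically by the disc.
-/
lemma generators_pos_pushoutProduct {A B A' B' : Bicomplex k} {f : A ⟶ B} {f' : A' ⟶ B'}
    (hf : generators k (fun p => 0 < p) f) (hf' : generators k (fun _ => True) f')
    {X Y : Bicomplex k} (p : X ⟶ Y) (hp : surjLifts k (fun p => 0 < p) p) :
    HasLiftingProperty ((Arrow.pushoutProduct.obj (.mk f)).obj (.mk f')).hom p := by
  obtain ⟨j, -⟩ | ⟨j, hj⟩ := hf'
  · obtain ⟨i, hi⟩ | ⟨i, hi⟩ := hf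
    · exact pushoutProduct_hasLiftingProperty (discSplitExact k i) (discSplitExact k j)
        (fun q hq => exists_section_of_hContraction q
          (tensorObj_dv_eq_zero (rowObj k i) (rowObj k j) (fun _ => rfl) (fun _ => rfl))
          ((rowHContraction i hi.ne').tensorRight _) hq) p hp
    · exact pushoutProduct_hasLiftingProperty (zeroSplitExact _) (discSplitExact k j)
        (fun q hq => exists_section_disc_tensor_row i j (not_lt.1 hi) q hq.1) p hp
  · exact (hj trivial).elim

/-- The pushout product of saturated classes. -/
lemma pushoutProduct_llp_rlp {C : Type*} [Category* C] [MonoidalCategory C] [MonoidalClosed C]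
    [BraidedCategory C] [HasPushouts C] [HasPullbacks C] {I J K : MorphismProperty C}
    (h : ∀ {A B A' B' : C} {f : A ⟶ B} {f' : A' ⟶ B'} (_ : I f) (_ : J f') {X Y : C} (p : X ⟶ Y)
      (_ : K.rlp p), HasLiftingProperty ((Arrow.pushoutProduct.obj (.mk f)).obj (.mk f')).hom p)
    {A B A' B' : C} {f : A ⟶ B} {f' : A' ⟶ B'} (hf : I.rlp.llp f) (hf' : J.rlp.llp f') :
    K.rlp.llp ((Arrow.pushoutProduct.obj (.mk f)).obj (.mk f')).hom := by
  intro X Y p hp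
  -- Fixing one variable, adjunction moves the other into a lifting problem against a pullback-hom,
  -- so it may be replaced by a generator; this is done for each variable in turn.
  rw [Arrow.PushoutProduct.hasLiftingProperty_mk_iff]
  refine hf' _ fun _ _ j hj => ?_
  rw [← Arrow.PushoutProduct.hasLiftingProperty_mk_iff,
    Arrow.PushoutProduct.hasLiftingProperty_mk_iff']
  refine hf _ fun _ _ i hi => ?_
  rw [← Arrow.PushoutProduct.hasLiftingProperty_mk_iff']
  exact h hi hj p hp

lemma cofibration_pushoutProduct {A B A' B' : Bicomplex k} {f : A ⟶ B} {f' : A' ⟶ B'}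
    (hf : (surjLifts k (fun _ => True)).llp f) (hf' : (surjLifts k (fun _ => True)).llp f') :
    (surjLifts k (fun _ => True)).llp
      ((Arrow.pushoutProduct.obj (.mk f)).obj (.mk f')).hom := by
  rw [← generators_rlp] at hf hf' ⊢
  exact pushoutProduct_llp_rlp
    (fun hi hj _ _ p hp => generators_pushoutProduct hi hj p (generators_rlp (k := k) _ ▸ hp))
    hf hf'

lemma trivialCofibration_pushoutProduct {A B A' B' : Bicomplex k} {f : A ⟶ B} {f' : A' ⟶ B'}
    (hf : (surjLifts k (fun p => 0 < p)).llp f) (hf' : (surjLifts k (fun _ => True)).llp f') :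
    (surjLifts k (fun p => 0 < p)).llp
      ((Arrow.pushoutProduct.obj (.mk f)).obj (.mk f')).hom := by
  rw [← generators_rlp] at hf hf' ⊢
  exact pushoutProduct_llp_rlp
    (fun hi hj _ _ p hp => generators_pos_pushoutProduct hi hj p (generators_rlp (k := k) _ ▸ hp))
    hf hf'

lemma trivialCofibration_pushoutProduct' {A B A' B' : Bicomplex k} {f : A ⟶ B} {f' : A' ⟶ B'}
    (hf : (surjLifts k (fun _ => True)).llp f) (hf' : (surjLifts k (fun p => 0 < p)).llp f') :
    (surjLifts k (fun p => 0 < p)).llp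
      ((Arrow.pushoutProduct.obj (.mk f)).obj (.mk f')).hom := fun _ _ p hp =>
  (HasLiftingProperty.iff_of_arrow_iso_left (Arrow.PushoutProduct.braiding (.mk f) (.mk f')) p).2
    (trivialCofibration_pushoutProduct hf' hf p hp)

end Bicomplex

/-! ### Injective quasi-isomorphisms and lifting against injective discs. -/

namespace ChainComplexElements

variable {k : Type u} [CommRing k]

/-- A map into an injective module which vanishes on the kernel of another map factors through
it. -/
lemma exists_extension {M N E : ModuleCat.{u} k} [Injective E] (c : M ⟶ N) (g : M ⟶ E)
    (h : ∀ m, c m = 0 → g m = 0) : ∃ g' : N ⟶ E, c ≫ g' = g := by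
  let c' : ModuleCat.of k (M ⧸ LinearMap.ker c.hom) ⟶ N :=
    ModuleCat.ofHom ((LinearMap.ker c.hom).liftQ c.hom le_rfl)
  let g₀ : ModuleCat.of k (M ⧸ LinearMap.ker c.hom) ⟶ E :=
    ModuleCat.ofHom ((LinearMap.ker c.hom).liftQ g.hom h)
  have : Mono c' := (ModuleCat.mono_iff_injective _).2
    (LinearMap.ker_eq_bot.1 (Submodule.ker_liftQ_eq_bot _ _ _ le_rfl))
  refine ⟨Injective.factorThru g₀ c', ?_⟩
  ext m
  exact ConcreteCategory.congr_hom (Injective.comp_factorThru g₀ c')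
    (Submodule.Quotient.mk (p := LinearMap.ker c.hom) m)

/-- Elements outside of a submodule are detected by maps to injective modules. -/
lemma exists_injective_ne_zero {M : ModuleCat.{u} k} (N : Submodule k M) (x : M) (hx : x ∉ N) :
    ∃ (E : ModuleCat.{u} k) (_ : Injective E) (g : M ⟶ E), (∀ y ∈ N, g y = 0) ∧ g x ≠ 0 := by
  let q : M ⟶ ModuleCat.of k (M ⧸ N) := ModuleCat.ofHom N.mkQ
  refine ⟨Injective.under (ModuleCat.of k (M ⧸ N)), inferInstance, q ≫ Injective.ι _,
    fun y hy => ?_, fun h => hx ?_⟩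
  · have : q y = 0 := (Submodule.Quotient.mk_eq_zero N).2 hy
    rw [ConcreteCategory.comp_apply, this, map_zero]
  · have h' : Function.Injective (Injective.ι (ModuleCat.of k (M ⧸ N))) :=
      (ModuleCat.mono_iff_injective _).1 inferInstance
    refine (Submodule.Quotient.mk_eq_zero N).1 (h' (a₁ := q x) (a₂ := 0) ?_)
    rw [map_zero]
    exact h

section

variable {K L : ChainComplex (ModuleCat.{u} k) ℤ} {i j : ℤ} (hij : (ComplexShape.down ℤ).Rel i j)

include hij in
lemma ne_of_rel : i ≠ j := by
  have : j + 1 = i := hij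
  omega

/-- The complex with two copies of `E` in degrees `i` and `j = i - 1`. -/
abbrev disc (E : ModuleCat.{u} k) : ChainComplex (ModuleCat.{u} k) ℤ :=
  HomologicalComplex.double (𝟙 E) hij

/-- The complex with `E` in degree `i`. -/
abbrev sphere (i : ℤ) (E : ModuleCat.{u} k) : ChainComplex (ModuleCat.{u} k) ℤ :=
  (HomologicalComplex.single _ (ComplexShape.down ℤ) i).obj E

/-- The projection of the disc to the sphere. -/
def discToSphere (E : ModuleCat.{u} k) : disc hij E ⟶ sphere i E :=
  HomologicalComplex.mkHomToSingle (HomologicalComplex.doubleXIso₀ (𝟙 E) hij).hom fun l hl => by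
    rw [HomologicalComplex.double_d_eq_zero₁ _ _ _ _ (ne_of_rel hij), zero_comp]

/-- Maps into a disc. -/
def toDisc {E : ModuleCat.{u} k} (ψ : K.X j ⟶ E) : K ⟶ disc hij E where
  f l := if hi : l = i then (K.XIsoOfEq hi).hom ≫ K.d i j ≫ ψ ≫
      (HomologicalComplex.doubleXIso₀ (𝟙 E) hij).inv ≫ ((disc hij E).XIsoOfEq hi).inv
    else if hj : l = j then (K.XIsoOfEq hj).hom ≫ ψ ≫
      (HomologicalComplex.doubleXIso₁ (𝟙 E) hij (ne_of_rel hij)).inv ≫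
        ((disc hij E).XIsoOfEq hj).inv
    else 0
  comm' l m hlm := by
    by_cases hm : m = j
    · subst hm
      obtain rfl : l = i := hlm.symm.trans hij
      rw [dif_pos rfl, dif_neg (ne_of_rel hij).symm, dif_pos rfl,
        HomologicalComplex.double_d _ _ (ne_of_rel hij)]
      simp
    · by_cases hm' : m = i
      · subst hm'
        rw [HomologicalComplex.double_d_eq_zero₁ _ _ _ _ (ne_of_rel hij), comp_zero, dif_pos rfl]
        simp
      · exact (HomologicalComplex.isZero_double_X _ hij _ hm' hm).eq_of_tgt _ _

lemma toDisc_f₀ {E : ModuleCat.{u} k} (ψ : K.X j ⟶ E) :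
    (toDisc hij ψ).f i = K.d i j ≫ ψ ≫ (HomologicalComplex.doubleXIso₀ (𝟙 E) hij).inv := by
  dsimp only [toDisc]
  rw [dif_pos rfl]
  simp

lemma toDisc_f₁ {E : ModuleCat.{u} k} (ψ : K.X j ⟶ E) :
    (toDisc hij ψ).f j =
      ψ ≫ (HomologicalComplex.doubleXIso₁ (𝟙 E) hij (ne_of_rel hij)).inv := by
  dsimp only [toDisc]
  rw [dif_neg (ne_of_rel hij).symm, dif_pos rfl]
  simp

lemma discToSphere_f (E : ModuleCat.{u} k) : (discToSphere hij E).f i =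
    (HomologicalComplex.doubleXIso₀ (𝟙 E) hij).hom ≫
      (HomologicalComplex.singleObjXSelf (ComplexShape.down ℤ) i E).inv :=
  HomologicalComplex.mkHomToSingle_f _ _

/-- A map to the disc on `E` is a map `ψ` from degree `j` to `E`, and a map to the sphere is a map
`φ` from degree `i` to `E` that kills boundaries; the square and its diagonal translate accordingly.
-/
lemma hasLiftingProperty_discToSphere_iff (f : K ⟶ L) (E : ModuleCat.{u} k) :
    HasLiftingProperty f (discToSphere hij E) ↔
      ∀ (ψ : K.X j ⟶ E) (φ : L.X i ⟶ E), (∀ l, L.d l i ≫ φ = 0) → K.d i j ≫ ψ = f.f i ≫ φ →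
        ∃ ψ' : L.X j ⟶ E, L.d i j ≫ ψ' = φ ∧ f.f j ≫ ψ' = ψ := by
  constructor
  · intro h ψ φ hφ hψ
    have sq : CommSq (toDisc hij ψ) f (discToSphere hij E)
        (HomologicalComplex.mkHomToSingle φ fun l _ => hφ l) := ⟨by
      refine HomologicalComplex.to_single_hom_ext ?_
      rw [HomologicalComplex.comp_f, HomologicalComplex.comp_f,
        HomologicalComplex.mkHomToSingle_f, toDisc_f₀, discToSphere_f, ← Category.assoc (f.f i),
        ← hψ]
      simp only [Category.assoc, Iso.inv_hom_id_assoc]⟩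
    have h₁ := congr_arg (fun g => HomologicalComplex.Hom.f g j) sq.fac_left
    have h₂ := congr_arg (fun g => HomologicalComplex.Hom.f g i) sq.fac_right
    rw [HomologicalComplex.comp_f, toDisc_f₁] at h₁
    rw [HomologicalComplex.comp_f, discToSphere_f, HomologicalComplex.mkHomToSingle_f,
      ← Category.assoc, cancel_mono] at h₂
    refine ⟨sq.lift.f j ≫ (HomologicalComplex.doubleXIso₁ (𝟙 E) hij (ne_of_rel hij)).hom, ?_, ?_⟩
    · refine Eq.trans ?_ h₂
      rw [← Category.assoc, ← sq.lift.comm, HomologicalComplex.double_d _ _ (ne_of_rel hij)]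
      simp
    · rw [← Category.assoc, h₁, Category.assoc, Iso.inv_hom_id, Category.comp_id]
  · intro h
    refine ⟨fun {u v} sq => ?_⟩
    have w := congr_arg (fun g => HomologicalComplex.Hom.f g i) sq.w
    rw [HomologicalComplex.comp_f, HomologicalComplex.comp_f, discToSphere_f] at w
    have hu := u.comm i j
    rw [HomologicalComplex.double_d _ _ (ne_of_rel hij)] at hu
    obtain ⟨ψ', h₁, h₂⟩ := h
      (u.f j ≫ (HomologicalComplex.doubleXIso₁ (𝟙 E) hij (ne_of_rel hij)).hom)
      (v.f i ≫ (HomologicalComplex.singleObjXSelf (ComplexShape.down ℤ) i E).hom)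
      (fun l => by
        rw [← Category.assoc, ← v.comm, HomologicalComplex.single_obj_d, comp_zero, zero_comp])
      (by
        rw [← Category.assoc, ← hu, ← Category.assoc (f.f i), ← w]
        simp)
    refine ⟨⟨⟨toDisc hij ψ', ?_, ?_⟩⟩⟩
    · apply HomologicalComplex.to_double_hom_ext
      · rw [HomologicalComplex.comp_f, toDisc_f₀, ← Category.assoc, f.comm, Category.assoc,
          reassoc_of% h₂]
        rw [← reassoc_of% hu]
        simp
      · rw [HomologicalComplex.comp_f, toDisc_f₁, reassoc_of% h₂]
        simp
    · refine HomologicalComplex.to_single_hom_ext ?_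
      rw [HomologicalComplex.comp_f, toDisc_f₀, discToSphere_f, reassoc_of% h₁]
      simp

/-- The class of the projections from injective discs to spheres. -/
inductive discsToSpheres (k : Type u) [CommRing k] :
    MorphismProperty (ChainComplex (ModuleCat.{u} k) ℤ)
  | mk (i j : ℤ) (hij : (ComplexShape.down ℤ).Rel i j) (E : ModuleCat.{u} k) [Injective E] :
      discsToSpheres k (discToSphere hij E)

/-- The required map is prescribed on the sum of the image of `f` and the boundaries, and extends
from there because `E` is injective. That the prescription is well defined uses injectivity on
homology in degree `j` and surjectivity on homology in degree `i`. -/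
lemma discsToSpheres_llp_of_injective (f : K ⟶ L) (hf : ∀ n, Function.Injective (f.f n))
    (hf' : QuasiIso f) : (discsToSpheres k).llp f := by
  rw [quasiIso_iff_forall] at hf'
  rintro _ _ _ ⟨i, j, hij, E⟩
  rw [hasLiftingProperty_discToSphere_iff]
  intro ψ φ hφ hψ
  have hψ' (x) : ψ (K.d i j x) = φ (f.f i x) := ConcreteCategory.congr_hom hψ x
  have hφ' (l : ℤ) (x : L.X l) : φ (L.d l i x) = 0 := ConcreteCategory.congr_hom (hφ l) x
  let c : ModuleCat.of k (K.X j × L.X i) ⟶ L.X j :=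
    ModuleCat.ofHom ((f.f j).hom.coprod (L.d i j).hom)
  let g : ModuleCat.of k (K.X j × L.X i) ⟶ E := ModuleCat.ofHom (ψ.hom.coprod φ.hom)
  obtain ⟨ψ', h⟩ := exists_extension c g (by
    rintro ⟨a, b⟩ hab
    have hab : f.f j a + L.d i j b = 0 := hab
    change ψ a + φ b = 0
    have hab' : f.f j a = L.d i j (-b) := by rw [map_neg]; exact eq_neg_of_add_eq_zero_left hab
    have ha : K.d j (j - 1) a = 0 := hf _ (by
      rw [map_zero, ← comm_apply, hab', d_d_apply])
    obtain ⟨a', rfl⟩ := (hf' hij (sub_add_cancel j 1)).1 a _ ha hab'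
    obtain ⟨c, hc, b', hb'⟩ := (hf' (i := i + 1) rfl hij).2 (b + f.f i a')
      (by rw [map_add, comm_apply, add_comm, hab])
    rw [hψ', add_comm, ← map_add, hb', map_add, ← hψ', hc, hφ', map_zero, add_zero])
  have h' (a b) : ψ' (f.f j a + L.d i j b) = ψ a + φ b := ConcreteCategory.congr_hom h (a, b)
  refine ⟨ψ', ?_, ?_⟩
  · ext b
    have := h' 0 b
    rw [map_zero, map_zero, zero_add, zero_add] at this
    exact this
  · ext a
    have := h' a 0
    rw [map_zero, map_zero, add_zero, add_zero] at this
    exact this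

/-- A class violating injectivity or surjectivity on homology would be detected by a map to an
injective module; the lifting property forces this map to vanish on it. -/
lemma quasiIso_of_discsToSpheres_llp (f : K ⟶ L) (hf : (discsToSpheres k).llp f) :
    QuasiIso f := by
  rw [quasiIso_iff_forall]
  intro i j l hij hjl
  constructor
  · intro a b ha hab
    by_contra hx
    obtain ⟨E, _, ψ, hψ, hψ'⟩ := exists_injective_ne_zero (LinearMap.range (K.d i j).hom) a hx
    obtain ⟨ψ', h₁, h₂⟩ := (hasLiftingProperty_discToSphere_iff hij f E).1
      (hf _ (.mk i j hij E)) ψ 0 (fun _ => comp_zero) (by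
        ext x
        exact hψ _ ⟨x, rfl⟩)
    apply hψ'
    have e₁ : ψ' (L.d i j b) = 0 := ConcreteCategory.congr_hom h₁ b
    have e₂ : ψ' (f.f j a) = ψ a := ConcreteCategory.congr_hom h₂ a
    rw [← e₂, hab, e₁]
  · intro b hb
    by_contra hx
    obtain ⟨E, _, φ, hφ, hφ'⟩ := exists_injective_ne_zero
      ((LinearMap.ker (K.d j l).hom).map (f.f j).hom ⊔ LinearMap.range (L.d i j).hom) b (by
        intro h
        obtain ⟨_, ⟨a, ha, rfl⟩, _, ⟨b', rfl⟩, h⟩ := Submodule.mem_sup.1 h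
        exact hx ⟨a, ha, b', h.symm⟩)
    obtain ⟨ψ, hψ⟩ := exists_extension (K.d j l) (f.f j ≫ φ)
      (fun a ha => hφ _ (Submodule.mem_sup_left ⟨a, ha, rfl⟩))
    obtain ⟨ψ', h₁, h₂⟩ := (hasLiftingProperty_discToSphere_iff hjl f E).1
      (hf _ (.mk j l hjl E)) ψ φ (fun n => by
        by_cases hn : n = i
        · subst hn
          ext x
          exact hφ _ (Submodule.mem_sup_right ⟨x, rfl⟩)
        · rw [L.shape, zero_comp]
          intro (h : j + 1 = n)
          omega) hψ
    apply hφ'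
    have e₁ : ψ' (L.d j l b) = φ b := ConcreteCategory.congr_hom h₁ b
    rw [← e₁, hb, map_zero]

end

end ChainComplexElements

namespace Bicomplex

open BigradedTensor MonoidalCategory

variable {k : Type u} [CommRing k]

/-! ### Total complexes and contractions -/

section

variable {X Y Z : Bicomplex k}

/-- The map on total complexes given by a family of degreewise maps. -/
def totMap (u : ∀ i, X.X i ⟶ Y.X i) (n : ℤ) : X.totObj.X n ⟶ Y.totObj.X n :=
  X.totDesc fun i hi => u i ≫ Y.totι i n hi

lemma totι_totMap (u : ∀ i, X.X i ⟶ Y.X i) (n : ℤ) (i : ℤ × ℤ) (hi : i.1 + i.2 = n) :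
    X.totι i n hi ≫ totMap u n = u i ≫ Y.totι i n hi :=
  totι_desc _ _ _ _

lemma totMap_f (f : X ⟶ Y) (n : ℤ) : totMap f.f n = (totHom f).f n :=
  X.tot_hom_ext fun i hi => by rw [totι_totMap, totι_map]

lemma totMap_comp (u : ∀ i, X.X i ⟶ Y.X i) (v : ∀ i, Y.X i ⟶ Z.X i) (n : ℤ) :
    totMap u n ≫ totMap v n = totMap (fun i => u i ≫ v i) n :=
  X.tot_hom_ext fun i hi => by
    rw [← Category.assoc, totι_totMap, Category.assoc, totι_totMap, totι_totMap, Category.assoc]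

lemma totMap_id (n : ℤ) : totMap (fun i => 𝟙 (X.X i)) n = 𝟙 _ :=
  X.tot_hom_ext fun i hi => by rw [totι_totMap, Category.id_comp, Category.comp_id]

lemma totMap_add (u v : ∀ i, X.X i ⟶ Y.X i) (n : ℤ) :
    totMap (fun i => u i + v i) n = totMap u n + totMap v n :=
  X.tot_hom_ext fun i hi => by
    rw [Preadditive.comp_add, totι_totMap, totι_totMap, totι_totMap, Preadditive.add_comp]

/-- The total complex of a bicomplex with a contraction is exact. -/
lemma tot_exact_of_contraction {σ τ : ℤ × ℤ → ℤ × ℤ} (hσ : Function.Bijective σ)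
    (hσ' : ∀ i, (σ i).1 + (σ i).2 + 1 = i.1 + i.2) (hτ' : ∀ i, (τ i).1 + (τ i).2 + 1 = i.1 + i.2)
    (hστ : ∀ i, σ (τ i) = τ (σ i))
    {d : ∀ i, X.X i ⟶ X.X (σ i)} {e : ∀ i, X.X i ⟶ X.X (τ i)}
    (hX : ∀ i n m (hi : i.1 + i.2 = n) (h : m + 1 = n), X.totι i n hi ≫ X.totObj.d n m =
      d i ≫ X.totι (σ i) m (by have := hσ' i; omega) +
        e i ≫ X.totι (τ i) m (by have := hτ' i; omega))
    (S : Contraction σ τ d e) (n m l : ℤ) (hm : m + 1 = n) (hl : l + 1 = m) (x : X.totObj.X m)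
    (hx : X.totObj.d m l x = 0) : ∃ y : X.totObj.X n, X.totObj.d n m y = x := by
  let s (n m : ℤ) (hm : m + 1 = n) : X.totObj.X m ⟶ X.totObj.X n := X.totDesc fun i hi =>
    S.s i _ (Function.surjInv_eq hσ.2 i) ≫ X.totι _ n (by
      have := hσ' (Function.surjInv hσ.2 i)
      rw [Function.surjInv_eq hσ.2 i] at this
      omega)
  have hs (n m : ℤ) (hm : m + 1 = n) (i j : ℤ × ℤ) (hi : i.1 + i.2 = m) (hj : σ j = i) :
      X.totι i m hi ≫ s n m hm = S.s i j hj ≫ X.totι j n (by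
        have := hσ' j
        rw [hj] at this
        omega) := by
    obtain rfl : j = Function.surjInv hσ.2 i := hσ.1 (hj.trans (Function.surjInv_eq hσ.2 i).symm)
    exact totι_desc _ _ _ _
  -- The terms mixing `s` and `e` cancel by anticommutation, so `s` contracts the total
  -- differential.
  have key : s n m hm ≫ X.totObj.d n m + X.totObj.d m l ≫ s m l hl = 𝟙 _ :=
    X.tot_hom_ext fun i hi => by
      obtain ⟨j, rfl⟩ := hσ.2 i
      rw [Preadditive.comp_add, ← Category.assoc, ← Category.assoc, hs n m hm (σ j) j hi rfl,
        Category.assoc, hX j n m _ hm, hX (σ j) m l hi hl, Preadditive.add_comp, Category.assoc,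
        Category.assoc, hs m l hl (σ (σ j)) (σ j) _ rfl, hs m l hl (τ (σ j)) (τ j) _ (hστ j),
        Preadditive.comp_add, ← Category.assoc (S.s _ _ _) (e j), S.anticomm _ _ rfl (hστ j)]
      have h := S.contr j =≫ X.totι (σ j) m hi
      rw [Preadditive.add_comp, Category.assoc, Category.assoc] at h
      rw [Preadditive.neg_comp, Category.assoc, Category.comp_id]
      refine Eq.trans ?_ (h.trans (Category.id_comp _))
      abel
  refine ⟨s n m hm x, ?_⟩
  have h : X.totObj.d n m (s n m hm x) + s m l hl (X.totObj.d m l x) = x :=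
    ConcreteCategory.congr_hom key x
  rw [hx, map_zero, add_zero] at h
  exact h

lemma HContraction.tot_exact (S : HContraction X) (n m l : ℤ) (hm : m + 1 = n) (hl : l + 1 = m)
    (x : X.totObj.X m) (hx : X.totObj.d m l x = 0) : ∃ y : X.totObj.X n, X.totObj.d n m y = x :=
  tot_exact_of_contraction bijective_h (fun i => by dsimp; omega) (fun i => by dsimp; omega)
    (fun _ => rfl) (fun i n m hi h => X.totι_d i n m hi h) S n m l hm hl x hx

lemma VContraction.tot_exact (S : VContraction X) (n m l : ℤ) (hm : m + 1 = n) (hl : l + 1 = m)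
    (x : X.totObj.X m) (hx : X.totObj.d m l x = 0) : ∃ y : X.totObj.X n, X.totObj.d n m y = x :=
  tot_exact_of_contraction bijective_v (fun i => by dsimp; omega) (fun i => by dsimp; omega)
    (fun _ => rfl) (fun i n m hi h => (X.totι_d i n m hi h).trans (add_comm _ _)) S n m l hm hl x hx

end

namespace SplitExact

variable {A B C : Bicomplex k} {f : A ⟶ B} {g : B ⟶ C} (S : SplitExact f g)

include S

lemma tot_injective (n : ℤ) : Function.Injective ((totHom f).f n) := by
  have h : (totHom f).f n ≫ totMap S.r n = 𝟙 _ := by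
    rw [← totMap_f, totMap_comp, funext S.f_r, totMap_id]
  exact Function.LeftInverse.injective fun x => ConcreteCategory.congr_hom h x

/-- The degreewise splitting keeps the sequence of totals exact, so this is the long exact sequence
for an exact cokernel, carried out on elements. -/
lemma quasiIso_tot (hC : ∀ (n m l : ℤ) (_ : m + 1 = n) (_ : l + 1 = m) (x : C.totObj.X m),
    C.totObj.d m l x = 0 → ∃ y : C.totObj.X n, C.totObj.d n m y = x) : QuasiIso (totHom f) := by
  have h₁ (n : ℤ) : totMap S.r n ≫ (totHom f).f n + (totHom g).f n ≫ totMap S.s n = 𝟙 _ := by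
    rw [← totMap_f, ← totMap_f, totMap_comp, totMap_comp, ← totMap_add, funext S.total, totMap_id]
  have h₂ (n : ℤ) : totMap S.s n ≫ (totHom g).f n = 𝟙 _ := by
    rw [← totMap_f, totMap_comp, funext S.s_g, totMap_id]
  have h₁' (n : ℤ) (x : B.totObj.X n) :
      (totHom f).f n (totMap S.r n x) + totMap S.s n ((totHom g).f n x) = x :=
    ConcreteCategory.congr_hom (h₁ n) x
  have h₂' (n : ℤ) (x : C.totObj.X n) : (totHom g).f n (totMap S.s n x) = x :=
    ConcreteCategory.congr_hom (h₂ n) x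
  have h₃ (n : ℤ) (x : B.totObj.X n) (hx : (totHom g).f n x = 0) : ∃ a, (totHom f).f n a = x :=
    ⟨totMap S.r n x, by simpa only [hx, map_zero, add_zero] using h₁' n x⟩
  have h₄ : totHom f ≫ totHom g = 0 := by
    exact HomologicalComplex.hom_ext _ _ fun n => A.tot_hom_ext fun i hi => by
      rw [HomologicalComplex.comp_f, reassoc_of% totι_map, totι_map, reassoc_of% S.f_g i,
        zero_comp]
      exact comp_zero.symm
  have h₄' (n : ℤ) (x : A.totObj.X n) : (totHom g).f n ((totHom f).f n x) = 0 :=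
    ConcreteCategory.congr_hom (congr_arg (fun φ => HomologicalComplex.Hom.f φ n) h₄) x
  -- An element whose image in the cokernel is a cycle comes from `A` up to a boundary, by exactness
  -- of the cokernel.
  have h₅ (n m l : ℤ) (hm : m + 1 = n) (hl : l + 1 = m) (x : B.totObj.X m)
      (hx : C.totObj.d m l ((totHom g).f m x) = 0) :
      ∃ a b', x = (totHom f).f m a + B.totObj.d n m b' := by
    obtain ⟨c, hc⟩ := hC n m l hm hl _ hx
    obtain ⟨a, ha⟩ := h₃ m (x - B.totObj.d n m (totMap S.s n c)) (by
      rw [map_sub, ← ChainComplexElements.comm_apply, h₂', hc, sub_self])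
    exact ⟨a, _, eq_add_of_sub_eq ha.symm⟩
  rw [ChainComplexElements.quasiIso_iff_forall]
  intro i j l hij hjl
  constructor
  · intro a b ha hab
    obtain ⟨a', b', h⟩ := h₅ (i + 1) i j rfl hij b (by
      rw [ChainComplexElements.comm_apply, ← hab, h₄'])
    refine ⟨a', S.tot_injective j ?_⟩
    rw [← ChainComplexElements.comm_apply, hab, h, map_add, ChainComplexElements.d_d_apply,
      add_zero]
  · intro b hb
    obtain ⟨a, b', h⟩ := h₅ i j l hij hjl b (by
      rw [ChainComplexElements.comm_apply, hb, map_zero])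
    refine ⟨a, S.tot_injective l ?_, b', h⟩
    rw [map_zero, ← ChainComplexElements.comm_apply, ← hb, h, map_add,
      ChainComplexElements.d_d_apply, add_zero]

end SplitExact

/-! ### Injective maps inducing quasi-isomorphisms -/

/-- The right adjoint of the totalisation. -/
def totRightAdjoint (k : Type u) [CommRing k] : ChainComplex (ModuleCat.{u} k) ℤ ⥤ Bicomplex k :=
  Functor.rightAdjoint (tot k)

/-- The class of maps of bicomplexes whose totalisations lift against the projections from
injective discs to spheres. -/
def totTrivialMonos (k : Type u) [CommRing k] : MorphismProperty (Bicomplex k) :=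
  ((ChainComplexElements.discsToSpheres k).strictMap (totRightAdjoint k)).llp

/-- By adjunction the lifting problems may be moved to chain complexes. Defining the class by a left
lifting property among bicomplexes gives its closure properties for free. -/
lemma totTrivialMonos_iff {X Y : Bicomplex k} (f : X ⟶ Y) :
    totTrivialMonos k f ↔ (ChainComplexElements.discsToSpheres k).llp (totHom f) := by
  have h {K L : ChainComplex (ModuleCat.{u} k) ℤ} (p : K ⟶ L) :=
    (Adjunction.ofIsLeftAdjoint (tot k)).hasLiftingProperty_iff f p
  constructor
  · intro hf K L p hp
    exact (h p).2 (hf _ ⟨hp⟩)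
  · rintro hf _ _ _ ⟨hp⟩
    exact (h _).1 (hf _ hp)

lemma totTrivialMonos_le : totTrivialMonos k ≤ totWeakEquivalences k := fun _ _ f hf =>
  ChainComplexElements.quasiIso_of_discsToSpheres_llp _ ((totTrivialMonos_iff f).1 hf)

lemma SplitExact.totTrivialMonos {A B C : Bicomplex k} {f : A ⟶ B} {g : B ⟶ C}
    (S : SplitExact f g) (hC : Nonempty (HContraction C) ∨ Nonempty (VContraction C)) :
    totTrivialMonos k f := by
  rw [totTrivialMonos_iff]
  refine ChainComplexElements.discsToSpheres_llp_of_injective _ S.tot_injective (S.quasiIso_tot ?_)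
  obtain ⟨⟨T⟩⟩ | ⟨⟨T⟩⟩ := hC
  · exact T.tot_exact
  · exact T.tot_exact

/-- Degreewise splittings and contractions survive tensoring with anything, so no flatness of `Z` is
needed. -/
lemma generators_whiskerRight {A B : Bicomplex k} {f : A ⟶ B}
    (hf : generators k (fun p => 0 < p) f) (Z : Bicomplex k) : totTrivialMonos k (f ▷ Z) := by
  obtain ⟨i, hi⟩ | ⟨i, hi⟩ := hf
  · exact ((discSplitExact k i).whiskerRight Z).totTrivialMonos
      (Or.inl ⟨(rowHContraction i hi.ne').tensorRight Z⟩)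
  · exact ((zeroSplitExact (discObj k i)).whiskerRight Z).totTrivialMonos
      (Or.inr ⟨(discVContraction k i).tensorRight Z⟩)

instance (Z : Bicomplex k) : (tensorRight Z).IsLeftAdjoint :=
  Functor.isLeftAdjoint_of_iso (BraidedCategory.tensorLeftIsoTensorRight Z)

/-- Tensoring with `Z` is a left adjoint and the target class is defined by left lifting, so it is
enough to know the generators. -/
lemma totTrivialMonos_whiskerRight {A B : Bicomplex k} {f : A ⟶ B}
    (hf : (surjLifts k (fun p => 0 < p)).llp f) (Z : Bicomplex k) :
    totTrivialMonos k (f ▷ Z) := by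
  rw [← generators_rlp] at hf
  intro X Y p hp
  have adj := Adjunction.ofIsLeftAdjoint (tensorRight Z)
  refine (adj.hasLiftingProperty_iff f p).2 (hf _ fun _ _ i hi => ?_)
  exact (adj.hasLiftingProperty_iff i p).1 (generators_whiskerRight hi Z p hp)

end Bicomplex

namespace Bicomplex

open Opposite MorphismProperty HomotopicalAlgebra

variable {k : Type u} [CommRing k]

/-! ### The small object argument -/

section

variable {J : Type u} [SmallCategory J] [IsFiltered J] {F : J ⥤ Bicomplex k} {c : Cocone F}
  (hc : IsColimit c)

include hc

lemma exists_leg_eq (i : ℤ × ℤ) (x : c.pt.X i) :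
    ∃ (j : J) (y : (F.obj j).X i), (leg c j).f i y = x :=
  Concrete.isColimit_exists_rep (F ⋙ ev k i) (isColimitOfPreserves (ev k i) hc) x

lemma exists_map_eq (i : ℤ × ℤ) {j : J} (x y : (F.obj j).X i)
    (h : (leg c j).f i x = (leg c j).f i y) :
    ∃ (j' : J) (φ : j ⟶ j'), (F.map φ).f i x = (F.map φ).f i y := by
  obtain ⟨l, f, g, hl⟩ := Concrete.isColimit_exists_of_rep_eq (F ⋙ ev k i)
    (isColimitOfPreserves (ev k i) hc) x y h
  have hl' : (F.map f).f i x = (F.map g).f i y := hl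
  -- The two elements become equal along possibly different arrows; coequalizing these gives a
  -- single one.
  refine ⟨IsFiltered.coeq f g, f ≫ IsFiltered.coeqHom f g, ?_⟩
  have h₁ : (F.map (f ≫ IsFiltered.coeqHom f g)).f i x =
      (F.map (IsFiltered.coeqHom f g)).f i ((F.map f).f i x) := by
    rw [F.map_comp]
    rfl
  have h₂ : (F.map (g ≫ IsFiltered.coeqHom f g)).f i y =
      (F.map (IsFiltered.coeqHom f g)).f i ((F.map g).f i y) := by
    rw [F.map_comp]
    rfl
  rw [h₁, hl', ← h₂, ← IsFiltered.coeq_condition]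

end

/-- A map out of a row is one element subject to one equation, and in a filtered colimit both are
already realized at some stage. -/
instance (i : ℤ × ℤ) : IsFinitelyPresentable.{u} (rowObj k i) := by
  rw [isFinitelyPresentable_iff_preservesFilteredColimits]
  refine ⟨fun J _ _ => ⟨fun {F} => ⟨fun {c} hc => ⟨Types.FilteredColimit.isColimitOf' _ _ ?_ ?_⟩⟩⟩⟩
  · intro (g : rowObj k i ⟶ c.pt)
    obtain ⟨j, y, hy⟩ := exists_leg_eq hc i (g.f i (rowGen k i))
    have hg : c.pt.dv i (g.f i (rowGen k i)) = 0 := by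
      rw [← comm_v_apply]
      exact map_zero (g.f (i.1, i.2 - 1)).hom
    obtain ⟨j', φ, hφ⟩ := exists_map_eq hc _ ((F.obj j).dv i y) 0 (by
      rw [comm_v_apply, hy, hg, map_zero])
    rw [map_zero, comm_v_apply] at hφ
    refine ⟨j', rowDesc _ hφ, rowHom_ext ?_⟩
    have h₁ : (rowDesc _ hφ ≫ leg c j').f i (rowGen k i) = (leg c j').f i ((F.map φ).f i y) :=
      congr_arg ((leg c j').f i) (rowDesc_gen _ hφ)
    have h₂ : F.map φ ≫ leg c j' = leg c j := c.w φ
    refine Eq.trans ?_ h₁.symm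
    refine Eq.trans ?_ (congr_arg (fun ψ => Hom.f ψ i y) h₂).symm
    exact hy.symm
  · intro j (g : rowObj k i ⟶ F.obj j) (g' : rowObj k i ⟶ F.obj j) h
    obtain ⟨j', φ, hφ⟩ := exists_map_eq hc i (g.f i (rowGen k i)) (g'.f i (rowGen k i))
      (congr_arg (fun ψ : rowObj k i ⟶ c.pt => ψ.f i (rowGen k i)) h)
    exact ⟨j', φ, rowHom_ext hφ⟩

instance : IsFinitelyPresentable.{u} (zeroObj k) := by
  rw [isFinitelyPresentable_iff_preservesFilteredColimits]
  refine ⟨fun J _ _ => ⟨fun {F} => ⟨fun {c} hc => ⟨Types.FilteredColimit.isColimitOf' _ _ ?_ ?_⟩⟩⟩⟩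
  · intro (g : zeroObj k ⟶ c.pt)
    have j : J := IsFiltered.nonempty.some
    exact ⟨j, fromZero _, (fromZero_uniq _).trans (fromZero_uniq _).symm⟩
  · intro j (g : zeroObj k ⟶ F.obj j) (g' : zeroObj k ⟶ F.obj j) h
    exact ⟨j, 𝟙 j, (fromZero_uniq _).trans (fromZero_uniq _).symm⟩

instance (P : ℤ → Prop) : MorphismProperty.IsSmall.{u} (generators k P) := by
  let φ : { i : ℤ × ℤ // P i.1 } ⊕ { i : ℤ × ℤ // ¬ P i.1 } → (generators k P).toSet := Sum.elim
    (fun i => ⟨Arrow.mk (discInl k i), .row i.1 i.2⟩)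
    (fun i => ⟨Arrow.mk (fromZero (discObj k i)), .zero i.1 i.2⟩)
  refine ⟨small_of_surjective (f := φ) ?_⟩
  rintro ⟨⟨_, _, _⟩, ⟨i, hi⟩ | ⟨i, hi⟩⟩
  · exact ⟨Sum.inl ⟨i, hi⟩, rfl⟩
  · exact ⟨Sum.inr ⟨i, hi⟩, rfl⟩

attribute [local instance] Cardinal.fact_isRegular_aleph0 Cardinal.orderBotAleph0OrdToType

instance (P : ℤ → Prop) :
    IsCardinalForSmallObjectArgument (generators k P) Cardinal.aleph0.{u} where
  preservesColimit {A B X Y} i hi f hf := by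
    have : IsFinitelyPresentable.{u} A := by
      obtain _ | _ := hi <;> infer_instance
    infer_instance

instance (P : ℤ → Prop) : HasSmallObjectArgument.{u} (generators k P) :=
  ⟨.aleph0, inferInstance, inferInstance, inferInstance⟩

instance (P : ℤ → Prop) : IsWeakFactorizationSystem (surjLifts k P).llp (surjLifts k P) where
  rlp := by rw [← generators_rlp, rlp_llp_rlp]
  llp := rfl
  hasFactorization := by
    rw [← generators_rlp]
    infer_instance

end Bicomplex

namespace Bicomplex

open MorphismProperty HomotopicalAlgebra MonoidalCategory

variable {k : Type u} [CommRing k]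

/-! ### The total model structure -/

instance : (totWeakEquivalences k).HasTwoOutOfThreeProperty :=
  inferInstanceAs
    ((HomologicalComplex.quasiIso (ModuleCat.{u} k) (ComplexShape.down ℤ)).inverseImage
      (tot k)).HasTwoOutOfThreeProperty

lemma surjLifts_inf_totWeakEquivalences :
    surjLifts k (fun p => 0 < p) ⊓ totWeakEquivalences k = surjLifts k (fun _ => True) := by
  ext X Y f
  exact (surjLifts_top_iff f).symm

instance : (totTrivialMonos k).IsStableUnderCobaseChange :=
  inferInstanceAs (MorphismProperty.llp _).IsStableUnderCobaseChange

instance : IsStableUnderTransfiniteComposition.{u} (totTrivialMonos k) :=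
  inferInstanceAs (IsStableUnderTransfiniteComposition.{u} (MorphismProperty.llp _))

lemma llp_surjLifts_le_totTrivialMonos :
    (surjLifts k (fun p => 0 < p)).llp ≤ totTrivialMonos k := by
  rw [← generators_rlp, totTrivialMonos, le_llp_iff_le_rlp, rlp_llp_rlp, ← le_llp_iff_le_rlp]
  rintro _ _ _ (⟨i, hi⟩ | ⟨i, hi⟩)
  · exact (discSplitExact k i).totTrivialMonos (Or.inl ⟨rowHContraction i hi.ne'⟩)
  · exact (zeroSplitExact _).totTrivialMonos (Or.inr ⟨discVContraction k i⟩)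

/-- The retract argument: factor `f` through a fibration, which is a weak equivalence by
two-out-of-three. As `f` lifts against it, `f` is a retract of the first factor. -/
lemma llp_inf_totWeakEquivalences :
    (surjLifts k (fun _ => True)).llp ⊓ totWeakEquivalences k =
      (surjLifts k (fun p => 0 < p)).llp := by
  refine le_antisymm ?_ (le_inf (antitone_llp (surjLifts_mono fun _ _ => trivial))
    (llp_surjLifts_le_totTrivialMonos.trans totTrivialMonos_le))
  rintro X Y f ⟨hf, hf'⟩
  have h := factorizationData (surjLifts k (fun p => 0 < p)).llp (surjLifts k (fun p => 0 < p)) f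
  have hi : totWeakEquivalences k h.i := totTrivialMonos_le _ (llp_surjLifts_le_totTrivialMonos _ h.hi)
  have hp : totWeakEquivalences k h.p :=
    (totWeakEquivalences k).of_precomp h.i h.p hi (by rwa [h.fac])
  have := hf h.p ((surjLifts_top_iff _).2 ⟨h.hp, hp⟩)
  exact of_retract (RetractArrow.ofLeftLiftingProperty h.fac) h.hi

/-- The total model structure. -/
@[reducible]
def totModelCategory (k : Type u) [CommRing k] : ModelCategory (Bicomplex k) :=
  letI : CategoryWithFibrations (Bicomplex k) := ⟨totFibrations k⟩
  letI : CategoryWithCofibrations (Bicomplex k) := ⟨(surjLifts k (fun _ => True)).llp⟩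
  letI : CategoryWithWeakEquivalences (Bicomplex k) := ⟨totWeakEquivalences k⟩
  have : (weakEquivalences (Bicomplex k)).HasTwoOutOfThreeProperty :=
    inferInstanceAs (totWeakEquivalences k).HasTwoOutOfThreeProperty
  have h₁ : trivialFibrations (Bicomplex k) = surjLifts k (fun _ => True) := by
    refine Eq.trans ?_ surjLifts_inf_totWeakEquivalences
    rw [← totFibrations_eq]
    rfl
  have h₂ : trivialCofibrations (Bicomplex k) = (surjLifts k (fun p => 0 < p)).llp :=
    llp_inf_totWeakEquivalences
  have : IsWeakFactorizationSystem (cofibrations (Bicomplex k))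
      (trivialFibrations (Bicomplex k)) := by
    rw [h₁]
    exact inferInstanceAs (IsWeakFactorizationSystem (surjLifts k (fun _ => True)).llp _)
  have : IsWeakFactorizationSystem (trivialCofibrations (Bicomplex k))
      (fibrations (Bicomplex k)) := by
    rw [h₂]
    change IsWeakFactorizationSystem _ (totFibrations k)
    rw [totFibrations_eq]
    infer_instance
  ModelCategory.mk' _

attribute [local instance] totModelCategory

lemma trivialCofibrations_eq :
    trivialCofibrations (Bicomplex k) = (surjLifts k (fun p => 0 < p)).llp :=
  llp_inf_totWeakEquivalences

lemma isZero_tensorUnit (i : ℤ × ℤ) (hi : i ≠ 0) : IsZero ((tensorUnit k).X i) :=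
  (GradedObject.Monoidal.isInitialTensorUnitApply (C := ModuleCat.{u} k) i hi).isZero

instance (i : ℤ × ℤ) : Projective ((tensorUnit k).X i) := by
  by_cases hi : i = 0
  · subst hi
    have : Projective (ModuleCat.of k k) :=
      (IsProjective.iff_projective k).1 (inferInstanceAs (Module.Projective k k))
    exact Projective.of_iso
      (GradedObject.Monoidal.tensorUnit₀ (C := ModuleCat.{u} k) (I := ℤ × ℤ)).symm this
  · exact ((isZero_tensorUnit i hi).projective)

/-- The zero bicomplex is initial. -/
def isInitialZeroObj (k : Type u) [CommRing k] : IsInitial (zeroObj k) :=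
  IsInitial.ofUniqueHom fromZero fun _ g => fromZero_uniq g

/-- The unit is projective, in column zero, with zero vertical differential, so it lifts against the
trivial fibrations. -/
lemma isCofibrant_tensorUnit : IsCofibrant (𝟙_ (Bicomplex k)) := by
  rw [isCofibrant_iff_of_isInitial (fromZero (𝟙_ (Bicomplex k))) (isInitialZeroObj k),
    cofibration_iff]
  intro X Y p hp
  exact (zeroSplitExact (tensorUnit k)).hasLiftingProperty
    (fun q hq => exists_section_of_column_zero q (fun _ => rfl)
      (fun i hi => isZero_tensorUnit i (by rintro rfl; exact hi rfl)) hq) p hp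

lemma totTrivialMonos_whiskerRight_of_trivialCofibration {A B : Bicomplex k} (j : A ⟶ B)
    (hj : trivialCofibrations (Bicomplex k) j) (Z : Bicomplex k) :
    totTrivialMonos k (j ▷ Z) :=
  totTrivialMonos_whiskerRight (trivialCofibrations_eq (k := k) ▸ hj) Z

/-- Ken Brown's argument: `f` is a trivial cofibration followed by a retraction of a trivial
cofibration, and tensoring with any `Z` sends trivial cofibrations to weak equivalences. As the unit
is cofibrant, this contains the unit axiom. -/
lemma weakEquivalence_whiskerRight {A B : Bicomplex k} (f : A ⟶ B) [IsCofibrant A] [IsCofibrant B]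
    (hf : weakEquivalences (Bicomplex k) f) (Z : Bicomplex k) :
    weakEquivalences (Bicomplex k) (f ▷ Z) := by
  have : WeakEquivalence f := ⟨hf⟩
  obtain ⟨h⟩ := (inferInstance : Nonempty (CofibrantBrownFactorization f))
  have hi : Cofibration h.i := ⟨h.hi⟩
  have key {A B : Bicomplex k} (j : A ⟶ B) [Cofibration j] [WeakEquivalence j] :
      weakEquivalences (Bicomplex k) (j ▷ Z) :=
    totTrivialMonos_le _ (totTrivialMonos_whiskerRight_of_trivialCofibration j
      (mem_trivialCofibrations j) Z)
  have h₁ : weakEquivalences (Bicomplex k) (h.p ▷ Z) :=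
    (weakEquivalences (Bicomplex k)).of_precomp (h.s ▷ Z) (h.p ▷ Z) (key h.s) (by
      rw [← comp_whiskerRight, h.s_p, id_whiskerRight]
      exact id_mem _ _)
  rw [← h.fac, comp_whiskerRight]
  exact comp_mem _ _ _ (key h.i) h₁

lemma isMonoidalModelCategory : IsMonoidalModelCategory (Bicomplex k) where
  closed := ⟨inferInstance⟩
  cofibration_pushoutProduct _ _ hf hg := cofibration_pushoutProduct hf hg
  trivialCofibration_pushoutProduct_left _ _ hf hg := by
    rw [trivialCofibrations_eq] at hf ⊢
    exact trivialCofibration_pushoutProduct hf hg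
  trivialCofibration_pushoutProduct_right _ _ hf hg := by
    rw [trivialCofibrations_eq] at hg ⊢
    exact trivialCofibration_pushoutProduct' hf hg
  weakEquivalence_unit_left q X _ _ hq :=
    have := isCofibrant_tensorUnit (k := k)
    weakEquivalence_whiskerRight q hq X
  weakEquivalence_unit_right q X _ _ hq := by
    have := isCofibrant_tensorUnit (k := k)
    refine ((weakEquivalences (Bicomplex k)).arrow_mk_iso_iff ?_).1
      (weakEquivalence_whiskerRight q hq X)
    exact Arrow.isoMk (β_ _ _) (β_ _ _) (BraidedCategory.braiding_naturality_left q X).symm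

/-- The class `totTrivialMonos` contains all `j ⊗ Z`, is closed under the two operations, and
consists of weak equivalences. -/
lemma monoidAxiom : MonoidAxiom.{u} (Bicomplex k) := by
  have h : TrivialCofibrationsTensor (Bicomplex k) ≤ totTrivialMonos k := by
    rintro _ _ _ ⟨j, Z, hj⟩
    exact totTrivialMonos_whiskerRight_of_trivialCofibration j hj Z
  have h' : (TrivialCofibrationsTensor (Bicomplex k)).pushouts ≤ totTrivialMonos k := by
    rw [pushouts_le_iff]
    exact h
  refine le_trans ?_ (totTrivialMonos_le (k := k))
  rw [transfiniteCompositions_le_iff]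
  exact h'

end Bicomplex

end

open CategoryTheory HomotopicalAlgebra MonoidalCategory

theorem proposition3p3 (k : Type u) [CommRing k] :
    ∃ M : ModelCategory (Bicomplex k),
      (weakEquivalences (Bicomplex k) = Bicomplex.totWeakEquivalences k ∧
        fibrations (Bicomplex k) = Bicomplex.totFibrations k) ∧
      IsMonoidalModelCategory (Bicomplex k) ∧
      IsCofibrant (𝟙_ (Bicomplex k)) ∧
      MonoidAxiom.{u} (Bicomplex k) :=
  ⟨Bicomplex.totModelCategory k, ⟨rfl, rfl⟩, Bicomplex.isMonoidalModelCategory,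
    Bicomplex.isCofibrant_tensorUnit, Bicomplex.monoidAxiom⟩
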